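/- Let $X$ be a complex manifold of dimension $n$. Let $\mathfrak g=\bigoplus_{p,q}\Omega^{0,q}(X,\Lambda^pT)$, with $\Omega^{0,q}(X,\Lambda^pT)$ in degree $q-p+1$, be the differential graded Lie algebra with the Dolbeault differential $\bar\partial$ and the Schouten–Nijenhuis bracket extended by the exterior product of $(0,*)$-forms. For $\gamma\in\mathfrak g$ let $i_\gamma$ be the contraction of forms with $\Lambda^*T$, combined with left exterior multiplication by $(0,*)$-forms; signs are normalized so that $[\bar\partial,i_\gamma]=i_{\bar\partial\gamma}$ and $[[\partial,i_{\gamma_1}],i_{\gamma_2}]=i_{[\gamma_1,\gamma_2]}$. Let $R$ be a graded-commutative $\mathbb Z$-graded local Artin $\mathbb C$-algebra with residue field $\mathbb C$, or the limit of a tower of such algebras with surjective transition maps, with maximal ideal $\mathfrak M_R$ (tensor products with $R$ are completed). Let $MC(R)$ be the set of $\gamma\in(\mathfrak g[1]\otimes\mathfrak M_R)^0$ with $\bar\partial\gamma+\frac12[\gamma,\gamma]=0$, and let $\mathcal M(R)$ be its quotient by the gauge action of $\exp((\mathfrak g\otimes\mathfrak M_R)^0)$, generated by $\dot\gamma=\bar\partial\alpha+[\gamma,\alpha]$.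 Let $Der(R)$ be the space of continuous graded derivations of $R$ (sums of an even and an odd one). Let $\Omega^*(X,\mathbb C)[[\hbar^{-1},\hbar]]$ denote two-sided formal series in which even forms carry integral and odd forms half-integral powers of $\hbar$; the cohomology of $(\Omega^*(X,\mathbb C)[[\hbar^{-1},\hbar]]\otimes R,\ \hbar^{1/2}(\bar\partial+\partial))$ is written $H^*(X,\mathbb C)[[\hbar^{-1},\hbar]]\otimes R$. Let $l_\hbar\varphi^{p,q}=\hbar^{(q-p)/2}\varphi^{p,q}$. For $\phi\in\mathcal M(R)$ described by $\gamma\in MC(R)$, let $L(\phi)\subset H^*(X,\mathbb C)[[\hbar^{-1},\hbar]]\otimes R$ be the set of classes of cocycles of the form $$l_\hbar\exp(\tfrac1\hbar i_\gamma)(\varphi_0+\varphi_1\hbar+\varphi_2\hbar^2+\dots),\qquad \varphi_j\in\Omega^*(X,\mathbb C)\otimes R.$$ Let $\mathcal H^\hbar_\gamma$ be the cohomology of $(\Omega^{*,*}\otimes\mathbb C[[\hbar^{-1},\hbar]]\otimes R,\ \bar\partial+[\partial,i_\gamma]+\hbar\partial)$, with integral powers of $\hbar$. Then for every $\phi\in\mathcal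 M(R)$, every $\gamma\in MC(R)$ describing $\phi$ and every $v\in Der(R)$: 1. the operator $\nabla_v=\partial_v+\hbar^{-1}i_{\partial_v\gamma}$ induces a well-defined linear operator on $\mathcal H^\hbar_\gamma$ (the Gauss–Manin connection), the operator $l_\hbar\exp(\frac1\hbar i_\gamma)$ induces a linear isomorphism $P_\gamma:\mathcal H^\hbar_\gamma\to H^*(X,\mathbb C)[[\hbar^{-1},\hbar]]\otimes R$, and $P_\gamma\nabla_v=\partial_vP_\gamma$; 2. (semi-infinite Griffiths transversality) $\nabla L\subset\hbar^{-1}L$: if $P_\gamma x\in L(\phi)$, then $P_\gamma(\nabla_vx)\in\hbar^{-1}L(\phi)$; equivalently $\partial_vL(\phi)\subset\hbar^{-1}L(\phi)$. -/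

import Mathlib

open scoped TensorProduct Manifold ContDiff

noncomputable section

namespace SemiInfinite

/-! ### Fibres: the exterior algebra on `dz_1, …, dz_n, dz̄_1, …, dz̄_n` -/

/-- The model space `ℂⁿ`. -/
abbrev Cn (n : ℕ) : Type := Fin n → ℂ

/-- The exterior algebra over `ℂ` on `ℂⁿ ⊕ ℂⁿ`. It serves as the fibre, written in local
holomorphic coordinates, of two bundles:
* differential forms: `(ξ, η)` stands for `∑ ξ_i dz_i + ∑ η_i dz̄_i`;
* `(0,*)`-forms with values in polyvectors `Λ^*T`: `(a, η)` stands for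
  `∑ a_i ∂/∂z_i + ∑ η_i dz̄_i`. -/
abbrev Lam (n : ℕ) : Type := ExteriorAlgebra ℂ (Cn n × Cn n)

instance instFiniteLam (n : ℕ) : Module.Finite ℂ (Lam n) :=
  Module.Finite.of_basis (Module.finBasis ℂ (Cn n × Cn n)).ExteriorAlgebra

variable {n : ℕ}

/-- Generators of the first kind (`∑ a_i dz_i`, respectively `∑ a_i ∂/∂z_i`). -/
def gen₁ : Cn n →ₗ[ℂ] Lam n := ExteriorAlgebra.ι ℂ ∘ₗ LinearMap.inl ℂ (Cn n) (Cn n)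

/-- Generators of the second kind, `∑ b_i dz̄_i`. -/
def gen₂ : Cn n →ₗ[ℂ] Lam n := ExteriorAlgebra.ι ℂ ∘ₗ LinearMap.inr ℂ (Cn n) (Cn n)

/-- The functional `(ξ, η) ↦ ∑ a_i ξ_i`. -/
def pair₁ : Cn n →ₗ[ℂ] Module.Dual ℂ (Cn n × Cn n) :=
  LinearMap.mk₂ ℂ (fun a w => a ⬝ᵥ w.1) (by intros; simp [add_dotProduct])
    (by intros; simp [smul_dotProduct]) (by intros; simp [dotProduct_add])
    (by intros; simp [dotProduct_smul])

/-- The generators of polyvector-valued forms acting on forms: `∂/∂z_i` contracts, `dz̄_i`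
multiplies from the left. -/
def contrGen : Cn n × Cn n →ₗ[ℂ] Module.End ℂ (Lam n) :=
  CliffordAlgebra.contractLeft ∘ₗ pair₁ ∘ₗ LinearMap.fst ℂ (Cn n) (Cn n) +
    LinearMap.mul ℂ (Lam n) ∘ₗ gen₂ ∘ₗ LinearMap.snd ℂ (Cn n) (Cn n)

theorem contrGen_apply (w : Cn n × Cn n) (x : Lam n) :
    contrGen w x = CliffordAlgebra.contractLeft (pair₁ w.1) x + gen₂ w.2 * x := rfl

theorem contrGen_sq (w : Cn n × Cn n) : contrGen w * contrGen w = 0 := by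
  refine LinearMap.ext fun x => ?_
  have h2 : gen₂ w.2 * (gen₂ w.2 * x) = 0 := by
    rw [← mul_assoc]; simp [gen₂]
  have h3 : CliffordAlgebra.contractLeft (pair₁ w.1) (gen₂ w.2 * x) =
      - (gen₂ w.2 * CliffordAlgebra.contractLeft (pair₁ w.1) x) := by
    simp only [gen₂, LinearMap.comp_apply]
    erw [CliffordAlgebra.contractLeft_ι_mul]
    simp [pair₁]
  rw [Module.End.mul_apply, contrGen_apply, contrGen_apply, map_add, mul_add, h2, h3,
    CliffordAlgebra.contractLeft_contractLeft]
  simp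

/-- The contraction `γ ↦ i_γ` of forms with polyvector-valued `(0,*)`-forms: the algebra
morphism with `i_{∂/∂z_i}` the contraction and `i_{dz̄_i}` the left exterior multiplication. -/
def contr : Lam n →ₐ[ℂ] Module.End ℂ (Lam n) :=
  ExteriorAlgebra.lift ℂ ⟨contrGen, contrGen_sq⟩

/-- The generators placed in bidegrees `(1,0)` and `(0,1)`. -/
def bidegGen : Cn n × Cn n →ₗ[ℂ] AddMonoidAlgebra (Lam n) (ℕ × ℕ) :=
  AddMonoidAlgebra.lsingle (1, 0) ∘ₗ gen₁ ∘ₗ LinearMap.fst ℂ (Cn n) (Cn n) +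
    AddMonoidAlgebra.lsingle (0, 1) ∘ₗ gen₂ ∘ₗ LinearMap.snd ℂ (Cn n) (Cn n)

theorem bidegGen_sq (w : Cn n × Cn n) : bidegGen w * bidegGen w = 0 := by
  have h1 : gen₁ w.1 * gen₁ w.1 = 0 := by simp [gen₁]
  have h2 : gen₂ w.2 * gen₂ w.2 = 0 := by simp [gen₂]
  have h3 : gen₁ w.1 * gen₂ w.2 + gen₂ w.2 * gen₁ w.1 = 0 := by
    simp only [gen₁, gen₂, LinearMap.comp_apply]
    exact ExteriorAlgebra.ι_add_mul_swap _ _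
  have e : bidegGen w = AddMonoidAlgebra.single (1, 0) (gen₁ w.1) +
      AddMonoidAlgebra.single (0, 1) (gen₂ w.2) := rfl
  rw [e, add_mul, mul_add, mul_add]
  simp only [AddMonoidAlgebra.single_mul_single, h1, h2, Prod.mk_add_mk]
  simp only [AddMonoidAlgebra.single_zero, zero_add, add_zero]
  rw [← AddMonoidAlgebra.single_add, h3, AddMonoidAlgebra.single_zero]

/-- The component of bidegree `(p,q)`: `p` factors of the first and `q` of the second kind. -/
def comp (p q : ℕ) : Lam n →ₗ[ℂ] Lam n where
  toFun a := (ExteriorAlgebra.lift ℂ ⟨bidegGen, bidegGen_sq⟩ a).coeff (p, q)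
  map_add' a b := by simp
  map_smul' c a := by simp

/-- The parity involution `(-1)^{p+q}` of the exterior algebra. -/
def inv : Lam n →ₗ[ℂ] Lam n := (CliffordAlgebra.involute (Q := 0)).toLinearMap

/-- Left contraction by `dz_i` on polyvectors, i.e. the left derivative `∂/∂(∂/∂z_i)`. -/
def leftDer (i : Fin n) : Lam n →ₗ[ℂ] Lam n :=
  CliffordAlgebra.contractLeft (pair₁ (Pi.single i 1))

/-! ### Graded Artin algebras and their projective limits -/

universe u

/-- A `ℤ`-graded local Artin `ℂ`-algebra, commutative in the graded sense, with residue
field `ℂ`. -/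
structure GradedArtin where
  carrier : Type u
  [ring : Ring carrier]
  [algebra : Algebra ℂ carrier]
  [finite : Module.Finite ℂ carrier]
  gr : ℤ → Submodule ℂ carrier
  [graded : GradedAlgebra gr]
  comm : ∀ {i j : ℤ} {a b : carrier}, a ∈ gr i → b ∈ gr j →
    a * b = (i * j).negOnePow • (b * a)
  /-- the maximal ideal -/
  max : Ideal carrier
  max_homogeneous : ∀ (i : ℤ) {r : carrier}, r ∈ max → GradedRing.proj gr i r ∈ max
  residue : ∀ r : carrier, ∃! c : ℂ, r - algebraMap ℂ carrier c ∈ max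
  max_nilpotent : ∃ N : ℕ, (max.restrictScalars ℂ) ^ N = ⊥

attribute [instance] GradedArtin.ring GradedArtin.algebra GradedArtin.finite GradedArtin.graded

/-- The even part of an element of a graded Artin algebra. -/
def GradedArtin.evenPart (A : GradedArtin.{u}) : A.carrier →ₗ[ℂ] A.carrier :=
  DirectSum.toModule ℂ ℤ A.carrier (fun k => if Even k then (A.gr k).subtype else 0) ∘ₗ
    (DirectSum.decomposeLinearEquiv A.gr).toLinearMap

/-- The odd part of an element of a graded Artin algebra. -/
def GradedArtin.oddPart (A : GradedArtin.{u}) : A.carrier →ₗ[ℂ] A.carrier :=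
  LinearMap.id - A.evenPart

/-- A pro-Artin algebra `R = lim R_i`: a tower of graded Artin algebras with surjective graded
transition morphisms. A constant tower is a graded Artin algebra. -/
structure ProArtin where
  level : ℕ → GradedArtin.{u}
  map : ∀ {i j : ℕ}, i ≤ j → (level j).carrier →ₐ[ℂ] (level i).carrier
  map_id : ∀ (i : ℕ) (r : (level i).carrier), map (le_refl i) r = r
  map_map : ∀ {i j k : ℕ} (hij : i ≤ j) (hjk : j ≤ k) (r : (level k).carrier),
    map hij (map hjk r) = map (hij.trans hjk) r
  map_surjective : ∀ {i j : ℕ} (h : i ≤ j), Function.Surjective (map h)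
  map_gr : ∀ {i j : ℕ} (h : i ≤ j) (d : ℤ) {r : (level j).carrier},
    r ∈ (level j).gr d → map h r ∈ (level i).gr d

/-- A graded Artin algebra as a (constant) pro-Artin algebra. -/
def GradedArtin.toPro (A : GradedArtin.{u}) : ProArtin.{u} where
  level _ := A
  map _ := AlgHom.id ℂ A.carrier
  map_id _ _ := rfl
  map_map _ _ _ := rfl
  map_surjective _ := Function.surjective_id
  map_gr _ _ _ h := h

/-- A vector field `v ∈ Der(R)`: a continuous derivation of `R = lim R_i`, in the graded sense,
written as the sum of its even and its odd part. By continuity, `v r` modulo the `i`-th level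
depends only on `r` modulo some level `shift i`. -/
structure ProArtin.Der (R : ProArtin.{u}) where
  shift : ℕ → ℕ
  le_shift : ∀ i, i ≤ shift i
  even : ∀ i, (R.level (shift i)).carrier →ₗ[ℂ] (R.level i).carrier
  odd : ∀ i, (R.level (shift i)).carrier →ₗ[ℂ] (R.level i).carrier
  even_compat : ∀ {i j m : ℕ} (h : i ≤ j) (hi : shift i ≤ m) (hj : shift j ≤ m)
    (r : (R.level m).carrier), R.map h (even j (R.map hj r)) = even i (R.map hi r)
  odd_compat : ∀ {i j m : ℕ} (h : i ≤ j) (hi : shift i ≤ m) (hj : shift j ≤ m)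
    (r : (R.level m).carrier), R.map h (odd j (R.map hj r)) = odd i (R.map hi r)
  even_parity : ∀ i r, even i ((R.level (shift i)).evenPart r) = (R.level i).evenPart (even i r)
  odd_parity : ∀ i r, odd i ((R.level (shift i)).evenPart r) = (R.level i).oddPart (odd i r)
  even_mul : ∀ i r s, even i (r * s) =
    even i r * R.map (le_shift i) s + R.map (le_shift i) r * even i s
  odd_mul : ∀ i r s, odd i (r * s) = odd i r * R.map (le_shift i) s +
    R.map (le_shift i)
      ((R.level (shift i)).evenPart r - (R.level (shift i)).oddPart r) * odd i s

/-- The fibre with coefficients in a graded Artin algebra. -/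
abbrev Fib (n : ℕ) (A : GradedArtin.{u}) : Type u := Lam n ⊗[ℂ] A.carrier

variable {A : GradedArtin.{u}}

/-- The extension of an even bilinear operation on `Lam n` to coefficients in `A`, with the Koszul
sign: `(a ⊗ r) ⋆ (b ⊗ s) = (-1)^{|r||b|} (a ⋆ b) ⊗ r s`. -/
def koszul (f : Lam n →ₗ[ℂ] Lam n →ₗ[ℂ] Lam n) : Fib n A →ₗ[ℂ] Fib n A →ₗ[ℂ] Fib n A :=
  TensorProduct.map₂ f (LinearMap.mul ℂ A.carrier ∘ₗ A.evenPart) +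
    TensorProduct.map₂ (f.compl₂ inv) (LinearMap.mul ℂ A.carrier ∘ₗ A.oddPart)

/-- The product of `Lam n ⊗ A`. -/
def fibMul : Fib n A →ₗ[ℂ] Fib n A →ₗ[ℂ] Fib n A := koszul (LinearMap.mul ℂ (Lam n))

/-- The contraction `i_γ` with coefficients in `A`. -/
def fibContr : Fib n A →ₗ[ℂ] Fib n A →ₗ[ℂ] Fib n A := koszul contr.toLinearMap

/-- The even part of an element of `Lam n ⊗ A` for the total parity. -/
def fibEven : Fib n A →ₗ[ℂ] Fib n A :=
  (2⁻¹ : ℂ) • (LinearMap.id + TensorProduct.map inv (A.evenPart - A.oddPart))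

/-- The odd part of an element of `Lam n ⊗ A` for the total parity. -/
def fibOdd : Fib n A →ₗ[ℂ] Fib n A :=
  (2⁻¹ : ℂ) • (LinearMap.id - TensorProduct.map inv (A.evenPart - A.oddPart))

/-- `(𝔤[1] ⊗ 𝔐_A)^d`: spanned by the `a ⊗ r` with `a ∈ Ω^{0,q}(Λ^p T)`, `r` in the maximal ideal
and `(q - p) + deg r = d`. -/
def polyDeg (n : ℕ) (A : GradedArtin.{u}) (d : ℤ) : Submodule ℂ (Fib n A) :=
  Submodule.span ℂ {t | ∃ (p q : ℕ) (a : Lam n) (r : A.carrier),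
    r ∈ A.gr (d + p - q) ∧ r ∈ A.max ∧ t = comp p q a ⊗ₜ[ℂ] r}

/-! ### Fields on a complex manifold

A field is written, at each point `x`, in the preferred chart at `x`. -/

section Fields

variable {X : Type*} [TopologicalSpace X] [ChartedSpace (Cn n) X] [IsManifold 𝓘(ℂ, Cn n) ω X]

/-- The Jacobian matrix `∂z_b/∂z_a` at `x` of the coordinates of the chart at `b` with respect to
those of the chart at `a`. -/
def jac (a b x : X) : Matrix (Fin n) (Fin n) ℂ :=
  LinearMap.toMatrix' (tangentCoordChange 𝓘(ℂ, Cn n) a b x).toLinearMap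

/-- Rewriting `dz`, `dz̄` from the chart at `x` to the chart at `x₀`, at the point `x`. -/
def formChange (x₀ x : X) : Cn n × Cn n →ₗ[ℂ] Cn n × Cn n :=
  LinearMap.prodMap (Matrix.toLin' (jac x₀ x x).transpose)
    (Matrix.toLin' (jac x₀ x x).conjTranspose)

/-- Rewriting `∂/∂z`, `dz̄` from the chart at `x` to the chart at `x₀`, at the point `x`. -/
def polyChange (x₀ x : X) : Cn n × Cn n →ₗ[ℂ] Cn n × Cn n :=
  LinearMap.prodMap (Matrix.toLin' (jac x x₀ x)) (Matrix.toLin' (jac x₀ x x).conjTranspose)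

/-- The expression in the chart at `x₀` of a field that transforms by `T`. -/
def read (T : X → X → Cn n × Cn n →ₗ[ℂ] Cn n × Cn n) (x₀ : X) (s : X → Fib n A) (y : Cn n) :
    Fib n A :=
  (ExteriorAlgebra.map (T x₀ ((chartAt (Cn n) x₀).symm y))).toLinearMap.rTensor A.carrier
    (s ((chartAt (Cn n) x₀).symm y))

/-- Linear coordinates on a finite-dimensional complex vector space. -/
def coords (W : Type*) [AddCommGroup W] [Module ℂ W] [Module.Finite ℂ W] :
    W ≃ₗ[ℂ] (Fin (Module.finrank ℂ W) → ℂ) :=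
  (Module.finBasis ℂ W).equivFun

/-- The (real) derivative at `y` in the direction `u` of a function with values in a
finite-dimensional complex vector space. -/
def dirDeriv {W : Type*} [AddCommGroup W] [Module ℂ W] [Module.Finite ℂ W]
    (f : Cn n → W) (y u : Cn n) : W :=
  (coords W).symm (fderiv ℝ (fun z => coords W (f z)) y u)

/-- `∂f/∂z_i` -/
def dz {W : Type*} [AddCommGroup W] [Module ℂ W] [Module.Finite ℂ W]
    (f : Cn n → W) (y : Cn n) (i : Fin n) : W :=
  (2⁻¹ : ℂ) • (dirDeriv f y (Pi.single i 1) - Complex.I • dirDeriv f y (Pi.single i Complex.I))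

/-- `∂f/∂z̄_i` -/
def dzbar {W : Type*} [AddCommGroup W] [Module ℂ W] [Module.Finite ℂ W]
    (f : Cn n → W) (y : Cn n) (i : Fin n) : W :=
  (2⁻¹ : ℂ) • (dirDeriv f y (Pi.single i 1) + Complex.I • dirDeriv f y (Pi.single i Complex.I))

/-- Left multiplication by an element of `Lam n` on `Lam n ⊗ A`. -/
def lmul (a : Lam n) : Fib n A →ₗ[ℂ] Fib n A := (LinearMap.mul ℂ (Lam n) a).rTensor A.carrier

/-- Smoothness (in the real sense) of a field that transforms by `T`. -/
def IsSmooth (T : X → X → Cn n × Cn n →ₗ[ℂ] Cn n × Cn n) (s : X → Fib n A) : Prop :=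
  ∀ x₀ : X, ContDiffOn ℝ ∞ (fun y => coords (Fib n A) (read T x₀ s y)) (chartAt (Cn n) x₀).target

/-- The operator `∂ = ∑ dz_i ∧ ∂/∂z_i` on forms. -/
def del (s : X → Fib n A) (x : X) : Fib n A :=
  ∑ i, lmul (gen₁ (Pi.single i 1)) (dz (read formChange x s) (chartAt (Cn n) x x) i)

/-- The operator `∂̄ = ∑ dz̄_i ∧ ∂/∂z̄_i` on forms. -/
def delbar (s : X → Fib n A) (x : X) : Fib n A :=
  ∑ i, lmul (gen₂ (Pi.single i 1)) (dzbar (read formChange x s) (chartAt (Cn n) x x) i)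

/-- The Dolbeault operator `∂̄ = ∑ dz̄_i ∧ ∂/∂z̄_i` on polyvector-valued `(0,*)`-forms, with respect
to the holomorphic frame `∂/∂z_i`. -/
def polyDelbar (s : X → Fib n A) (x : X) : Fib n A :=
  ∑ i, lmul (gen₂ (Pi.single i 1)) (dzbar (read polyChange x s) (chartAt (Cn n) x x) i)

/-- One half of the bracket: `∑ ∂α/∂(∂/∂z_i) · ∂β/∂z_i`. -/
def halfSchouten (α β : X → Fib n A) (x : X) : Fib n A :=
  ∑ i, fibMul ((leftDer i).rTensor A.carrier (α x))
    (dz (read polyChange x β) (chartAt (Cn n) x x) i)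

/-- The Schouten–Nijenhuis bracket extended by the exterior product of `(0,*)`-forms, in local
coordinates, where `|·|` is the degree in `𝔤[1]`:
`[α,β] = ∑ ∂α/∂(∂/∂z_i) · ∂β/∂z_i + (-1)^{|α||β|} ∑ ∂β/∂(∂/∂z_i) · ∂α/∂z_i`. For vector fields
it is the Lie bracket, and `[v,f] = v(f)`. With this normalization
`[[∂, i_α], i_β] = i_{[α,β]}`. -/
def schouten (α β : X → Fib n A) (x : X) : Fib n A :=
  halfSchouten α β x + halfSchouten β (fun y => fibEven (α y)) x +
    halfSchouten (fun y => fibEven (β y) - fibOdd (β y)) (fun y => fibOdd (α y)) x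

/-! Linearity of these operations on smooth fields. -/

section Linearity

variable {W W' : Type*} [AddCommGroup W] [Module ℂ W] [Module.Finite ℂ W]
  [AddCommGroup W'] [Module ℂ W'] [Module.Finite ℂ W']

/-- Differentiability in linear coordinates. -/
def DiffAt (f : Cn n → W) (y : Cn n) : Prop := DifferentiableAt ℝ (fun z => coords W (f z)) y

/-- A complex-linear map in linear coordinates, as a real continuous linear map. -/
def coordMap (L : W →ₗ[ℂ] W') :
    (Fin (Module.finrank ℂ W) → ℂ) →L[ℝ] (Fin (Module.finrank ℂ W') → ℂ) :=
  (LinearMap.toContinuousLinearMap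
    ((coords W').toLinearMap ∘ₗ L ∘ₗ (coords W).symm.toLinearMap)).restrictScalars ℝ

theorem coordMap_apply (L : W →ₗ[ℂ] W') (w : W) : coordMap L (coords W w) = coords W' (L w) := by
  simp [coordMap]

theorem dirDeriv_linear (L : W →ₗ[ℂ] W') {f : Cn n → W} {y : Cn n} (hf : DiffAt f y) (u : Cn n) :
    dirDeriv (fun z => L (f z)) y u = L (dirDeriv f y u) := by
  have h1 : (fun z => coords W' (L (f z))) = fun z => coordMap L (coords W (f z)) := by
    funext z; rw [coordMap_apply]
  have h2 : HasFDerivAt (fun z => coordMap L (coords W (f z)))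
      ((coordMap L).comp (fderiv ℝ (fun z => coords W (f z)) y)) y :=
    (coordMap L).hasFDerivAt.comp y hf.hasFDerivAt
  unfold dirDeriv
  rw [h1, h2.fderiv, LinearEquiv.symm_apply_eq, ← coordMap_apply]
  simp

theorem dirDeriv_add {f g : Cn n → W} {y : Cn n} (hf : DiffAt f y) (hg : DiffAt g y) (u : Cn n) :
    dirDeriv (fun z => f z + g z) y u = dirDeriv f y u + dirDeriv g y u := by
  have h : (fun z => coords W (f z + g z)) =
      (fun z => coords W (f z)) + fun z => coords W (g z) := by funext z; simp
  unfold dirDeriv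
  rw [h, fderiv_add hf hg]
  simp

theorem dz_linear (L : W →ₗ[ℂ] W') {f : Cn n → W} {y : Cn n} (hf : DiffAt f y) (i : Fin n) :
    dz (fun z => L (f z)) y i = L (dz f y i) := by
  simp [dz, dirDeriv_linear L hf]

theorem dzbar_linear (L : W →ₗ[ℂ] W') {f : Cn n → W} {y : Cn n} (hf : DiffAt f y) (i : Fin n) :
    dzbar (fun z => L (f z)) y i = L (dzbar f y i) := by
  simp [dzbar, dirDeriv_linear L hf]

theorem dz_add {f g : Cn n → W} {y : Cn n} (hf : DiffAt f y) (hg : DiffAt g y) (i : Fin n) :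
    dz (fun z => f z + g z) y i = dz f y i + dz g y i := by
  simp only [dz, dirDeriv_add hf hg, smul_add, smul_sub]
  abel

theorem dzbar_add {f g : Cn n → W} {y : Cn n} (hf : DiffAt f y) (hg : DiffAt g y) (i : Fin n) :
    dzbar (fun z => f z + g z) y i = dzbar f y i + dzbar g y i := by
  simp only [dzbar, dirDeriv_add hf hg, smul_add]
  abel

end Linearity

section Smooth

variable {T : X → X → Cn n × Cn n →ₗ[ℂ] Cn n × Cn n} {s t : X → Fib n A}
  {B : GradedArtin.{u}}

theorem IsSmooth.diffAt (h : IsSmooth T s) (x : X) :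
    DiffAt (read T x s) (chartAt (Cn n) x x) :=
  ((h x).contDiffAt ((chartAt (Cn n) x).open_target.mem_nhds
    (mem_chart_target (Cn n) x))).differentiableAt (by simp)

theorem read_add (x : X) : read T x (s + t) = fun y => read T x s y + read T x t y := by
  funext y; simp [read]

theorem IsSmooth.add (hs : IsSmooth T s) (ht : IsSmooth T t) : IsSmooth T (s + t) := by
  intro x
  simp only [read_add, map_add]
  exact (hs x).add (ht x)

theorem IsSmooth.zero : IsSmooth T (0 : X → Fib n A) := by
  intro x
  have : (fun y => coords (Fib n A) (read T x (0 : X → Fib n A) y)) = fun _ => 0 := by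
    funext y; simp [read]
  rw [this]
  exact contDiffOn_const

/-- Application of `L ⊗ f` to the values of a field, for `L` that commutes with changes of
coordinates. -/
theorem read_map (L : Lam n →ₗ[ℂ] Lam n) (f : A.carrier →ₗ[ℂ] B.carrier)
    (hL : ∀ g : Cn n × Cn n →ₗ[ℂ] Cn n × Cn n,
      (ExteriorAlgebra.map g).toLinearMap ∘ₗ L = L ∘ₗ (ExteriorAlgebra.map g).toLinearMap)
    (x : X) : read T x (fun z => TensorProduct.map L f (s z)) =
      fun y => TensorProduct.map L f (read T x s y) := by
  funext y
  simp only [read, ← LinearMap.comp_apply, LinearMap.rTensor_comp_map, LinearMap.map_comp_rTensor,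
    hL]

theorem IsSmooth.map (L : Lam n →ₗ[ℂ] Lam n) (f : A.carrier →ₗ[ℂ] B.carrier)
    (hL : ∀ g : Cn n × Cn n →ₗ[ℂ] Cn n × Cn n,
      (ExteriorAlgebra.map g).toLinearMap ∘ₗ L = L ∘ₗ (ExteriorAlgebra.map g).toLinearMap)
    (hs : IsSmooth T s) : IsSmooth T (fun z => TensorProduct.map L f (s z)) := by
  intro x
  simp only [read_map L f hL, ← coordMap_apply]
  exact (coordMap (TensorProduct.map L f)).contDiff.comp_contDiffOn (hs x)

theorem map_comp_id (g : Cn n × Cn n →ₗ[ℂ] Cn n × Cn n) :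
    (ExteriorAlgebra.map g).toLinearMap ∘ₗ LinearMap.id =
      LinearMap.id ∘ₗ (ExteriorAlgebra.map g).toLinearMap := rfl

theorem map_comp_inv (g : Cn n × Cn n →ₗ[ℂ] Cn n × Cn n) :
    (ExteriorAlgebra.map g).toLinearMap ∘ₗ inv = inv ∘ₗ (ExteriorAlgebra.map g).toLinearMap := by
  have : (ExteriorAlgebra.map g).comp (CliffordAlgebra.involute (Q := 0)) =
      (CliffordAlgebra.involute (Q := 0)).comp (ExteriorAlgebra.map g) := by
    apply ExteriorAlgebra.hom_ext
    ext v <;> simp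
  exact congrArg AlgHom.toLinearMap this

theorem IsSmooth.smul (c : ℂ) (hs : IsSmooth T s) : IsSmooth T (c • s) := by
  have h := hs.map (c • LinearMap.id) LinearMap.id (by intro g; ext; simp)
  convert h using 1
  funext z
  simp [TensorProduct.map_smul_left]

theorem del_add (hs : IsSmooth formChange s) (ht : IsSmooth formChange t) :
    del (s + t) = del s + del t := by
  funext x
  simp only [del, read_add, dz_add (hs.diffAt x) (ht.diffAt x), map_add, Finset.sum_add_distrib,
    Pi.add_apply]

theorem delbar_add (hs : IsSmooth formChange s) (ht : IsSmooth formChange t) :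
    delbar (s + t) = delbar s + delbar t := by
  funext x
  simp only [delbar, read_add, dzbar_add (hs.diffAt x) (ht.diffAt x), map_add,
    Finset.sum_add_distrib, Pi.add_apply]

theorem lmul_map (L : Lam n →ₗ[ℂ] Lam n) (f : A.carrier →ₗ[ℂ] B.carrier) (a : Lam n) (c : ℂ)
    (hL : ∀ b, a * L b = c • L (a * b)) (w : Fib n A) :
    lmul a (TensorProduct.map L f w) = c • TensorProduct.map L f (lmul a w) := by
  induction w using TensorProduct.induction_on with
  | zero => simp
  | tmul b r => simp [lmul, hL, TensorProduct.smul_tmul']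
  | add w w' h h' => simp only [map_add, h, h', smul_add]

theorem del_map (L : Lam n →ₗ[ℂ] Lam n) (f : A.carrier →ₗ[ℂ] B.carrier) (c : ℂ)
    (hL : ∀ g : Cn n × Cn n →ₗ[ℂ] Cn n × Cn n,
      (ExteriorAlgebra.map g).toLinearMap ∘ₗ L = L ∘ₗ (ExteriorAlgebra.map g).toLinearMap)
    (hc : ∀ v b, ExteriorAlgebra.ι ℂ v * L b = c • L (ExteriorAlgebra.ι ℂ v * b))
    (hs : IsSmooth formChange s) :
    del (fun z => TensorProduct.map L f (s z)) =
      fun x => c • TensorProduct.map L f (del s x) := by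
  funext x
  simp only [del, read_map L f hL, dz_linear (TensorProduct.map L f) (hs.diffAt x), map_sum,
    Finset.smul_sum]
  refine Finset.sum_congr rfl fun i _ => lmul_map L f _ c (fun b => hc _ b) _

theorem delbar_map (L : Lam n →ₗ[ℂ] Lam n) (f : A.carrier →ₗ[ℂ] B.carrier) (c : ℂ)
    (hL : ∀ g : Cn n × Cn n →ₗ[ℂ] Cn n × Cn n,
      (ExteriorAlgebra.map g).toLinearMap ∘ₗ L = L ∘ₗ (ExteriorAlgebra.map g).toLinearMap)
    (hc : ∀ v b, ExteriorAlgebra.ι ℂ v * L b = c • L (ExteriorAlgebra.ι ℂ v * b))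
    (hs : IsSmooth formChange s) :
    delbar (fun z => TensorProduct.map L f (s z)) =
      fun x => c • TensorProduct.map L f (delbar s x) := by
  funext x
  simp only [delbar, read_map L f hL, dzbar_linear (TensorProduct.map L f) (hs.diffAt x), map_sum,
    Finset.smul_sum]
  refine Finset.sum_congr rfl fun i _ => lmul_map L f _ c (fun b => hc _ b) _

end Smooth

section Contraction

theorem map_contractLeft (g : Cn n × Cn n →ₗ[ℂ] Cn n × Cn n) (d d' : Module.Dual ℂ (Cn n × Cn n))
    (h : ∀ w, d' (g w) = d w) (b : Lam n) :
    ExteriorAlgebra.map g (CliffordAlgebra.contractLeft d b) =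
      CliffordAlgebra.contractLeft d' (ExteriorAlgebra.map g b) := by
  induction b using CliffordAlgebra.left_induction with
  | algebraMap r =>
    rw [AlgHom.commutes, CliffordAlgebra.contractLeft_algebraMap,
      CliffordAlgebra.contractLeft_algebraMap, map_zero]
  | add x y hx hy => simp only [map_add, hx, hy]
  | ι_mul x v hx =>
    have e : ExteriorAlgebra.map g (CliffordAlgebra.ι 0 v) = CliffordAlgebra.ι 0 (g v) :=
      ExteriorAlgebra.map_apply_ι g v
    rw [CliffordAlgebra.contractLeft_ι_mul, map_sub, map_smul, map_mul, map_mul, hx, e,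
      CliffordAlgebra.contractLeft_ι_mul, h]

theorem map_contr (f g : Cn n × Cn n →ₗ[ℂ] Cn n × Cn n)
    (h₁ : ∀ v w, pair₁ (f v).1 (g w) = pair₁ v.1 w)
    (h₂ : ∀ v, g (0, v.2) = (0, (f v).2)) (a b : Lam n) :
    ExteriorAlgebra.map g (contr a b) =
      contr (ExteriorAlgebra.map f a) (ExteriorAlgebra.map g b) := by
  induction a using CliffordAlgebra.left_induction generalizing b with
  | algebraMap r =>
    simp [AlgHom.commutes, Module.algebraMap_end_apply]
  | add x y hx hy => simp only [map_add, LinearMap.add_apply, hx, hy]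
  | ι_mul x v hx =>
    have e : ∀ u : Cn n × Cn n, contr (CliffordAlgebra.ι 0 u) = contrGen u := fun u =>
      ExteriorAlgebra.lift_ι_apply ℂ contrGen contrGen_sq u
    have e' : ExteriorAlgebra.map f (CliffordAlgebra.ι 0 v) = CliffordAlgebra.ι 0 (f v) :=
      ExteriorAlgebra.map_apply_ι f v
    have e₂ : ExteriorAlgebra.map g (gen₂ v.2) = gen₂ (f v).2 := by
      simp only [gen₂, LinearMap.comp_apply, LinearMap.inr_apply, ExteriorAlgebra.map_apply_ι, h₂]
    rw [map_mul, map_mul, map_mul, e, e', e, Module.End.mul_apply, Module.End.mul_apply,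
      contrGen_apply, contrGen_apply, map_add, map_mul, hx, e₂,
      map_contractLeft g _ (pair₁ (f v).1) (h₁ v), hx]

theorem jac_mul_jac {x₀ x : X} (h : x ∈ (chartAt (Cn n) x₀).source) :
    (jac x₀ x x * jac x x₀ x : Matrix (Fin n) (Fin n) ℂ) = 1 := by
  have h₁ : x ∈ (extChartAt 𝓘(ℂ, Cn n) x).source := mem_extChartAt_source x
  have h₂ : x ∈ (extChartAt 𝓘(ℂ, Cn n) x₀).source := by rwa [extChartAt_source]
  rw [jac, jac, ← LinearMap.toMatrix'_comp, ← LinearMap.toMatrix'_id]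
  congr 1
  refine LinearMap.ext fun v => ?_
  exact (tangentCoordChange_comp ⟨⟨h₁, h₂⟩, h₁⟩).trans (tangentCoordChange_self h₁)

theorem map_contr_change {x₀ x : X} (h : x ∈ (chartAt (Cn n) x₀).source) (a b : Lam n) :
    ExteriorAlgebra.map (formChange x₀ x) (contr a b) =
      contr (ExteriorAlgebra.map (polyChange x₀ x) a)
        (ExteriorAlgebra.map (formChange x₀ x) b) := by
  refine map_contr _ _ (fun v w => ?_) (fun v => ?_) a b
  · change (jac x x₀ x).mulVec v.1 ⬝ᵥ (jac x₀ x x).transpose.mulVec w.1 = v.1 ⬝ᵥ w.1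
    rw [Matrix.dotProduct_mulVec, Matrix.vecMul_transpose, Matrix.mulVec_mulVec, jac_mul_jac h,
      Matrix.one_mulVec]
  · simp [formChange, polyChange]

theorem read_contr (γ s : X → Fib n A) {x₀ : X} {y : Cn n} (h : y ∈ (chartAt (Cn n) x₀).target) :
    read formChange x₀ (fun z => fibContr (γ z) (s z)) y =
      fibContr (read polyChange x₀ γ y) (read formChange x₀ s y) := by
  have hx : (chartAt (Cn n) x₀).symm y ∈ (chartAt (Cn n) x₀).source :=
    (chartAt (Cn n) x₀).map_target h
  simp only [read]
  generalize (chartAt (Cn n) x₀).symm y = x at hx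
  generalize γ x = a
  generalize s x = b
  have hinv : ∀ b : Lam n, ExteriorAlgebra.map (formChange x₀ x) (inv b) =
      inv (ExteriorAlgebra.map (formChange x₀ x) b) := fun b =>
    LinearMap.congr_fun (map_comp_inv (formChange x₀ x)) b
  induction a using TensorProduct.induction_on with
  | zero => simp
  | add a a' ha ha' => simp only [map_add, LinearMap.add_apply, ha, ha']
  | tmul a r =>
    induction b using TensorProduct.induction_on with
    | zero => simp
    | add b b' hb hb' => simp only [map_add, hb, hb']
    | tmul b r' =>
      simp [fibContr, koszul, TensorProduct.map₂_apply_tmul, map_contr_change hx, hinv]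

/-- A bilinear map in linear coordinates. -/
theorem contDiffOn_bilin {W : Type*} [AddCommGroup W] [Module ℂ W] [Module.Finite ℂ W]
    (F : W →ₗ[ℂ] W →ₗ[ℂ] W) {f g : Cn n → W} {U : Set (Cn n)}
    (hf : ContDiffOn ℝ ∞ (fun y => coords W (f y)) U)
    (hg : ContDiffOn ℝ ∞ (fun y => coords W (g y)) U) :
    ContDiffOn ℝ ∞ (fun y => coords W (F (f y) (g y))) U := by
  let N := Fin (Module.finrank ℂ W) → ℂ
  let G : N →ₗ[ℂ] N →ₗ[ℂ] N :=
    LinearMap.mk₂ ℂ (fun a b => coords W (F ((coords W).symm a) ((coords W).symm b)))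
      (by intros; simp) (by intros; simp) (by intros; simp) (by intros; simp)
  let G' : N →L[ℂ] N →L[ℂ] N := LinearMap.toContinuousLinearMap
    ((LinearMap.toContinuousLinearMap (𝕜 := ℂ) (E := N) (F' := N)).toLinearMap ∘ₗ G)
  have hG : ContDiff ℝ ∞ (fun p : N × N => G' p.1 p.2) :=
    (G'.isBoundedBilinearMap.contDiff (n := ∞)).restrict_scalars ℝ
  have := hG.comp_contDiffOn (hf.prodMk hg)
  convert this using 1
  funext y
  simp [G', G]

theorem IsSmooth.contr {γ s : X → Fib n A} (hγ : IsSmooth polyChange γ)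
    (hs : IsSmooth formChange s) : IsSmooth formChange (fun z => fibContr (γ z) (s z)) := by
  intro x₀
  refine (contDiffOn_bilin fibContr (hγ x₀) (hs x₀)).congr fun y hy => ?_
  rw [read_contr γ s hy]

end Contraction

end Fields

/-! ### Forms and polyvector fields with coefficients in a pro-Artin algebra -/

section Families

variable (n) (X : Type*) [TopologicalSpace X] [ChartedSpace (Cn n) X]
  [IsManifold 𝓘(ℂ, Cn n) ω X] (R : ProArtin.{u})

/-- Families of fields over the levels of `R`. -/
abbrev Fam := ∀ i : ℕ, X → Fib n (R.level i)

variable {n X R}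

/-- Compatibility with the transition maps of `R`. -/
def IsCompat (s : Fam n X R) : Prop :=
  ∀ (i j : ℕ) (h : i ≤ j) (x : X), (R.map h).toLinearMap.lTensor (Lam n) (s j x) = s i x

variable (n X R)

/-- `Ω^*(X,ℂ) ⊗̂ R = lim Ω^*(X,ℂ) ⊗ R_i`. As each `R_i` is finite-dimensional, an element of
`Ω^*(X,ℂ) ⊗ R_i` is a smooth section of the bundle of forms tensored with `R_i`. -/
def forms : Submodule ℂ (Fam n X R) where
  carrier := {s | (∀ i, IsSmooth formChange (s i)) ∧ IsCompat s}
  add_mem' {s t} hs ht := by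
    refine ⟨fun i => (hs.1 i).add (ht.1 i), fun i j h x => ?_⟩
    simp only [Pi.add_apply, map_add, hs.2 i j h x, ht.2 i j h x]
  zero_mem' := ⟨fun i => IsSmooth.zero, fun i j h x => by simp⟩
  smul_mem' c s hs := by
    refine ⟨fun i => (hs.1 i).smul c, fun i j h x => ?_⟩
    simp only [Pi.smul_apply, map_smul, hs.2 i j h x]

/-- `γ ∈ (𝔤[1] ⊗̂ 𝔐_R)^d` for `𝔤 = ⊕ Ω^{0,q}(X, Λ^p T)`, where `Ω^{0,q}(X, Λ^p T)` has degree
`q - p` in `𝔤[1]`. -/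
def IsPolyField (d : ℤ) (γ : Fam n X R) : Prop :=
  (∀ i, IsSmooth polyChange (γ i)) ∧ IsCompat γ ∧ ∀ i x, γ i x ∈ polyDeg n (R.level i) d

/-- `MC(R)`: the elements `γ ∈ (𝔤[1] ⊗̂ 𝔐_R)^0` with `∂̄γ + ½[γ,γ] = 0`. -/
structure MC where
  val : Fam n X R
  isPolyField : IsPolyField n X R 0 val
  maurerCartan : ∀ i x, polyDelbar (val i) x + (2⁻¹ : ℂ) • schouten (val i) (val i) x = 0

variable {n X R}

/-- The gauge transformation of `γ` by `exp α`, the time-one flow of `γ̇ = ∂̄α + [γ,α]`: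
`∑_k ((ad α)^k ∂̄α / (k+1)! + (ad α)^k γ / k!)`, where `ad α = [·, α]`. The sum is finite at
each level, as `α` has coefficients in the nilpotent maximal ideal. -/
def gauge (α γ : Fam n X R) : Fam n X R := fun i x =>
  ∑ᶠ k : ℕ,
    ((((k + 1).factorial : ℂ)⁻¹) • (fun s => schouten s (α i))^[k] (polyDelbar (α i)) x +
      ((k.factorial : ℂ)⁻¹) • (fun s => schouten s (α i))^[k] (γ i) x)

variable (n X R)

/-- `𝓜(R)`: the solutions of the Maurer–Cartan equation modulo gauge transformations by
`exp ((𝔤 ⊗̂ 𝔐_R)^0)`, where `𝔤^0 = 𝔤[1]^{-1}`. -/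
def Moduli : Type _ :=
  Quot fun γ γ' : MC n X R => ∃ α : Fam n X R, IsPolyField n X R (-1) α ∧ γ'.val = gauge α γ.val

variable {n X R}

/-- The point of `𝓜(R)` described by a solution of the Maurer–Cartan equation. -/
def MC.point (γ : MC n X R) : Moduli n X R := Quot.mk _ γ

/-- `∂_v` on forms and on polyvector fields with coefficients in `R`, with the Koszul sign for the
odd part of `v`. -/
def derFam (v : R.Der) (s : Fam n X R) : Fam n X R := fun i x =>
  TensorProduct.map LinearMap.id (v.even i) (s (v.shift i) x) +
    TensorProduct.map inv (v.odd i) (s (v.shift i) x)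

theorem derFam_mem (v : R.Der) {s : Fam n X R} (hs : s ∈ forms n X R) :
    derFam v s ∈ forms n X R := by
  refine ⟨fun i => ?_, fun i j h x => ?_⟩
  · exact ((hs.1 (v.shift i)).map _ _ map_comp_id).add ((hs.1 (v.shift i)).map _ _ map_comp_inv)
  · have hi : v.shift i ≤ max (v.shift i) (v.shift j) := le_max_left _ _
    have hj : v.shift j ≤ max (v.shift i) (v.shift j) := le_max_right _ _
    simp only [derFam, ← hs.2 _ _ hi x, ← hs.2 _ _ hj x]
    generalize s (max (v.shift i) (v.shift j)) x = w
    induction w using TensorProduct.induction_on with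
    | zero => simp
    | tmul a r => simp [v.even_compat h hi hj, v.odd_compat h hi hj]
    | add w w' hw hw' =>
      simp only [map_add] at hw hw' ⊢
      rw [add_add_add_comm, hw, hw', add_add_add_comm]

end Families

/-! ### Series in `ħ` and the two complexes -/

section Complexes

variable (n) (X : Type*) [TopologicalSpace X] [ChartedSpace (Cn n) X]
  [IsManifold 𝓘(ℂ, Cn n) ω X] (R : ProArtin.{u})

/-- Two-sided formal series with coefficients indexed by `ℤ`. -/
abbrev Series := ℤ → Fam n X R

/-- `Ω^{*,*} ⊗ ℂ[[ħ⁻¹,ħ]] ⊗̂ R`: the index `m` stands for `ħ^m`. -/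
def intSeries : Submodule ℂ (Series n X R) where
  carrier := {Φ | ∀ m, Φ m ∈ forms n X R}
  add_mem' hΦ hΨ m := add_mem (hΦ m) (hΨ m)
  zero_mem' _ := zero_mem _
  smul_mem' c _ hΦ m := Submodule.smul_mem _ c (hΦ m)

/-- `Ω^*(X,ℂ)[[ħ⁻¹,ħ]] ⊗̂ R`: the index `k` stands for `ħ^{k/2}`; forms of even degree come with
integral powers of `ħ` and forms of odd degree with half-integral ones. -/
def halfSeries : Submodule ℂ (Series n X R) where
  carrier := {Ψ | (∀ k, Ψ k ∈ forms n X R) ∧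
    ∀ k i x, inv.rTensor (R.level i).carrier (Ψ k i x) = k.negOnePow • Ψ k i x}
  add_mem' hΦ hΨ := ⟨fun m => add_mem (hΦ.1 m) (hΨ.1 m), fun k i x => by
    simp only [Pi.add_apply, map_add, hΦ.2, hΨ.2, smul_add]⟩
  zero_mem' := ⟨fun m => zero_mem _, fun k i x => by simp⟩
  smul_mem' c Φ hΦ := ⟨fun m => Submodule.smul_mem _ c (hΦ.1 m), fun k i x => by
    simp only [Pi.smul_apply, map_smul, hΦ.2]
    rw [smul_comm]⟩

variable {n X R}

/-- The differential `ħ^{1/2} (∂̄ + ∂)` on `Ω^*(X,ℂ)[[ħ⁻¹,ħ]] ⊗̂ R`. -/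
def dHalf (Ψ : Series n X R) : Series n X R := fun k i x =>
  delbar (Ψ (k - 1) i) x + del (Ψ (k - 1) i) x

theorem del_smul {A : GradedArtin.{u}} {s : X → Fib n A} (c : ℂ) (hs : IsSmooth formChange s) :
    del (c • s) = c • del s := by
  have h := del_map (c • LinearMap.id) (LinearMap.id (M := A.carrier)) 1 (by intro g; ext; simp)
    (by intros; simp) hs
  simpa [TensorProduct.map_smul_left, Pi.smul_def] using h

theorem delbar_smul {A : GradedArtin.{u}} {s : X → Fib n A} (c : ℂ)
    (hs : IsSmooth formChange s) : delbar (c • s) = c • delbar s := by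
  have h := delbar_map (c • LinearMap.id) (LinearMap.id (M := A.carrier)) 1
    (by intro g; ext; simp) (by intros; simp) hs
  simpa [TensorProduct.map_smul_left, Pi.smul_def] using h

theorem dHalf_add {Φ Ψ : Series n X R} (hΦ : ∀ k, Φ k ∈ forms n X R)
    (hΨ : ∀ k, Ψ k ∈ forms n X R) : dHalf (Φ + Ψ) = dHalf Φ + dHalf Ψ := by
  funext k i x
  have h₁ := congrFun (del_add ((hΦ (k - 1)).1 i) ((hΨ (k - 1)).1 i)) x
  have h₂ := congrFun (delbar_add ((hΦ (k - 1)).1 i) ((hΨ (k - 1)).1 i)) x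
  simp only [Pi.add_apply] at h₁ h₂
  simp only [dHalf, Pi.add_apply, h₁, h₂]
  abel

theorem dHalf_smul (c : ℂ) {Φ : Series n X R} (hΦ : ∀ k, Φ k ∈ forms n X R) :
    dHalf (c • Φ) = c • dHalf Φ := by
  funext k i x
  have h₁ := congrFun (del_smul c ((hΦ (k - 1)).1 i)) x
  have h₂ := congrFun (delbar_smul c ((hΦ (k - 1)).1 i)) x
  simp only [Pi.smul_apply] at h₁ h₂
  simp only [dHalf, Pi.smul_apply, h₁, h₂, smul_add]

theorem dHalf_zero : dHalf (0 : Series n X R) = 0 := by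
  simpa using dHalf_smul (0 : ℂ) (Φ := (0 : Series n X R)) (fun k => zero_mem _)

variable (n X R)

/-- The cocycles of `(Ω^*(X,ℂ)[[ħ⁻¹,ħ]] ⊗̂ R, ħ^{1/2}(∂̄ + ∂))`. -/
def dRCocycles : Submodule ℂ (Series n X R) where
  carrier := {Ψ | Ψ ∈ halfSeries n X R ∧ dHalf Ψ = 0}
  add_mem' hΦ hΨ := ⟨add_mem hΦ.1 hΨ.1, by
    rw [dHalf_add hΦ.1.1 hΨ.1.1, hΦ.2, hΨ.2, add_zero]⟩
  zero_mem' := ⟨zero_mem _, dHalf_zero⟩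
  smul_mem' c Φ hΦ := ⟨Submodule.smul_mem _ c hΦ.1, by
    rw [dHalf_smul c hΦ.1.1, hΦ.2, smul_zero]⟩

/-- The coboundaries of `(Ω^*(X,ℂ)[[ħ⁻¹,ħ]] ⊗̂ R, ħ^{1/2}(∂̄ + ∂))`. -/
def dRCoboundaries : Submodule ℂ (Series n X R) where
  carrier := {Ψ | ∃ η ∈ halfSeries n X R, dHalf η = Ψ}
  add_mem' := by
    rintro _ _ ⟨η, hη, rfl⟩ ⟨θ, hθ, rfl⟩
    exact ⟨η + θ, add_mem hη hθ, dHalf_add hη.1 hθ.1⟩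
  zero_mem' := ⟨0, zero_mem _, dHalf_zero⟩
  smul_mem' := by
    rintro c _ ⟨η, hη, rfl⟩
    exact ⟨c • η, Submodule.smul_mem _ c hη, dHalf_smul c hη.1⟩

/-- The cohomology of `(Ω^*(X,ℂ)[[ħ⁻¹,ħ]] ⊗̂ R, ħ^{1/2}(∂̄ + ∂))`, that is,
`H^*(X,ℂ)[[ħ⁻¹,ħ]] ⊗̂ R`. -/
abbrev dRCohomology : Type _ :=
  dRCocycles n X R ⧸ (dRCoboundaries n X R).comap (dRCocycles n X R).subtype

variable {n X R}

/-- The class of a cocycle. -/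
def dRClass (Ψ : Series n X R) (h : Ψ ∈ dRCocycles n X R) : dRCohomology n X R :=
  Submodule.Quotient.mk ⟨Ψ, h⟩

/-- Multiplication by `ħ⁻¹` on `Ω^*(X,ℂ)[[ħ⁻¹,ħ]] ⊗̂ R`. -/
def hbarInvSeries : Series n X R →ₗ[ℂ] Series n X R where
  toFun Ψ k := Ψ (k + 2)
  map_add' _ _ := rfl
  map_smul' _ _ := rfl

theorem dHalf_hbarInv (Ψ : Series n X R) :
    dHalf (hbarInvSeries Ψ) = hbarInvSeries (dHalf Ψ) := by
  funext k i x
  simp only [dHalf, hbarInvSeries, LinearMap.coe_mk, AddHom.coe_mk]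
  rw [show k - 1 + 2 = k + 2 - 1 by ring]

theorem hbarInv_mem_half {Ψ : Series n X R} (h : Ψ ∈ halfSeries n X R) :
    hbarInvSeries Ψ ∈ halfSeries n X R := by
  refine ⟨fun k => h.1 (k + 2), fun k i x => ?_⟩
  have := h.2 (k + 2) i x
  rwa [Int.negOnePow_add, show (2 : ℤ).negOnePow = 1 from rfl, mul_one] at this

theorem hbarInv_mem {Ψ : Series n X R} (h : Ψ ∈ dRCocycles n X R) :
    hbarInvSeries Ψ ∈ dRCocycles n X R :=
  ⟨hbarInv_mem_half h.1, by rw [dHalf_hbarInv, h.2, map_zero]⟩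

/-- Multiplication by `ħ⁻¹` on `H^*(X,ℂ)[[ħ⁻¹,ħ]] ⊗̂ R`. -/
def hbarInv : dRCohomology n X R →ₗ[ℂ] dRCohomology n X R :=
  Submodule.mapQ _ _ (hbarInvSeries.restrict fun _ h => hbarInv_mem h) <| by
    rintro ⟨Ψ, hΨ⟩ ⟨η, hη, e⟩
    refine ⟨hbarInvSeries η, hbarInv_mem_half hη, ?_⟩
    rw [dHalf_hbarInv, e]
    rfl

/-- `∂_v` on series. -/
def derSeries (v : R.Der) : Series n X R →ₗ[ℂ] Series n X R where
  toFun Φ m := derFam v (Φ m)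
  map_add' Φ Ψ := by
    funext m i x
    simp only [derFam, Pi.add_apply, map_add]
    abel
  map_smul' c Φ := by
    funext m i x
    simp only [derFam, Pi.smul_apply, map_smul, smul_add, RingHom.id_apply]

/-- The derivation `v₀ - v₁` for `v = v₀ + v₁` with `v₀` even and `v₁` odd. -/
def ProArtin.Der.conj (v : R.Der) : R.Der where
  shift := v.shift
  le_shift := v.le_shift
  even := v.even
  odd i := -v.odd i
  even_compat := v.even_compat
  odd_compat h hi hj r := by simp [v.odd_compat h hi hj]
  even_parity := v.even_parity
  odd_parity i r := by simp [v.odd_parity]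
  even_mul := v.even_mul
  odd_mul i r s := by simp [v.odd_mul]; abel

theorem ι_mul_inv (w : Cn n × Cn n) (b : Lam n) :
    ExteriorAlgebra.ι ℂ w * inv b = (-1 : ℂ) • inv (ExteriorAlgebra.ι ℂ w * b) := by
  have : inv (ExteriorAlgebra.ι ℂ w * b) = -(ExteriorAlgebra.ι ℂ w * inv b) := by
    change CliffordAlgebra.involute _ = _
    rw [map_mul]
    erw [CliffordAlgebra.involute_ι]
    rw [neg_mul]
    rfl
  simp [this]

theorem del_der {A B : GradedArtin.{u}} {s : X → Fib n A} (f g : A.carrier →ₗ[ℂ] B.carrier)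
    (hs : IsSmooth formChange s) (x : X) :
    del (fun z => TensorProduct.map LinearMap.id f (s z) + TensorProduct.map inv g (s z)) x =
      TensorProduct.map LinearMap.id f (del s x) - TensorProduct.map inv g (del s x) := by
  have h := congrFun (del_add (hs.map LinearMap.id f map_comp_id) (hs.map inv g map_comp_inv)) x
  rw [del_map LinearMap.id f 1 map_comp_id (by intros; simp) hs,
    del_map inv g (-1) map_comp_inv ι_mul_inv hs] at h
  refine h.trans ?_
  rw [Pi.add_apply, one_smul, neg_one_smul, sub_eq_add_neg]

theorem delbar_der {A B : GradedArtin.{u}} {s : X → Fib n A} (f g : A.carrier →ₗ[ℂ] B.carrier)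
    (hs : IsSmooth formChange s) (x : X) :
    delbar (fun z => TensorProduct.map LinearMap.id f (s z) + TensorProduct.map inv g (s z)) x =
      TensorProduct.map LinearMap.id f (delbar s x) - TensorProduct.map inv g (delbar s x) := by
  have h := congrFun
    (delbar_add (hs.map LinearMap.id f map_comp_id) (hs.map inv g map_comp_inv)) x
  rw [delbar_map LinearMap.id f 1 map_comp_id (by intros; simp) hs,
    delbar_map inv g (-1) map_comp_inv ι_mul_inv hs] at h
  refine h.trans ?_
  rw [Pi.add_apply, one_smul, neg_one_smul, sub_eq_add_neg]

theorem map_inv_neg {A B : GradedArtin.{u}} (g : A.carrier →ₗ[ℂ] B.carrier) (w : Fib n A) :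
    TensorProduct.map inv (-g) w = -TensorProduct.map inv g w := by
  induction w using TensorProduct.induction_on with
  | zero => simp
  | tmul a r => simp [TensorProduct.tmul_neg]
  | add w w' h h' => simp only [map_add, h, h', neg_add]

theorem derFam_conj (v : R.Der) (s : Fam n X R) (i : ℕ) (x : X) :
    derFam v.conj s i x = TensorProduct.map LinearMap.id (v.even i) (s (v.shift i) x) -
      TensorProduct.map inv (v.odd i) (s (v.shift i) x) :=
  (congrArg (TensorProduct.map LinearMap.id (v.even i) (s (v.shift i) x) + ·)
    (map_inv_neg (v.odd i) (s (v.shift i) x))).trans (sub_eq_add_neg _ _).symm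

theorem dHalf_der (v : R.Der) {Ψ : Series n X R} (h : ∀ k, Ψ k ∈ forms n X R) :
    dHalf (derSeries v Ψ) = derSeries v.conj (dHalf Ψ) := by
  funext k i x
  have hs := (h (k - 1)).1 (v.shift i)
  have e₁ := del_der (v.even i) (v.odd i) hs x
  have e₂ := delbar_der (v.even i) (v.odd i) hs x
  have e₃ := derFam_conj v (dHalf Ψ k) i x
  refine (congrArg₂ (· + ·) e₂ e₁).trans (Eq.trans ?_ e₃.symm)
  simp only [dHalf, map_add]
  abel

theorem dHalf_der_conj (v : R.Der) {Ψ : Series n X R} (h : ∀ k, Ψ k ∈ forms n X R) :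
    dHalf (derSeries v.conj Ψ) = derSeries v (dHalf Ψ) := by
  rw [dHalf_der v.conj h]
  funext k i x
  refine (derFam_conj v.conj (dHalf Ψ k) i x).trans ?_
  refine (congrArg (TensorProduct.map LinearMap.id (v.even i) (dHalf Ψ k (v.shift i) x) - ·)
    (map_inv_neg (v.odd i) (dHalf Ψ k (v.shift i) x))).trans ?_
  exact sub_neg_eq_add _ _

theorem derSeries_mem_half (v : R.Der) {Ψ : Series n X R} (h : Ψ ∈ halfSeries n X R) :
    derSeries v Ψ ∈ halfSeries n X R := by
  refine ⟨fun k => derFam_mem v (h.1 k), fun k i x => ?_⟩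
  have e := h.2 k (v.shift i) x
  have key : ∀ (f : (R.level (v.shift i)).carrier →ₗ[ℂ] (R.level i).carrier)
      (L : Lam n →ₗ[ℂ] Lam n) (_ : inv ∘ₗ L = L ∘ₗ inv),
      inv.rTensor (R.level i).carrier (TensorProduct.map L f (Ψ k (v.shift i) x)) =
        k.negOnePow • TensorProduct.map L f (Ψ k (v.shift i) x) := by
    intro f L hL
    rw [← LinearMap.comp_apply, LinearMap.rTensor_comp_map, hL, ← LinearMap.map_comp_rTensor,
      LinearMap.comp_apply, e]
    rcases Int.units_eq_one_or k.negOnePow with hk | hk <;> simp [hk]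
  simp only [derSeries, derFam, LinearMap.coe_mk, AddHom.coe_mk, map_add, smul_add]
  rw [key (v.even i) LinearMap.id rfl, key (v.odd i) inv rfl]

theorem derSeries_mem (v : R.Der) {Ψ : Series n X R} (h : Ψ ∈ dRCocycles n X R) :
    derSeries v Ψ ∈ dRCocycles n X R :=
  ⟨derSeries_mem_half v h.1, by rw [dHalf_der v h.1.1, h.2, map_zero]⟩

/-- `∂_v` on `H^*(X,ℂ)[[ħ⁻¹,ħ]] ⊗̂ R`. -/
def dRDer (v : R.Der) : dRCohomology n X R →ₗ[ℂ] dRCohomology n X R :=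
  Submodule.mapQ _ _ ((derSeries v).restrict fun _ h => derSeries_mem v h) <| by
    rintro ⟨Ψ, hΨ⟩ ⟨η, hη, e⟩
    refine ⟨derSeries v.conj η, derSeries_mem_half v.conj hη, ?_⟩
    rw [dHalf_der_conj v hη.1, e]
    rfl

/-! The fibre of the Gauss–Manin local system over the point described by `γ`. -/

/-- `i_γ` on families. -/
def contrFam (γ s : Fam n X R) : Fam n X R := fun i x => fibContr (γ i x) (s i x)

/-- The differential `∂̄ + [∂, i_γ] + ħ∂` on `Ω^{*,*} ⊗ ℂ[[ħ⁻¹,ħ]] ⊗̂ R`. For `γ` of degree `0` the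
operator `i_γ` is even, so that `[∂, i_γ] = ∂ i_γ - i_γ ∂`. -/
def dTwist (γ : Fam n X R) (Φ : Series n X R) : Series n X R := fun m i x =>
  delbar (Φ m i) x + (del (contrFam γ (Φ m) i) x - fibContr (γ i x) (del (Φ m i) x)) +
    del (Φ (m - 1) i) x

theorem dTwist_add (γ : MC n X R) {Φ Ψ : Series n X R} (hΦ : Φ ∈ intSeries n X R)
    (hΨ : Ψ ∈ intSeries n X R) :
    dTwist γ.val (Φ + Ψ) = dTwist γ.val Φ + dTwist γ.val Ψ := by
  funext m i x
  have c₁ := (γ.isPolyField.1 i).contr ((hΦ m).1 i)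
  have c₂ := (γ.isPolyField.1 i).contr ((hΨ m).1 i)
  have e : contrFam γ.val (Φ m + Ψ m) i =
      contrFam γ.val (Φ m) i + contrFam γ.val (Ψ m) i := by
    funext x; simp [contrFam]
  have h₁ := congrFun (delbar_add ((hΦ m).1 i) ((hΨ m).1 i)) x
  have h₂ := congrFun (del_add c₁ c₂) x
  have h₃ := congrFun (del_add ((hΦ m).1 i) ((hΨ m).1 i)) x
  have h₄ := congrFun (del_add ((hΦ (m - 1)).1 i) ((hΨ (m - 1)).1 i)) x
  change _ = del (contrFam γ.val (Φ m) i) x + del (contrFam γ.val (Ψ m) i) x at h₂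
  simp only [Pi.add_apply] at h₁ h₃ h₄
  change delbar (Φ m i + Ψ m i) x + (del (contrFam γ.val (Φ m + Ψ m) i) x -
    fibContr (γ.val i x) (del (Φ m i + Ψ m i) x)) + del (Φ (m - 1) i + Ψ (m - 1) i) x = _
  rw [e, h₁, h₃, h₄]
  erw [h₂]
  simp only [dTwist, Pi.add_apply, map_add]
  abel

theorem dTwist_smul (γ : MC n X R) (c : ℂ) {Φ : Series n X R} (hΦ : Φ ∈ intSeries n X R) :
    dTwist γ.val (c • Φ) = c • dTwist γ.val Φ := by
  funext m i x
  have c₁ := (γ.isPolyField.1 i).contr ((hΦ m).1 i)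
  have e : contrFam γ.val (c • Φ m) i = c • contrFam γ.val (Φ m) i := by
    funext x; simp [contrFam]
  have h₁ := congrFun (delbar_smul c ((hΦ m).1 i)) x
  have h₂ := congrFun (del_smul c c₁) x
  have h₃ := congrFun (del_smul c ((hΦ m).1 i)) x
  have h₄ := congrFun (del_smul c ((hΦ (m - 1)).1 i)) x
  change _ = c • del (contrFam γ.val (Φ m) i) x at h₂
  simp only [Pi.smul_apply] at h₁ h₃ h₄
  change delbar (c • Φ m i) x + (del (contrFam γ.val (c • Φ m) i) x -
    fibContr (γ.val i x) (del (c • Φ m i) x)) + del (c • Φ (m - 1) i) x = _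
  rw [e, h₁, h₃, h₄]
  erw [h₂]
  simp only [dTwist, Pi.smul_apply, map_smul, smul_add, smul_sub]

theorem dTwist_zero (γ : MC n X R) : dTwist γ.val (0 : Series n X R) = 0 := by
  simpa using dTwist_smul γ (0 : ℂ) (zero_mem (intSeries n X R))

/-- The cocycles of `(Ω^{*,*} ⊗ ℂ[[ħ⁻¹,ħ]] ⊗̂ R, ∂̄ + [∂, i_γ] + ħ∂)`. -/
def gmCocycles (γ : MC n X R) : Submodule ℂ (Series n X R) where
  carrier := {Φ | Φ ∈ intSeries n X R ∧ dTwist γ.val Φ = 0}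
  add_mem' hΦ hΨ := ⟨add_mem hΦ.1 hΨ.1, by
    rw [dTwist_add γ hΦ.1 hΨ.1, hΦ.2, hΨ.2, add_zero]⟩
  zero_mem' := ⟨zero_mem _, dTwist_zero γ⟩
  smul_mem' c Φ hΦ := ⟨Submodule.smul_mem _ c hΦ.1, by
    rw [dTwist_smul γ c hΦ.1, hΦ.2, smul_zero]⟩

/-- The coboundaries of `(Ω^{*,*} ⊗ ℂ[[ħ⁻¹,ħ]] ⊗̂ R, ∂̄ + [∂, i_γ] + ħ∂)`. -/
def gmCoboundaries (γ : MC n X R) : Submodule ℂ (Series n X R) where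
  carrier := {Φ | ∃ η ∈ intSeries n X R, dTwist γ.val η = Φ}
  add_mem' := by
    rintro _ _ ⟨η, hη, rfl⟩ ⟨θ, hθ, rfl⟩
    exact ⟨η + θ, add_mem hη hθ, dTwist_add γ hη hθ⟩
  zero_mem' := ⟨0, zero_mem _, dTwist_zero γ⟩
  smul_mem' := by
    rintro c _ ⟨η, hη, rfl⟩
    exact ⟨c • η, Submodule.smul_mem _ c hη, dTwist_smul γ c hη⟩

/-- The fibre over `γ` of the Gauss–Manin local system: the cohomology of
`(Ω^{*,*} ⊗ ℂ[[ħ⁻¹,ħ]] ⊗̂ R, ∂̄ + [∂, i_γ] + ħ∂)`. -/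
abbrev gmFibre (γ : MC n X R) : Type _ :=
  gmCocycles γ ⧸ (gmCoboundaries γ).comap (gmCocycles γ).subtype

/-- The class of a cocycle. -/
def gmClass (γ : MC n X R) (Φ : Series n X R) (h : Φ ∈ gmCocycles γ) : gmFibre γ :=
  Submodule.Quotient.mk ⟨Φ, h⟩

/-- The Gauss–Manin connection on representatives: `∇_v = ∂_v + ħ⁻¹ i_{∂_v γ}`. -/
def nablaSeries (γ : MC n X R) (v : R.Der) (Φ : Series n X R) : Series n X R := fun m =>
  derFam v (Φ m) + contrFam (derFam v γ.val) (Φ (m + 1))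

/-- The operator `exp(ħ⁻¹ i_γ)`. The sum is finite at each level. -/
def expContr (γ : MC n X R) (Φ : Series n X R) : Series n X R := fun m i x =>
  ∑ᶠ k : ℕ, ((k.factorial : ℂ)⁻¹) • ((fibContr (γ.val i x)) ^ k) (Φ (m + k) i x)

/-- The rescaling `l_ħ : φ^{p,q} ↦ ħ^{(q-p)/2} φ^{p,q}`, from series in `ħ` to series in
`ħ^{1/2}`. -/
def rescale (Φ : Series n X R) : Series n X R := fun k i x =>
  ∑ p ∈ Finset.range (n + 1), ∑ q ∈ Finset.range (n + 1),
    if Even (k - ((q : ℤ) - p)) then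
      (comp p q).rTensor (R.level i).carrier (Φ ((k - ((q : ℤ) - p)) / 2) i x)
    else 0

/-- The operator `l_ħ exp(ħ⁻¹ i_γ)`. -/
def transportSeries (γ : MC n X R) (Φ : Series n X R) : Series n X R := rescale (expContr γ Φ)

/-- `Ω^*(X,ℂ) ⊗̂ R [[ħ]]`: the series `φ₀ + φ₁ħ + φ₂ħ² + …`. -/
def powerSeries (n : ℕ) (X : Type*) [TopologicalSpace X] [ChartedSpace (Cn n) X]
    [IsManifold 𝓘(ℂ, Cn n) ω X] (R : ProArtin.{u}) : Set (Series n X R) :=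
  {Φ | Φ ∈ intSeries n X R ∧ ∀ m < 0, Φ m = 0}

/-- The classes in `H^*(X,ℂ)[[ħ⁻¹,ħ]] ⊗̂ R` represented by cocycles of the form
`l_ħ exp(ħ⁻¹ i_γ)(φ₀ + φ₁ħ + φ₂ħ² + …)`. -/
def semiInfOf (γ : MC n X R) : Set (dRCohomology n X R) :=
  {c | ∃ Φ ∈ powerSeries n X R, ∃ h : transportSeries γ Φ ∈ dRCocycles n X R,
    c = dRClass (transportSeries γ Φ) h}

/-- The semi-infinite subspace `L(φ)`, `φ ∈ 𝓜(R)`: the classes represented by cocycles of the form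
`l_ħ exp(ħ⁻¹ i_γ)(φ₀ + φ₁ħ + φ₂ħ² + …)`, where `γ` describes `φ`. -/
def semiInf (φ : Moduli n X R) : Set (dRCohomology n X R) :=
  {c | ∃ γ : MC n X R, γ.point = φ ∧ c ∈ semiInfOf γ}

end Complexes

end SemiInfinite

end

open scoped Manifold ContDiff
open SemiInfinite

/-!
Contraction with `γ` is a nilpotent even operator, so conjugating an operator `f` by
`exp(ħ⁻¹ i_γ)` gives the finite sum of the iterated commutators of `f` with `ħ⁻¹ i_γ`, divided by
factorials. Since `[∂̄, i_γ] = i_{∂̄γ}`, `[[∂, i_γ], i_γ] = i_{[γ,γ]}` and contractions commute, the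
sum for `∂̄ + ħ∂` stops after the second commutator, and its terms in `ħ⁻¹` add up to
`i_{∂̄γ + ½[γ,γ]}`, which vanishes by the Maurer–Cartan equation. What remains is the twisted
differential `∂̄ + [∂, i_γ] + ħ∂`. In the same way `∂_v` is conjugated to
`∇_v = ∂_v + ħ⁻¹ i_{∂_v γ}`, because `[∂_v, i_γ] = i_{∂_v γ}` commutes with `i_γ`.

The rescaling `l_ħ` turns `∂̄ + ħ∂` into `ħ^{1/2}(∂̄ + ∂)` and commutes with `∂_v`. Hence
`l_ħ exp(ħ⁻¹ i_γ)` identifies the twisted complex and `∇_v` with the de Rham complex and `∂_v`.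
Transversality holds because `∇_v` lowers the order in `ħ` by at most one.
-/

noncomputable section

namespace SemiInfinite

universe u

/-! ### Exponentials of nilpotent endomorphisms -/

section Exponentials

variable {R V W : Type*} [CommRing R] [AddCommGroup V] [Module R V] [AddCommGroup W] [Module R W]

/-- The commutator `f ↦ f ∘ c - c' ∘ f` of linear maps `f : V → W` with the operator which acts as
`c` on the source and as `c'` on the target. -/
def homCommutator (c : Module.End R V) (c' : Module.End R W) : Module.End R (V →ₗ[R] W) :=
  LinearMap.lcomp R W c - LinearMap.llcomp R V W W c'

@[simp] theorem homCommutator_apply (c : Module.End R V) (c' : Module.End R W) (f : V →ₗ[R] W)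
    (x : V) : homCommutator c c' f x = f (c x) - c' (f x) := rfl

theorem lcomp_pow_apply (c : Module.End R V) (k : ℕ) (f : V →ₗ[R] W) :
    (LinearMap.lcomp R W c ^ k : Module.End R (V →ₗ[R] W)) f = f ∘ₗ (c ^ k) := by
  induction k with
  | zero => rfl
  | succ k ih => rw [pow_succ', Module.End.mul_apply, ih, pow_succ]; rfl

theorem llcomp_pow_apply (c' : Module.End R W) (k : ℕ) (f : V →ₗ[R] W) :
    (LinearMap.llcomp R V W W c' ^ k : Module.End R (V →ₗ[R] W)) f = (c' ^ k) ∘ₗ f := by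
  induction k with
  | zero => rfl
  | succ k ih => rw [pow_succ', Module.End.mul_apply, ih, pow_succ']; rfl

variable {c : Module.End R V} {c' : Module.End R W}

theorem lcomp_pow_eq_zero {N : ℕ} (hN : c ^ N = 0) :
    (LinearMap.lcomp R W c ^ N : Module.End R (V →ₗ[R] W)) = 0 :=
  LinearMap.ext fun f => by rw [lcomp_pow_apply, hN, LinearMap.comp_zero, LinearMap.zero_apply]

theorem llcomp_pow_eq_zero {N : ℕ} (hN : c' ^ N = 0) :
    (LinearMap.llcomp R V W W c' ^ N : Module.End R (V →ₗ[R] W)) = 0 :=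
  LinearMap.ext fun f => by rw [llcomp_pow_apply, hN, LinearMap.zero_comp, LinearMap.zero_apply]

theorem commute_lcomp_llcomp (c : Module.End R V) (c' : Module.End R W) :
    Commute (LinearMap.lcomp R W c : Module.End R (V →ₗ[R] W)) (LinearMap.llcomp R V W W c') :=
  rfl

theorem isNilpotent_homCommutator (hc : IsNilpotent c) (hc' : IsNilpotent c') :
    IsNilpotent (homCommutator c c') :=
  (commute_lcomp_llcomp c c').isNilpotent_sub (hc.imp fun _ => lcomp_pow_eq_zero)
    (hc'.imp fun _ => llcomp_pow_eq_zero)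

variable [Module ℚ W]

theorem exp_llcomp_apply (hc' : IsNilpotent c') (f : V →ₗ[R] W) :
    IsNilpotent.exp (LinearMap.llcomp R V W W c' : Module.End R (V →ₗ[R] W)) f =
      IsNilpotent.exp c' ∘ₗ f := by
  obtain ⟨N, hN⟩ := hc'
  ext x
  simp only [IsNilpotent.exp_eq_sum hN, IsNilpotent.exp_eq_sum (llcomp_pow_eq_zero hN),
    LinearMap.sum_apply, LinearMap.smul_apply, llcomp_pow_apply, LinearMap.comp_apply]

variable [Module ℚ V]

theorem exp_lcomp_apply (hc : IsNilpotent c) (f : V →ₗ[R] W) :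
    IsNilpotent.exp (LinearMap.lcomp R W c : Module.End R (V →ₗ[R] W)) f =
      f ∘ₗ IsNilpotent.exp c := by
  obtain ⟨N, hN⟩ := hc
  ext x
  simp only [IsNilpotent.exp_eq_sum hN, IsNilpotent.exp_eq_sum (lcomp_pow_eq_zero hN),
    LinearMap.sum_apply, LinearMap.smul_apply, lcomp_pow_apply, LinearMap.comp_apply, map_sum,
    map_rat_smul]

theorem comp_exp (hc : IsNilpotent c) (hc' : IsNilpotent c') (f : V →ₗ[R] W) :
    f ∘ₗ IsNilpotent.exp c = IsNilpotent.exp c' ∘ₗ IsNilpotent.exp (homCommutator c c') f := by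
  have commute : Commute (LinearMap.llcomp R V W W c' : Module.End R (V →ₗ[R] W))
      (homCommutator c c') :=
    (commute_lcomp_llcomp c c').symm.sub_right (Commute.refl _)
  have split : (LinearMap.lcomp R W c : Module.End R (V →ₗ[R] W)) =
      LinearMap.llcomp R V W W c' + homCommutator c c' := (add_sub_cancel _ _).symm
  rw [← exp_lcomp_apply hc, split, IsNilpotent.exp_add_of_commute commute
    (hc'.imp fun _ => llcomp_pow_eq_zero) (isNilpotent_homCommutator hc hc'), Module.End.mul_apply,
    exp_llcomp_apply hc']

theorem comp_exp_of_intertwines (hc : IsNilpotent c) (hc' : IsNilpotent c') {f : V →ₗ[R] W}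
    (h : homCommutator c c' f = 0) : f ∘ₗ IsNilpotent.exp c = IsNilpotent.exp c' ∘ₗ f := by
  have hexp := IsNilpotent.exp_smul_eq_sum (k := 1) (by rwa [pow_one, Module.End.smul_def])
    (isNilpotent_homCommutator hc hc')
  simp only [Module.End.smul_def, Finset.sum_range_one, pow_zero, Module.End.one_apply,
    Nat.factorial_zero, Nat.cast_one, inv_one, one_smul] at hexp
  rw [comp_exp hc hc', hexp]

theorem comp_exp_of_commutator_sq_eq_zero (hc : IsNilpotent c) (hc' : IsNilpotent c')
    {f : V →ₗ[R] W} (h : homCommutator c c' (homCommutator c c' f) = 0) :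
    f ∘ₗ IsNilpotent.exp c = IsNilpotent.exp c' ∘ₗ (f + homCommutator c c' f) := by
  have hexp := IsNilpotent.exp_smul_eq_sum (k := 2)
    (by rwa [pow_two, Module.End.smul_def, Module.End.mul_apply])
    (isNilpotent_homCommutator hc hc')
  simp only [Module.End.smul_def, Finset.sum_range_succ, Finset.sum_range_zero, pow_zero, pow_one,
    Module.End.one_apply, Nat.factorial_zero, Nat.factorial_one, Nat.cast_one, inv_one, one_smul,
    zero_add] at hexp
  rw [comp_exp hc hc', hexp]

theorem comp_exp_of_commutator_cube_eq_zero (hc : IsNilpotent c) (hc' : IsNilpotent c')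
    {f : V →ₗ[R] W}
    (h : homCommutator c c' (homCommutator c c' (homCommutator c c' f)) = 0) :
    f ∘ₗ IsNilpotent.exp c = IsNilpotent.exp c' ∘ₗ
      (f + homCommutator c c' f + (2⁻¹ : ℚ) • homCommutator c c' (homCommutator c c' f)) := by
  have hexp := IsNilpotent.exp_smul_eq_sum (k := 3)
    (by rwa [pow_three, Module.End.smul_def, Module.End.mul_apply, Module.End.mul_apply])
    (isNilpotent_homCommutator hc hc')
  simp only [Module.End.smul_def, Finset.sum_range_succ, Finset.sum_range_zero, pow_zero, pow_one,
    pow_two, Module.End.one_apply, Module.End.mul_apply, Nat.factorial_zero, Nat.factorial_one,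
    Nat.factorial_two, Nat.cast_one, Nat.cast_ofNat, inv_one, one_smul, zero_add] at hexp
  rw [comp_exp hc hc', hexp]

end Exponentials

section OverHbar

variable {R V W : Type*} [CommRing R] [AddCommGroup V] [Module R V] [AddCommGroup W] [Module R W]

/-- The operator `ħ⁻ʲ f` on two-sided series `Φ = ∑ₘ Φₘ ħᵐ`, where `f` acts on the coefficients. -/
def divHbarPow (j : ℤ) (f : V →ₗ[R] W) : (ℤ → V) →ₗ[R] (ℤ → W) :=
  f.compLeft ℤ ∘ₗ LinearMap.funLeft R V (· + j)

@[simp] theorem divHbarPow_apply (j : ℤ) (f : V →ₗ[R] W) (Φ : ℤ → V) (m : ℤ) :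
    divHbarPow j f Φ m = f (Φ (m + j)) := rfl

@[simp] theorem divHbarPow_zero (j : ℤ) : divHbarPow j (0 : V →ₗ[R] W) = 0 := rfl

/-- The operator `ħ⁻¹ c` on two-sided series, as an endomorphism. -/
def overHbar (c : Module.End R V) : Module.End R (ℤ → V) := divHbarPow 1 c

@[simp] theorem overHbar_apply (c : Module.End R V) (Φ : ℤ → V) (m : ℤ) :
    overHbar c Φ m = c (Φ (m + 1)) := rfl

theorem homCommutator_divHbarPow (c : Module.End R V) (c' : Module.End R W) (j : ℤ)
    (f : V →ₗ[R] W) :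
    homCommutator (overHbar c) (overHbar c') (divHbarPow j f) =
      divHbarPow (j + 1) (homCommutator c c' f) := by
  ext Φ m
  rw [homCommutator_apply, Pi.sub_apply, divHbarPow_apply, overHbar_apply, overHbar_apply,
    divHbarPow_apply, divHbarPow_apply, homCommutator_apply, add_assoc, add_right_comm, add_assoc]

theorem overHbar_neg (c : Module.End R V) : overHbar (-c) = -overHbar c := rfl

theorem overHbar_pow_apply (c : Module.End R V) (k : ℕ) (Φ : ℤ → V) (m : ℤ) :
    (overHbar c ^ k) Φ m = (c ^ k) (Φ (m + k)) := by
  induction k generalizing m with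
  | zero => simp
  | succ k ih =>
    rw [pow_succ', Module.End.mul_apply, overHbar_apply, ih, pow_succ', Module.End.mul_apply]
    push_cast
    rw [add_right_comm, add_assoc]

theorem overHbar_pow_eq_zero {c : Module.End R V} {N : ℕ} (hN : c ^ N = 0) :
    overHbar c ^ N = 0 := by
  ext Φ m
  rw [overHbar_pow_apply, hN]
  rfl

theorem isNilpotent_overHbar {c : Module.End R V} (hc : IsNilpotent c) :
    IsNilpotent (overHbar c) :=
  hc.imp fun _ hN => overHbar_pow_eq_zero hN

theorem exp_overHbar_apply [Module ℚ V] {c : Module.End R V} {N : ℕ} (hN : c ^ N = 0)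
    (Φ : ℤ → V) (m : ℤ) :
    IsNilpotent.exp (overHbar c) Φ m =
      ∑ k ∈ Finset.range N, (k.factorial : ℚ)⁻¹ • (c ^ k) (Φ (m + k)) := by
  rw [IsNilpotent.exp_eq_sum (overHbar_pow_eq_zero hN), LinearMap.sum_apply, Finset.sum_apply]
  simp only [LinearMap.smul_apply, Pi.smul_apply, overHbar_pow_apply]

theorem map_exp_overHbar_of_intertwines [Module ℚ V] [Module ℚ W] {c : Module.End R V}
    {c' : Module.End R W} (hc : IsNilpotent c) (hc' : IsNilpotent c') {f : V →ₗ[R] W}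
    (h : homCommutator c c' f = 0) (Φ : ℤ → V) (m : ℤ) :
    f (IsNilpotent.exp (overHbar c) Φ m) =
      IsNilpotent.exp (overHbar c') (fun k => f (Φ k)) m := by
  have key := comp_exp_of_intertwines (isNilpotent_overHbar hc) (isNilpotent_overHbar hc')
    (f := divHbarPow 0 f) (by rw [homCommutator_divHbarPow, h, divHbarPow_zero])
  have coefficients : divHbarPow 0 f Φ = fun k => f (Φ k) :=
    funext fun k => by rw [divHbarPow_apply, add_zero]
  simpa only [LinearMap.comp_apply, divHbarPow_apply, add_zero, coefficients] using
    congrFun (LinearMap.congr_fun key Φ) m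

end OverHbar

/-! ### Signs in exterior algebras -/

section Signs

open CliffordAlgebra

variable {R M : Type*} [CommRing R] [AddCommGroup M] [Module R M]

theorem contractLeft_involute {Q : QuadraticForm R M} (d : Module.Dual R M)
    (b : CliffordAlgebra Q) : contractLeft d (involute b) = -involute (contractLeft d b) := by
  induction b using CliffordAlgebra.left_induction with
  | algebraMap r => simp only [AlgHom.commutes, contractLeft_algebraMap, map_zero, neg_zero]
  | add a b ha hb => rw [map_add, map_add, map_add, map_add, ha, hb, neg_add]
  | ι_mul a m ha =>
    rw [map_mul, involute_ι, neg_mul, map_neg, contractLeft_ι_mul, contractLeft_ι_mul, ha,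
      map_sub, map_smul, map_mul, involute_ι, mul_neg, neg_mul]

theorem ι_mul_eq_involute_mul_ι (m : M) (b : ExteriorAlgebra R M) :
    ExteriorAlgebra.ι R m * b = involute b * ExteriorAlgebra.ι R m := by
  induction b using CliffordAlgebra.left_induction with
  | algebraMap r => rw [AlgHom.commutes]; exact (Algebra.commutes r _).symm
  | add a b ha hb => rw [map_add, mul_add, add_mul, ha, hb]
  | ι_mul a m' ha =>
    have anticomm : ExteriorAlgebra.ι R m * ExteriorAlgebra.ι R m' =
        -(ExteriorAlgebra.ι R m' * ExteriorAlgebra.ι R m) :=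
      eq_neg_of_add_eq_zero_left (ExteriorAlgebra.ι_add_mul_swap m m')
    calc ExteriorAlgebra.ι R m * (ExteriorAlgebra.ι R m' * a)
        = -(ExteriorAlgebra.ι R m' * (ExteriorAlgebra.ι R m * a)) := by
          rw [← mul_assoc, anticomm, neg_mul, mul_assoc]
      _ = involute (ExteriorAlgebra.ι R m' * a) * ExteriorAlgebra.ι R m := by
          rw [ha, map_mul, ← mul_assoc, ← neg_mul, ← neg_mul]
          exact congrArg (· * _ * _) (involute_ι (Q := (0 : QuadraticForm R M)) m').symm

theorem add_involute_commute_and_sub_involute_mul (a : ExteriorAlgebra R M) :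
    (∀ b, (a + involute a) * b = b * (a + involute a)) ∧
      ∀ b, (a - involute a) * b = involute b * (a - involute a) := by
  induction a using CliffordAlgebra.left_induction with
  | algebraMap r =>
    simp only [AlgHom.commutes, ← map_add, sub_self, zero_mul, mul_zero, implies_true, and_true]
    exact Algebra.commutes _
  | add a a' ha ha' =>
    refine ⟨fun b => ?_, fun b => ?_⟩
    · rw [map_add, add_add_add_comm, add_mul, mul_add, ha.1, ha'.1]
    · rw [map_add, add_sub_add_comm, add_mul, mul_add, ha.2, ha'.2]
  | ι_mul a m ha =>
    have swap (b : ExteriorAlgebra R M) : CliffordAlgebra.ι 0 m * b =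
        involute b * CliffordAlgebra.ι 0 m := ι_mul_eq_involute_mul_ι m b
    refine ⟨fun b => ?_, fun b => ?_⟩
    · rw [map_mul, involute_ι, neg_mul, ← sub_eq_add_neg, ← mul_sub, mul_assoc, ha.2, ← mul_assoc,
        swap, involute_involute, mul_assoc]
    · rw [map_mul, involute_ι, neg_mul, sub_neg_eq_add, ← mul_add, mul_assoc, ha.1, ← mul_assoc,
        swap, mul_assoc]

variable [Invertible (2 : R)] {a : ExteriorAlgebra R M}

theorem mul_comm_of_involute_eq (ha : involute a = a) (b : ExteriorAlgebra R M) :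
    a * b = b * a := by
  have h := (add_involute_commute_and_sub_involute_mul a).1 b
  rw [ha, ← two_smul R a, smul_mul_assoc, mul_smul_comm] at h
  exact (isUnit_of_invertible (2 : R)).smul_left_cancel.mp h

theorem mul_eq_involute_mul_of_involute_eq_neg (ha : involute a = -a) (b : ExteriorAlgebra R M) :
    a * b = involute b * a := by
  have h := (add_involute_commute_and_sub_involute_mul a).2 b
  rw [ha, sub_neg_eq_add, ← two_smul R a, smul_mul_assoc, mul_smul_comm] at h
  exact (isUnit_of_invertible (2 : R)).smul_left_cancel.mp h

end Signs

/-! ### The exterior algebra on two kinds of generators -/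

variable {n : ℕ}

theorem ι_eq_gen₁_add_gen₂ (w : Cn n × Cn n) :
    CliffordAlgebra.ι 0 w = gen₁ w.1 + gen₂ w.2 := by
  change ExteriorAlgebra.ι ℂ w = _
  simp only [gen₁, gen₂, LinearMap.comp_apply, ← map_add, LinearMap.inl_apply,
    LinearMap.inr_apply, Prod.mk_add_mk, add_zero, zero_add, Prod.mk.eta]

theorem Lam.induction {P : Lam n → Prop} (scalar : ∀ c, P (algebraMap ℂ (Lam n) c))
    (add : ∀ a b, P a → P b → P (a + b)) (gen₁_mul : ∀ v a, P a → P (gen₁ v * a))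
    (gen₂_mul : ∀ v a, P a → P (gen₂ v * a)) (a : Lam n) : P a := by
  induction a using CliffordAlgebra.left_induction with
  | algebraMap c => exact scalar c
  | add a b ha hb => exact add a b ha hb
  | ι_mul a v ha =>
    rw [ι_eq_gen₁_add_gen₂, add_mul]
    exact add _ _ (gen₁_mul _ _ ha) (gen₂_mul _ _ ha)

@[simp] theorem inv_algebraMap (c : ℂ) : inv (algebraMap ℂ (Lam n) c) = algebraMap ℂ _ c :=
  AlgHom.commutes (CliffordAlgebra.involute (Q := 0)) c

theorem inv_mul (a b : Lam n) : inv (a * b) = inv a * inv b :=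
  map_mul (CliffordAlgebra.involute (Q := 0)) a b

@[simp] theorem inv_inv (a : Lam n) : inv (inv a) = a := CliffordAlgebra.involute_involute a

@[simp] theorem inv_ι (w : Cn n × Cn n) :
    inv (CliffordAlgebra.ι 0 w : Lam n) = -CliffordAlgebra.ι 0 w :=
  CliffordAlgebra.involute_ι w

@[simp] theorem inv_gen₁ (v : Cn n) : inv (gen₁ v) = -gen₁ v := inv_ι _

@[simp] theorem inv_gen₂ (v : Cn n) : inv (gen₂ v) = -gen₂ v := inv_ι _

theorem mul_comm_of_inv_eq {a : Lam n} (ha : inv a = a) (b : Lam n) : a * b = b * a :=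
  mul_comm_of_involute_eq ha b

theorem mul_eq_inv_mul_of_inv_eq_neg {a : Lam n} (ha : inv a = -a) (b : Lam n) :
    a * b = inv b * a :=
  mul_eq_involute_mul_of_involute_eq_neg ha b

theorem gen₂_mul_gen₁_mul (v w : Cn n) (a : Lam n) :
    gen₂ v * (gen₁ w * a) = -(gen₁ w * (gen₂ v * a)) := by
  have anticomm : gen₂ v * gen₁ w = -(gen₁ w * gen₂ v) :=
    eq_neg_of_add_eq_zero_left (ExteriorAlgebra.ι_add_mul_swap (R := ℂ) _ _)
  rw [← mul_assoc, anticomm, neg_mul, mul_assoc]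

/-! ### Contractions with polyvector-valued forms -/

theorem contrGen_inv (w : Cn n × Cn n) (b : Lam n) :
    contrGen w (inv b) = -inv (contrGen w b) := by
  have h : CliffordAlgebra.contractLeft (pair₁ w.1) (inv b) =
      -inv (CliffordAlgebra.contractLeft (pair₁ w.1) b) := contractLeft_involute _ _
  rw [contrGen_apply, contrGen_apply, h, map_add, inv_mul, inv_gen₂, neg_add, neg_mul, neg_neg]

theorem contr_ι (w : Cn n × Cn n) : contr (CliffordAlgebra.ι 0 w) = contrGen w :=
  ExteriorAlgebra.lift_ι_apply ℂ contrGen contrGen_sq w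

theorem contr_mul (a b c : Lam n) : contr (a * b) c = contr a (contr b c) := by
  rw [map_mul, Module.End.mul_apply]

theorem contr_ι_mul (w : Cn n × Cn n) (a b : Lam n) :
    contr (CliffordAlgebra.ι 0 w * a) b = contrGen w (contr a b) := by
  rw [contr_mul, contr_ι]

theorem contr_inv (a b : Lam n) : inv (contr a b) = contr (inv a) (inv b) := by
  induction a using CliffordAlgebra.left_induction generalizing b with
  | algebraMap c =>
    rw [inv_algebraMap, AlgHom.commutes, Module.algebraMap_end_apply, map_smul,
      Module.algebraMap_end_apply]
  | add a a' ha ha' => simp only [map_add, LinearMap.add_apply, ha, ha']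
  | ι_mul a w ha =>
    rw [contr_ι_mul, inv_mul, inv_ι, neg_mul, map_neg, LinearMap.neg_apply, contr_ι_mul, ← ha,
      contrGen_inv, neg_neg]

theorem contr_gen₂ (v : Cn n) (b : Lam n) : contr (gen₂ v) b = gen₂ v * b := by
  change contr (CliffordAlgebra.ι 0 (0, v)) b = _
  rw [contr_ι, contrGen_apply, map_zero, map_zero, LinearMap.zero_apply, zero_add]

theorem contrGen_gen₁_mul (w : Cn n × Cn n) (i : Fin n) (b : Lam n) :
    contrGen w (gen₁ (Pi.single i 1) * b) =
      w.1 i • b - gen₁ (Pi.single i 1) * contrGen w b := by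
  have contract : CliffordAlgebra.contractLeft (pair₁ w.1) (gen₁ (Pi.single i 1) * b) =
      w.1 i • b - gen₁ (Pi.single i 1) * CliffordAlgebra.contractLeft (pair₁ w.1) b := by
    refine (CliffordAlgebra.contractLeft_ι_mul _ _ _).trans ?_
    simp only [pair₁, LinearMap.mk₂_apply, LinearMap.inl_apply, dotProduct_single, mul_one]
    rfl
  rw [contrGen_apply, contrGen_apply, contract, gen₂_mul_gen₁_mul, mul_add]
  abel

theorem leftDer_ι_mul (i : Fin n) (w : Cn n × Cn n) (a : Lam n) :
    leftDer i (CliffordAlgebra.ι 0 w * a) = w.1 i • a - CliffordAlgebra.ι 0 w * leftDer i a := by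
  rw [leftDer, CliffordAlgebra.contractLeft_ι_mul]
  simp [pair₁]

/-- The supercommutator of `dz_i ∧` with `i_a` is the contraction with `∂a/∂(∂/∂z_i)`. -/
theorem gen₁_mul_contr (i : Fin n) (a b : Lam n) :
    gen₁ (Pi.single i 1) * contr a b =
      contr (inv a) (gen₁ (Pi.single i 1) * b) + contr (leftDer i a) b := by
  induction a using CliffordAlgebra.left_induction generalizing b with
  | algebraMap c =>
    rw [inv_algebraMap, AlgHom.commutes, leftDer, CliffordAlgebra.contractLeft_algebraMap,
      map_zero, LinearMap.zero_apply, add_zero, Module.algebraMap_end_apply,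
      Module.algebraMap_end_apply, mul_smul_comm]
  | add a a' ha ha' =>
    simp only [map_add, LinearMap.add_apply, mul_add, ha, ha']
    abel
  | ι_mul a w ha =>
    have h := contrGen_gen₁_mul w i (contr a b)
    rw [ha, map_add, eq_sub_iff_add_eq, add_comm, ← eq_sub_iff_add_eq] at h
    rw [contr_ι_mul, leftDer_ι_mul, inv_mul, inv_ι, neg_mul, map_neg, LinearMap.neg_apply,
      contr_ι_mul, map_sub, LinearMap.sub_apply, contr_ι_mul, map_smul, LinearMap.smul_apply, h]
    abel

/-! ### Bidegrees -/


theorem comp_apply (p q : ℕ) (a : Lam n) :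
    comp p q a = (ExteriorAlgebra.lift ℂ ⟨bidegGen, bidegGen_sq⟩ a).coeff (p, q) := rfl

theorem lift_bidegGen_gen₁ (v : Cn n) :
    ExteriorAlgebra.lift ℂ ⟨bidegGen, bidegGen_sq⟩ (gen₁ v) =
      AddMonoidAlgebra.single (1, 0) (gen₁ v) := by
  have : bidegGen (v, 0) = AddMonoidAlgebra.single (1, 0) (gen₁ v) := by simp [bidegGen]
  rw [← this]
  exact ExteriorAlgebra.lift_ι_apply ℂ bidegGen bidegGen_sq (v, 0)

theorem lift_bidegGen_gen₂ (v : Cn n) :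
    ExteriorAlgebra.lift ℂ ⟨bidegGen, bidegGen_sq⟩ (gen₂ v) =
      AddMonoidAlgebra.single (0, 1) (gen₂ v) := by
  have : bidegGen (0, v) = AddMonoidAlgebra.single (0, 1) (gen₂ v) := by simp [bidegGen]
  rw [← this]
  exact ExteriorAlgebra.lift_ι_apply ℂ bidegGen bidegGen_sq (0, v)

theorem comp_gen₁_mul (p q : ℕ) (v : Cn n) (a : Lam n) :
    comp (p + 1) q (gen₁ v * a) = gen₁ v * comp p q a := by
  rw [comp_apply, map_mul, lift_bidegGen_gen₁]
  refine AddMonoidAlgebra.coeff_single_mul_eq_mul_coeff (p, q) fun m _ => ?_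
  simp only [Prod.ext_iff, Prod.fst_add, Prod.snd_add]
  omega

theorem comp_zero_gen₁_mul (q : ℕ) (v : Cn n) (a : Lam n) : comp 0 q (gen₁ v * a) = 0 := by
  rw [comp_apply, map_mul, lift_bidegGen_gen₁]
  refine AddMonoidAlgebra.coeff_single_mul_of_forall_add_ne _ _ fun m => ?_
  simp only [ne_eq, Prod.ext_iff, Prod.fst_add, Prod.snd_add]
  omega

theorem comp_gen₂_mul (p q : ℕ) (v : Cn n) (a : Lam n) :
    comp p (q + 1) (gen₂ v * a) = gen₂ v * comp p q a := by
  rw [comp_apply, map_mul, lift_bidegGen_gen₂]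
  refine AddMonoidAlgebra.coeff_single_mul_eq_mul_coeff (p, q) fun m _ => ?_
  simp only [Prod.ext_iff, Prod.fst_add, Prod.snd_add]
  omega

theorem comp_zero_gen₂_mul (p : ℕ) (v : Cn n) (a : Lam n) : comp p 0 (gen₂ v * a) = 0 := by
  rw [comp_apply, map_mul, lift_bidegGen_gen₂]
  refine AddMonoidAlgebra.coeff_single_mul_of_forall_add_ne _ _ fun m => ?_
  simp only [ne_eq, Prod.ext_iff, Prod.fst_add, Prod.snd_add]
  omega

theorem comp_algebraMap (p q : ℕ) (c : ℂ) :
    comp p q (algebraMap ℂ (Lam n) c) =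
      if p = 0 ∧ q = 0 then algebraMap ℂ (Lam n) c else 0 := by
  rw [comp_apply, AlgHom.commutes]
  rw [show algebraMap ℂ (AddMonoidAlgebra (Lam n) (ℕ × ℕ)) c =
    AddMonoidAlgebra.single 0 (algebraMap ℂ (Lam n) c) from rfl]
  rw [AddMonoidAlgebra.coeff_single, Finsupp.single_apply]
  simp only [Prod.ext_iff, Prod.fst_zero, Prod.snd_zero, eq_comm (a := 0)]

theorem comp_comp (p q p' q' : ℕ) (a : Lam n) :
    comp p q (comp p' q' a) = if p = p' ∧ q = q' then comp p q a else 0 := by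
  induction a using Lam.induction generalizing p q p' q' with
  | scalar c =>
    rw [comp_algebraMap]
    split_ifs with h₁ h₂ h₂
    · rw [comp_algebraMap]
    · rw [comp_algebraMap, if_neg (by omega)]
    · rw [map_zero, comp_algebraMap, if_neg (by omega)]
    · rw [map_zero]
  | add a b ha hb =>
    rw [map_add, map_add, ha, hb]
    split_ifs <;> simp
  | gen₁_mul v a ha =>
    rcases p' with _ | p' <;> rcases p with _ | p <;>
      simp only [comp_gen₁_mul, comp_zero_gen₁_mul, map_zero, ha] <;> simp
  | gen₂_mul v a ha =>
    rcases q' with _ | q' <;> rcases q with _ | q <;>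
      simp only [comp_gen₂_mul, comp_zero_gen₂_mul, map_zero, ha] <;> simp

theorem inv_comp (p q : ℕ) (a : Lam n) :
    inv (comp p q a) = (-1 : ℂ) ^ (p + q) • comp p q a := by
  induction a using Lam.induction generalizing p q with
  | scalar c =>
    rw [comp_algebraMap]
    split_ifs with h
    · simp [h.1, h.2]
    · simp
  | add a b ha hb => rw [map_add, map_add, ha, hb, smul_add]
  | gen₁_mul v a ha =>
    rcases p with _ | p
    · simp [comp_zero_gen₁_mul]
    · rw [comp_gen₁_mul, inv_mul, ha, inv_gen₁, add_right_comm, pow_succ]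
      simp
  | gen₂_mul v a ha =>
    rcases q with _ | q
    · simp [comp_zero_gen₂_mul]
    · rw [comp_gen₂_mul, inv_mul, ha, inv_gen₂, ← add_assoc, pow_succ]
      simp

theorem map_prodMap_gen₁ (f g : Cn n →ₗ[ℂ] Cn n) (v : Cn n) :
    ExteriorAlgebra.map (f.prodMap g) (gen₁ v) = gen₁ (f v) := by
  simp [gen₁, ExteriorAlgebra.map_apply_ι]

theorem map_prodMap_gen₂ (f g : Cn n →ₗ[ℂ] Cn n) (v : Cn n) :
    ExteriorAlgebra.map (f.prodMap g) (gen₂ v) = gen₂ (g v) := by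
  simp [gen₂, ExteriorAlgebra.map_apply_ι]

theorem map_prodMap_comp (f g : Cn n →ₗ[ℂ] Cn n) (p q : ℕ) (a : Lam n) :
    ExteriorAlgebra.map (f.prodMap g) (comp p q a) =
      comp p q (ExteriorAlgebra.map (f.prodMap g) a) := by
  induction a using Lam.induction generalizing p q with
  | scalar c =>
    rw [AlgHom.commutes, comp_algebraMap]
    split_ifs <;> simp
  | add a b ha hb => simp only [map_add, ha, hb]
  | gen₁_mul v a ha =>
    rcases p with _ | p <;>
      simp [map_prodMap_gen₁, comp_gen₁_mul, comp_zero_gen₁_mul, ha]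
  | gen₂_mul v a ha =>
    rcases q with _ | q <;>
      simp [map_prodMap_gen₂, comp_gen₂_mul, comp_zero_gen₂_mul, ha]

theorem inv_eq_map_neg (a : Lam n) :
    inv a = ExteriorAlgebra.map ((-LinearMap.id).prodMap (-LinearMap.id)) a := by
  induction a using Lam.induction with
  | scalar c => rw [inv_algebraMap, AlgHom.commutes]
  | add a b ha hb => rw [map_add, map_add, ha, hb]
  | gen₁_mul v a ha => rw [inv_mul, map_mul, ha, inv_gen₁, map_prodMap_gen₁, LinearMap.neg_apply,
      LinearMap.id_apply, map_neg]
  | gen₂_mul v a ha => rw [inv_mul, map_mul, ha, inv_gen₂, map_prodMap_gen₂, LinearMap.neg_apply,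
      LinearMap.id_apply, map_neg]

theorem comp_inv (p q : ℕ) (a : Lam n) : comp p q (inv a) = inv (comp p q a) := by
  rw [inv_eq_map_neg, inv_eq_map_neg, map_prodMap_comp]

theorem range_gen₂_mul_pow_range_gen₁_le (p : ℕ) :
    LinearMap.range (gen₂ (n := n)) * LinearMap.range gen₁ ^ p ≤
      LinearMap.range gen₁ ^ p * LinearMap.range gen₂ := by
  induction p with
  | zero => simp
  | succ p ih =>
    have h : LinearMap.range (gen₂ (n := n)) * LinearMap.range gen₁ ≤
        LinearMap.range gen₁ * LinearMap.range gen₂ := by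
      rw [Submodule.mul_le]
      rintro _ ⟨v, rfl⟩ _ ⟨w, rfl⟩
      rw [← mul_one (gen₁ w), gen₂_mul_gen₁_mul, mul_one]
      exact neg_mem (Submodule.mul_mem_mul ⟨w, rfl⟩ ⟨v, rfl⟩)
    calc _ = LinearMap.range (gen₂ (n := n)) * LinearMap.range gen₁ ^ p * LinearMap.range gen₁ := by
          rw [pow_succ, mul_assoc]
      _ ≤ LinearMap.range (gen₁ (n := n)) ^ p * LinearMap.range gen₂ * LinearMap.range gen₁ :=
          mul_le_mul' ih le_rfl
      _ ≤ _ := by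
          rw [pow_succ, mul_assoc, mul_assoc]
          exact mul_le_mul' le_rfl h

theorem comp_mem (p q : ℕ) (a : Lam n) :
    comp p q a ∈ LinearMap.range (gen₁ (n := n)) ^ p * LinearMap.range gen₂ ^ q := by
  induction a using Lam.induction generalizing p q with
  | scalar c =>
    rw [comp_algebraMap]
    split_ifs with h
    · rw [h.1, h.2, pow_zero, pow_zero, one_mul]
      exact Submodule.algebraMap_mem c
    · exact zero_mem _
  | add a b ha hb => rw [map_add]; exact add_mem (ha p q) (hb p q)
  | gen₁_mul v a ha =>
    rcases p with _ | p
    · rw [comp_zero_gen₁_mul]; exact zero_mem _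
    · rw [comp_gen₁_mul, pow_succ', mul_assoc]
      exact Submodule.mul_mem_mul ⟨v, rfl⟩ (ha p q)
  | gen₂_mul v a ha =>
    rcases q with _ | q
    · rw [comp_zero_gen₂_mul]; exact zero_mem _
    · rw [comp_gen₂_mul, pow_succ', ← mul_assoc]
      refine mul_le_mul' (range_gen₂_mul_pow_range_gen₁_le p) le_rfl ?_
      rw [mul_assoc]
      exact Submodule.mul_mem_mul ⟨v, rfl⟩ (ha p q)

theorem pow_range_ι_comp_eq_bot (f : Cn n →ₗ[ℂ] Cn n × Cn n) {p : ℕ} (hp : n < p) :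
    LinearMap.range ((ExteriorAlgebra.ι ℂ : _ →ₗ[ℂ] Lam n) ∘ₗ f) ^ p = ⊥ := by
  have e : (ExteriorAlgebra.ι ℂ : _ →ₗ[ℂ] Lam n) ∘ₗ f =
      (ExteriorAlgebra.map f).toLinearMap ∘ₗ ExteriorAlgebra.ι ℂ :=
    (ExteriorAlgebra.map_comp_ι f).symm
  have h : (⋀[ℂ]^p (Cn n)) = ⊥ := by
    have := exteriorPower.finrank_eq (R := ℂ) (M := Cn n) (n := p)
    rw [Module.finrank_fin_fun, Nat.choose_eq_zero_of_lt hp] at this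
    exact Submodule.finrank_eq_zero.mp this
  rw [e, LinearMap.range_comp, ← Submodule.map_pow]
  exact (congrArg _ h).trans (Submodule.map_bot _)

theorem comp_eq_zero_of_lt_left {p : ℕ} (hp : n < p) (q : ℕ) (a : Lam n) : comp p q a = 0 := by
  have h := comp_mem p q a
  have e : LinearMap.range (gen₁ (n := n)) ^ p = ⊥ := pow_range_ι_comp_eq_bot _ hp
  rwa [e, Submodule.bot_mul, Submodule.mem_bot] at h

theorem comp_eq_zero_of_lt_right (p : ℕ) {q : ℕ} (hq : n < q) (a : Lam n) : comp p q a = 0 := by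
  have h := comp_mem p q a
  have e : LinearMap.range (gen₂ (n := n)) ^ q = ⊥ := pow_range_ι_comp_eq_bot _ hq
  rwa [e, Submodule.mul_bot, Submodule.mem_bot] at h

theorem sum_comp (a : Lam n) :
    ∑ p ∈ Finset.range (n + 1), ∑ q ∈ Finset.range (n + 1), comp p q a = a := by
  induction a using Lam.induction with
  | scalar c =>
    simp only [comp_algebraMap]
    rw [Finset.sum_eq_single 0, Finset.sum_eq_single 0]
    · simp
    · intro q _ hq; simp [hq]
    · simp
    · intro p _ hp; simp [hp]
    · simp
  | add a b ha hb => simp only [map_add, Finset.sum_add_distrib, ha, hb]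
  | gen₁_mul v a ha =>
    rw [Finset.sum_range_succ']
    simp only [comp_gen₁_mul, comp_zero_gen₁_mul, Finset.sum_const_zero, add_zero]
    rw [Finset.sum_range_succ] at ha
    conv_rhs => rw [← ha]
    have h : gen₁ v * ∑ q ∈ Finset.range (n + 1), comp n q a = 0 := by
      rw [Finset.mul_sum]
      refine Finset.sum_eq_zero fun q _ => ?_
      rw [← comp_gen₁_mul, comp_eq_zero_of_lt_left (Nat.lt_succ_self n)]
    rw [mul_add, h, add_zero]
    simp only [Finset.mul_sum]
  | gen₂_mul v a ha =>
    conv_rhs => rw [← ha, Finset.mul_sum]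
    refine Finset.sum_congr rfl fun p _ => ?_
    rw [Finset.sum_range_succ', comp_zero_gen₂_mul, add_zero, Finset.sum_range_succ, mul_add,
      ← comp_gen₂_mul, comp_eq_zero_of_lt_right p (Nat.lt_succ_self n), add_zero, Finset.mul_sum]
    simp only [comp_gen₂_mul]

/-! ### Parity in graded Artin algebras -/

namespace GradedArtin

variable (A : GradedArtin.{u})

theorem homogeneous_induction {P : A.carrier → Prop} (add : ∀ r s, P r → P s → P (r + s))
    (homogeneous : ∀ k, ∀ r ∈ A.gr k, P r) (r : A.carrier) : P r :=
  DirectSum.Decomposition.inductionOn A.gr (homogeneous 0 0 (zero_mem _))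
    (fun m => homogeneous _ m m.2) (fun r s => add r s) r

variable {A}

theorem evenPart_apply_of_mem {k : ℤ} {r : A.carrier} (hr : r ∈ A.gr k) :
    A.evenPart r = if Even k then r else 0 := by
  simp only [evenPart, LinearMap.comp_apply, LinearEquiv.coe_coe,
    DirectSum.decomposeLinearEquiv_apply]
  rw [DirectSum.decompose_of_mem A.gr hr]
  refine (DirectSum.toModule_lof ℂ (M := fun k => A.gr k) k (⟨r, hr⟩ : A.gr k)).trans ?_
  split_ifs <;> rfl

theorem oddPart_apply (r : A.carrier) : A.oddPart r = r - A.evenPart r := rfl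

theorem oddPart_apply_of_mem {k : ℤ} {r : A.carrier} (hr : r ∈ A.gr k) :
    A.oddPart r = if Even k then 0 else r := by
  rw [oddPart_apply, evenPart_apply_of_mem hr]
  split_ifs <;> simp

theorem evenPart_add_oddPart (r : A.carrier) : A.evenPart r + A.oddPart r = r :=
  add_sub_cancel _ _

@[simp] theorem evenPart_evenPart (r : A.carrier) : A.evenPart (A.evenPart r) = A.evenPart r := by
  induction r using homogeneous_induction with
  | add r s hr hs => simp only [map_add, hr, hs]
  | homogeneous k r hr =>
    simp only [evenPart_apply_of_mem hr]
    split_ifs with h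
    · simp [evenPart_apply_of_mem hr, h]
    · simp

@[simp] theorem evenPart_oddPart (r : A.carrier) : A.evenPart (A.oddPart r) = 0 := by
  rw [oddPart_apply, map_sub, evenPart_evenPart, sub_self]

theorem evenPart_mul (r s : A.carrier) :
    A.evenPart (r * s) = A.evenPart r * A.evenPart s + A.oddPart r * A.oddPart s := by
  induction r using homogeneous_induction with
  | add r r' hr hr' => simp only [map_add, add_mul, hr, hr']; abel
  | homogeneous i r hr =>
    induction s using homogeneous_induction with
    | add s s' hs hs' => simp only [map_add, mul_add, hs, hs']; abel
    | homogeneous j s hs =>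
      rw [evenPart_apply_of_mem (SetLike.mul_mem_graded hr hs), evenPart_apply_of_mem hr,
        evenPart_apply_of_mem hs, oddPart_apply_of_mem hr, oddPart_apply_of_mem hs]
      by_cases hi : Even i <;> by_cases hj : Even j <;> simp [Int.even_add, hi, hj]

theorem evenPart_mul_comm (r s : A.carrier) : A.evenPart r * s = s * A.evenPart r := by
  induction r using homogeneous_induction with
  | add r r' hr hr' => simp only [map_add, add_mul, mul_add, hr, hr']
  | homogeneous i r hr =>
    induction s using homogeneous_induction with
    | add s s' hs hs' => simp only [mul_add, add_mul, hs, hs']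
    | homogeneous j s hs =>
      rw [evenPart_apply_of_mem hr]
      split_ifs with hi
      · rw [A.comm hr hs, Int.negOnePow_even _ (hi.mul_right j), one_smul]
      · simp

theorem oddPart_mul_oddPart_comm (r s : A.carrier) :
    A.oddPart r * A.oddPart s = -(A.oddPart s * A.oddPart r) := by
  induction r using homogeneous_induction with
  | add r r' hr hr' => simp only [map_add, add_mul, mul_add, hr, hr', neg_add]
  | homogeneous i r hr =>
    induction s using homogeneous_induction with
    | add s s' hs hs' => simp only [map_add, mul_add, add_mul, hs, hs', neg_add]
    | homogeneous j s hs =>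
      rw [oddPart_apply_of_mem hr, oddPart_apply_of_mem hs]
      by_cases hi : Even i <;> by_cases hj : Even j <;> simp only [hi, hj, if_true, if_false,
        zero_mul, mul_zero, neg_zero]
      rw [A.comm hr hs, Int.negOnePow_odd _
        ((Int.not_even_iff_odd.mp hi).mul (Int.not_even_iff_odd.mp hj))]
      simp

/-- Elements concentrated in even degrees. -/
def IsEven (r : A.carrier) : Prop := A.evenPart r = r

/-- Elements concentrated in odd degrees. -/
def IsOdd (r : A.carrier) : Prop := A.evenPart r = 0

theorem IsOdd.oddPart_eq {r : A.carrier} (h : A.IsOdd r) : A.oddPart r = r := by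
  rw [oddPart_apply, h, sub_zero]

theorem IsEven.oddPart_eq {r : A.carrier} (h : A.IsEven r) : A.oddPart r = 0 := by
  rw [oddPart_apply, h, sub_self]

theorem isEven_evenPart (r : A.carrier) : A.IsEven (A.evenPart r) := evenPart_evenPart r

theorem isOdd_oddPart (r : A.carrier) : A.IsOdd (A.oddPart r) := evenPart_oddPart r

variable {r s : A.carrier}

theorem IsEven.mul (hr : A.IsEven r) (hs : A.IsEven s) : A.IsEven (r * s) := by
  rw [IsEven, evenPart_mul, hr, hs, hr.oddPart_eq, zero_mul, add_zero]

theorem IsOdd.mul (hr : A.IsOdd r) (hs : A.IsOdd s) : A.IsEven (r * s) := by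
  rw [IsEven, evenPart_mul, hr, hr.oddPart_eq, hs.oddPart_eq, zero_mul, zero_add]

theorem IsEven.mul_isOdd (hr : A.IsEven r) (hs : A.IsOdd s) : A.IsOdd (r * s) := by
  rw [IsOdd, evenPart_mul, hs, hr.oddPart_eq, mul_zero, zero_mul, add_zero]

theorem IsOdd.mul_isEven (hr : A.IsOdd r) (hs : A.IsEven s) : A.IsOdd (r * s) := by
  rw [IsOdd, evenPart_mul, hr, hs.oddPart_eq, mul_zero, zero_mul, add_zero]

theorem IsEven.mul_comm (hr : A.IsEven r) (s : A.carrier) : r * s = s * r := by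
  rw [← hr, evenPart_mul_comm]

theorem IsOdd.mul_comm (hr : A.IsOdd r) (hs : A.IsOdd s) : r * s = -(s * r) := by
  rw [← hr.oddPart_eq, ← hs.oddPart_eq, oddPart_mul_oddPart_comm]

theorem isEven_or_isOdd_of_mem {k : ℤ} (hr : r ∈ A.gr k) : A.IsEven r ∨ A.IsOdd r := by
  rw [IsEven, IsOdd, evenPart_apply_of_mem hr]
  by_cases hk : Even k
  · exact Or.inl (if_pos hk)
  · exact Or.inr (if_neg hk)

theorem isEven_one : A.IsEven 1 := by
  rw [IsEven, evenPart_apply_of_mem (SetLike.one_mem_graded A.gr), if_pos Even.zero]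

end GradedArtin

theorem ProArtin.map_evenPart (R : ProArtin.{u}) {i j : ℕ} (h : i ≤ j)
    (r : (R.level j).carrier) :
    R.map h ((R.level j).evenPart r) = (R.level i).evenPart (R.map h r) := by
  induction r using GradedArtin.homogeneous_induction with
  | add r s hr hs => simp only [map_add, hr, hs]
  | homogeneous k r hr =>
    rw [GradedArtin.evenPart_apply_of_mem hr, GradedArtin.evenPart_apply_of_mem (R.map_gr h k hr)]
    split_ifs <;> simp

/-! ### The action of polyvector-valued forms on forms, with coefficients -/

section Contractions

variable {A : GradedArtin.{u}}

/-- Invariance under the total parity involution. -/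
def IsEvenFib (w : Fib n A) : Prop :=
  TensorProduct.map inv (A.evenPart - A.oddPart) w = w

theorem Fib.induction {P : Fib n A → Prop} (add : ∀ w w', P w → P w' → P (w + w'))
    (even : ∀ a r, A.IsEven r → P (a ⊗ₜ r)) (odd : ∀ a r, A.IsOdd r → P (a ⊗ₜ r))
    (w : Fib n A) : P w := by
  induction w using TensorProduct.induction_on with
  | zero => simpa using even 0 0 (map_zero _)
  | tmul a r =>
    rw [← A.evenPart_add_oddPart r, TensorProduct.tmul_add]
    exact add _ _ (even _ _ (A.isEven_evenPart r)) (odd _ _ (A.isOdd_oddPart r))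
  | add w w' h h' => exact add _ _ h h'

theorem IsEvenFib.induction {P : Fib n A → Prop} (add : ∀ w w', P w → P w' → P (w + w'))
    (even : ∀ a r, inv a = a → A.IsEven r → P (a ⊗ₜ r))
    (odd : ∀ a r, inv a = -a → A.IsOdd r → P (a ⊗ₜ r)) {w : Fib n A} (hw : IsEvenFib w) :
    P w := by
  have key : ∀ w : Fib n A,
      P ((2⁻¹ : ℂ) • (w + TensorProduct.map inv (A.evenPart - A.oddPart) w)) := by
    refine Fib.induction (fun w w' h h' => ?_) (fun a r hr => ?_) (fun a r hr => ?_)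
    · rw [map_add, add_add_add_comm, smul_add]
      exact add _ _ h h'
    · rw [TensorProduct.map_tmul, LinearMap.sub_apply, hr, hr.oddPart_eq, sub_zero,
        ← TensorProduct.add_tmul, TensorProduct.smul_tmul']
      refine even _ _ ?_ hr
      rw [map_smul, map_add, inv_inv, add_comm]
    · rw [TensorProduct.map_tmul, LinearMap.sub_apply, hr, hr.oddPart_eq, zero_sub,
        TensorProduct.tmul_neg, ← sub_eq_add_neg, ← TensorProduct.sub_tmul,
        TensorProduct.smul_tmul']
      refine odd _ _ ?_ hr
      rw [map_smul, map_sub, inv_inv, ← smul_neg, neg_sub]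
  have h := key w
  rw [hw, ← two_smul ℂ w, smul_smul, inv_mul_cancel₀ two_ne_zero, one_smul] at h
  exact h

theorem koszul_tmul (f : Lam n →ₗ[ℂ] Lam n →ₗ[ℂ] Lam n) (a b : Lam n) (r s : A.carrier) :
    koszul f (a ⊗ₜ r) (b ⊗ₜ s) =
      f a b ⊗ₜ[ℂ] (A.evenPart r * s) + f a (inv b) ⊗ₜ[ℂ] (A.oddPart r * s) := rfl

theorem koszul_tmul_of_isEven (f : Lam n →ₗ[ℂ] Lam n →ₗ[ℂ] Lam n) (a b : Lam n)
    {r : A.carrier} (hr : A.IsEven r) (s : A.carrier) :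
    koszul f (a ⊗ₜ r) (b ⊗ₜ s) = f a b ⊗ₜ[ℂ] (r * s) := by
  rw [koszul_tmul, hr.oddPart_eq, hr, zero_mul, TensorProduct.tmul_zero, add_zero]

theorem koszul_tmul_of_isOdd (f : Lam n →ₗ[ℂ] Lam n →ₗ[ℂ] Lam n) (a b : Lam n)
    {r : A.carrier} (hr : A.IsOdd r) (s : A.carrier) :
    koszul f (a ⊗ₜ r) (b ⊗ₜ s) = f a (inv b) ⊗ₜ[ℂ] (r * s) := by
  rw [koszul_tmul, hr.oddPart_eq, hr, zero_mul, TensorProduct.tmul_zero, zero_add]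

theorem fibContr_tmul_of_isEven (a b : Lam n) {r : A.carrier} (hr : A.IsEven r)
    (s : A.carrier) : fibContr (a ⊗ₜ r) (b ⊗ₜ s) = contr a b ⊗ₜ[ℂ] (r * s) :=
  koszul_tmul_of_isEven _ a b hr s

theorem fibContr_tmul_of_isOdd (a b : Lam n) {r : A.carrier} (hr : A.IsOdd r)
    (s : A.carrier) : fibContr (a ⊗ₜ r) (b ⊗ₜ s) = contr a (inv b) ⊗ₜ[ℂ] (r * s) :=
  koszul_tmul_of_isOdd _ a b hr s

theorem fibMul_tmul_of_isEven (a b : Lam n) {r : A.carrier} (hr : A.IsEven r)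
    (s : A.carrier) : fibMul (a ⊗ₜ r) (b ⊗ₜ s) = (a * b) ⊗ₜ[ℂ] (r * s) :=
  koszul_tmul_of_isEven _ a b hr s

theorem fibMul_tmul_of_isOdd (a b : Lam n) {r : A.carrier} (hr : A.IsOdd r)
    (s : A.carrier) : fibMul (a ⊗ₜ r) (b ⊗ₜ s) = (a * inv b) ⊗ₜ[ℂ] (r * s) :=
  koszul_tmul_of_isOdd _ a b hr s

theorem lmul_tmul (a b : Lam n) (r : A.carrier) : lmul a (b ⊗ₜ r) = (a * b) ⊗ₜ[ℂ] r := rfl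

theorem fibContr_fibMul (α β w : Fib n A) :
    fibContr (fibMul α β) w = fibContr α (fibContr β w) := by
  induction w using TensorProduct.induction_on with
  | zero => simp
  | add w w' h h' => simp only [map_add, h, h']
  | tmul c s =>
    induction α using Fib.induction with
    | add α α' h h' => simp only [map_add, LinearMap.add_apply, h, h']
    | even a r hr =>
      induction β using Fib.induction with
      | add β β' h h' => simp only [map_add, LinearMap.add_apply, h, h']
      | even b t ht =>
        rw [fibMul_tmul_of_isEven _ _ hr, fibContr_tmul_of_isEven _ _ (hr.mul ht),
          fibContr_tmul_of_isEven _ _ ht, fibContr_tmul_of_isEven _ _ hr, contr_mul, mul_assoc]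
      | odd b t ht =>
        rw [fibMul_tmul_of_isEven _ _ hr, fibContr_tmul_of_isOdd _ _ (hr.mul_isOdd ht),
          fibContr_tmul_of_isOdd _ _ ht, fibContr_tmul_of_isEven _ _ hr, contr_mul, mul_assoc]
    | odd a r hr =>
      induction β using Fib.induction with
      | add β β' h h' => simp only [map_add, LinearMap.add_apply, h, h']
      | even b t ht =>
        rw [fibMul_tmul_of_isOdd _ _ hr, fibContr_tmul_of_isOdd _ _ (hr.mul_isEven ht),
          fibContr_tmul_of_isEven _ _ ht, fibContr_tmul_of_isOdd _ _ hr, contr_mul, contr_inv,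
          mul_assoc]
      | odd b t ht =>
        rw [fibMul_tmul_of_isOdd _ _ hr, fibContr_tmul_of_isEven _ _ (hr.mul ht),
          fibContr_tmul_of_isOdd _ _ ht, fibContr_tmul_of_isOdd _ _ hr, contr_mul, contr_inv,
          inv_inv, mul_assoc]

theorem fibMul_comm_of_isEvenFib {γ : Fib n A} (hγ : IsEvenFib γ) (β : Fib n A) :
    fibMul γ β = fibMul β γ := by
  refine hγ.induction (P := fun γ => fibMul γ β = fibMul β γ) (fun w w' h h' => ?_)
    (fun a r ha hr => ?_) (fun a r ha hr => ?_)
  · simp only [map_add, LinearMap.add_apply, h, h']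
  · induction β using Fib.induction with
    | add β β' h h' => simp only [map_add, LinearMap.add_apply, h, h']
    | even b t ht =>
      rw [fibMul_tmul_of_isEven _ _ hr, fibMul_tmul_of_isEven _ _ ht, hr.mul_comm,
        mul_comm_of_inv_eq ha]
    | odd b t ht =>
      rw [fibMul_tmul_of_isEven _ _ hr, fibMul_tmul_of_isOdd _ _ ht, hr.mul_comm, ha,
        mul_comm_of_inv_eq ha]
  · induction β using Fib.induction with
    | add β β' h h' => simp only [map_add, LinearMap.add_apply, h, h']
    | even b t ht =>
      rw [fibMul_tmul_of_isOdd _ _ hr, fibMul_tmul_of_isEven _ _ ht, ← ht.mul_comm,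
        mul_eq_inv_mul_of_inv_eq_neg ha, inv_inv]
    | odd b t ht =>
      rw [fibMul_tmul_of_isOdd _ _ hr, fibMul_tmul_of_isOdd _ _ ht, hr.mul_comm ht, ha,
        mul_eq_inv_mul_of_inv_eq_neg ha, inv_inv, mul_neg, TensorProduct.tmul_neg,
        TensorProduct.neg_tmul]

theorem fibContr_comm_of_isEvenFib {γ : Fib n A} (hγ : IsEvenFib γ) (β w : Fib n A) :
    fibContr γ (fibContr β w) = fibContr β (fibContr γ w) := by
  rw [← fibContr_fibMul, ← fibContr_fibMul, fibMul_comm_of_isEvenFib hγ]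

theorem fibMul_tmul_one (a : Lam n) (w : Fib n A) : fibMul (a ⊗ₜ 1) w = lmul a w := by
  induction w using TensorProduct.induction_on with
  | zero => rw [map_zero, map_zero]
  | add w w' h h' => rw [map_add, map_add, h, h']
  | tmul b s => rw [fibMul_tmul_of_isEven _ _ A.isEven_one, one_mul, lmul_tmul]

theorem fibContr_gen₂_tmul_one (v : Cn n) (w : Fib n A) :
    fibContr (gen₂ v ⊗ₜ 1) w = lmul (gen₂ v) w := by
  induction w using TensorProduct.induction_on with
  | zero => rw [map_zero, map_zero]
  | add w w' h h' => rw [map_add, map_add, h, h']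
  | tmul b s => rw [fibContr_tmul_of_isEven _ _ A.isEven_one, contr_gen₂, one_mul, lmul_tmul]

theorem fibContr_lmul_gen₂ (v : Cn n) (β w : Fib n A) :
    fibContr (lmul (gen₂ v) β) w = lmul (gen₂ v) (fibContr β w) := by
  rw [← fibMul_tmul_one, fibContr_fibMul, fibContr_gen₂_tmul_one]

theorem lmul_gen₂_fibContr {γ : Fib n A} (hγ : IsEvenFib γ) (v : Cn n) (w : Fib n A) :
    lmul (gen₂ v) (fibContr γ w) = fibContr γ (lmul (gen₂ v) w) := by
  rw [← fibContr_gen₂_tmul_one, ← fibContr_gen₂_tmul_one, fibContr_comm_of_isEvenFib hγ]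

theorem lmul_gen₁_fibContr {γ : Fib n A} (hγ : IsEvenFib γ) (i : Fin n) (w : Fib n A) :
    lmul (gen₁ (Pi.single i 1)) (fibContr γ w) =
      fibContr γ (lmul (gen₁ (Pi.single i 1)) w) +
        fibContr ((leftDer i).rTensor A.carrier γ) w := by
  induction w using TensorProduct.induction_on with
  | zero => simp
  | add w w' h h' => simp only [map_add, h, h']; abel
  | tmul c s =>
    refine hγ.induction (P := fun γ => lmul (gen₁ (Pi.single i 1)) (fibContr γ (c ⊗ₜ s)) =
      fibContr γ (lmul (gen₁ (Pi.single i 1)) (c ⊗ₜ s)) +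
        fibContr ((leftDer i).rTensor A.carrier γ) (c ⊗ₜ s)) (fun w w' h h' => ?_)
      (fun a r ha hr => ?_) (fun a r ha hr => ?_)
    · simp only [map_add, LinearMap.add_apply, h, h']; abel
    · rw [fibContr_tmul_of_isEven _ _ hr, lmul_tmul, lmul_tmul, LinearMap.rTensor_tmul,
        fibContr_tmul_of_isEven _ _ hr, fibContr_tmul_of_isEven _ _ hr, gen₁_mul_contr, ha,
        TensorProduct.add_tmul]
    · rw [fibContr_tmul_of_isOdd _ _ hr, lmul_tmul, lmul_tmul, LinearMap.rTensor_tmul,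
        fibContr_tmul_of_isOdd _ _ hr, fibContr_tmul_of_isOdd _ _ hr, gen₁_mul_contr, ha,
        TensorProduct.add_tmul, inv_mul, inv_gen₁, neg_mul, map_neg, map_neg,
        LinearMap.neg_apply]

theorem fibEven_of_isEvenFib {γ : Fib n A} (hγ : IsEvenFib γ) : fibEven γ = γ := by
  rw [fibEven, LinearMap.smul_apply, LinearMap.add_apply, hγ, LinearMap.id_apply,
    ← two_smul ℂ γ, smul_smul, inv_mul_cancel₀ two_ne_zero, one_smul]

theorem fibOdd_of_isEvenFib {γ : Fib n A} (hγ : IsEvenFib γ) : fibOdd γ = 0 := by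
  rw [fibOdd, LinearMap.smul_apply, LinearMap.sub_apply, hγ, LinearMap.id_apply, sub_self,
    smul_zero]

theorem isEvenFib_of_mem_polyDeg {γ : Fib n A} (hγ : γ ∈ polyDeg n A 0) : IsEvenFib γ := by
  induction hγ using Submodule.span_induction with
  | zero => exact map_zero _
  | add w w' _ _ h h' => rw [IsEvenFib, map_add, h, h']
  | smul c w _ h => rw [IsEvenFib, map_smul, h]
  | mem w h =>
    obtain ⟨p, q, a, r, hr, -, rfl⟩ := h
    rw [IsEvenFib, TensorProduct.map_tmul, inv_comp, LinearMap.sub_apply,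
      GradedArtin.evenPart_apply_of_mem hr, GradedArtin.oddPart_apply_of_mem hr]
    have parity : Even (0 + p - q : ℤ) ↔ Even (p + q) := by
      rw [zero_add, Int.even_sub, Int.even_coe_nat, Int.even_coe_nat, Nat.even_add]
    by_cases h : Even (p + q)
    · rw [h.neg_one_pow, one_smul, if_pos (parity.mpr h), if_pos (parity.mpr h), sub_zero]
    · rw [(Nat.not_even_iff_odd.mp h).neg_one_pow, if_neg (parity.not.mpr h),
        if_neg (parity.not.mpr h), neg_one_smul, zero_sub, TensorProduct.neg_tmul,
        TensorProduct.tmul_neg, neg_neg]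

/-- The filtration of a fibre by the order of its coefficients at the maximal ideal `𝔐`: the span
of the `a ⊗ r` with `r` in the right ideal generated by `𝔐 ^ k`. -/
def adicFiltration (n : ℕ) (A : GradedArtin.{u}) (k : ℕ) : Submodule ℂ (Fib n A) :=
  Submodule.span ℂ {t | ∃ (a : Lam n) (r : A.carrier),
    r ∈ A.max.restrictScalars ℂ ^ k * ⊤ ∧ t = a ⊗ₜ[ℂ] r}

theorem adicFiltration_zero : adicFiltration n A 0 = ⊤ := by
  rw [eq_top_iff, ← TensorProduct.span_tmul_eq_top]
  refine Submodule.span_mono ?_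
  rintro _ ⟨a, r, rfl⟩
  exact ⟨a, r, by rw [pow_zero, one_mul]; exact Submodule.mem_top, rfl⟩

theorem exists_adicFiltration_eq_bot (A : GradedArtin.{u}) :
    ∃ N, ∀ n, adicFiltration n A N = ⊥ := by
  obtain ⟨N, hN⟩ := A.max_nilpotent
  refine ⟨N, fun n => eq_bot_iff.mpr (Submodule.span_le.mpr ?_)⟩
  rintro _ ⟨a, r, hr, rfl⟩
  rw [hN, Submodule.bot_mul, Submodule.mem_bot] at hr
  rw [hr, TensorProduct.tmul_zero]
  exact zero_mem _

theorem koszul_mem_adicFiltration (f : Lam n →ₗ[ℂ] Lam n →ₗ[ℂ] Lam n) {d : ℤ} {k : ℕ}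
    {γ w : Fib n A} (hγ : γ ∈ polyDeg n A d) (hw : w ∈ adicFiltration n A k) :
    koszul f γ w ∈ adicFiltration n A (k + 1) := by
  induction hγ using Submodule.span_induction with
  | zero => rw [map_zero, LinearMap.zero_apply]; exact zero_mem _
  | add γ γ' _ _ h h' => rw [map_add, LinearMap.add_apply]; exact add_mem h h'
  | smul c γ _ h => rw [map_smul, LinearMap.smul_apply]; exact Submodule.smul_mem _ c h
  | mem γ h =>
    obtain ⟨p, q, a, r, hr, hrm, rfl⟩ := h
    induction hw using Submodule.span_induction with
    | zero => rw [map_zero]; exact zero_mem _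
    | add w w' _ _ h h' => rw [map_add]; exact add_mem h h'
    | smul c w _ h => rw [map_smul]; exact Submodule.smul_mem _ c h
    | mem w hw =>
      obtain ⟨b, s, hs, rfl⟩ := hw
      have hrs : r * s ∈ A.max.restrictScalars ℂ ^ (k + 1) * ⊤ := by
        rw [pow_succ', mul_assoc]
        exact Submodule.mul_mem_mul hrm hs
      apply Submodule.subset_span
      rcases GradedArtin.isEven_or_isOdd_of_mem hr with hr | hr
      · exact ⟨_, _, hrs, koszul_tmul_of_isEven _ _ _ hr s⟩
      · exact ⟨_, _, hrs, koszul_tmul_of_isOdd _ _ _ hr s⟩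

theorem fibContr_pow_mem_adicFiltration {d : ℤ} {γ : Fib n A} (hγ : γ ∈ polyDeg n A d) (k : ℕ)
    (w : Fib n A) : (fibContr γ ^ k) w ∈ adicFiltration n A k := by
  induction k with
  | zero => rw [adicFiltration_zero]; exact Submodule.mem_top
  | succ k ih =>
    rw [pow_succ', Module.End.mul_apply]
    exact koszul_mem_adicFiltration _ hγ ih

theorem exists_fibContr_pow_eq_zero (A : GradedArtin.{u}) :
    ∃ N : ℕ, ∀ (n : ℕ) (d : ℤ), ∀ γ ∈ polyDeg n A d, fibContr γ ^ N = 0 := by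
  obtain ⟨N, hN⟩ := exists_adicFiltration_eq_bot A
  refine ⟨N, fun n d γ hγ => LinearMap.ext fun w => ?_⟩
  have h := fibContr_pow_mem_adicFiltration hγ N w
  rwa [hN, Submodule.mem_bot] at h

end Contractions

/-! ### Derivations of the coefficients -/

section Coefficients

variable {R : ProArtin.{u}}

theorem ProArtin.map_isEven {i j : ℕ} (h : i ≤ j) {r : (R.level j).carrier}
    (hr : (R.level j).IsEven r) : (R.level i).IsEven (R.map h r) := by
  rw [GradedArtin.IsEven, ← R.map_evenPart, hr]

theorem ProArtin.map_isOdd {i j : ℕ} (h : i ≤ j) {r : (R.level j).carrier}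
    (hr : (R.level j).IsOdd r) : (R.level i).IsOdd (R.map h r) := by
  rw [GradedArtin.IsOdd, ← R.map_evenPart, hr, map_zero]

theorem lTensor_fibContr {i j : ℕ} (h : i ≤ j) (γ w : Fib n (R.level j)) :
    (R.map h).toLinearMap.lTensor (Lam n) (fibContr γ w) =
      fibContr ((R.map h).toLinearMap.lTensor (Lam n) γ)
        ((R.map h).toLinearMap.lTensor (Lam n) w) := by
  induction w using TensorProduct.induction_on with
  | zero => simp
  | add w w' h h' => simp only [map_add, h, h']
  | tmul c s =>
    induction γ using Fib.induction with
    | add γ γ' h h' => simp only [map_add, LinearMap.add_apply, h, h']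
    | even a r hr =>
      rw [fibContr_tmul_of_isEven _ _ hr, LinearMap.lTensor_tmul, LinearMap.lTensor_tmul,
        LinearMap.lTensor_tmul]
      simp only [AlgHom.toLinearMap_apply]
      rw [fibContr_tmul_of_isEven _ _ (ProArtin.map_isEven h hr), map_mul]
    | odd a r hr =>
      rw [fibContr_tmul_of_isOdd _ _ hr, LinearMap.lTensor_tmul, LinearMap.lTensor_tmul,
        LinearMap.lTensor_tmul]
      simp only [AlgHom.toLinearMap_apply]
      rw [fibContr_tmul_of_isOdd _ _ (ProArtin.map_isOdd h hr), map_mul]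

variable (v : R.Der) (i : ℕ) {r : (R.level (v.shift i)).carrier}

theorem ProArtin.Der.even_isEven (hr : (R.level (v.shift i)).IsEven r) :
    (R.level i).IsEven (v.even i r) := by
  rw [GradedArtin.IsEven, ← v.even_parity, hr]

theorem ProArtin.Der.even_isOdd (hr : (R.level (v.shift i)).IsOdd r) :
    (R.level i).IsOdd (v.even i r) := by
  rw [GradedArtin.IsOdd, ← v.even_parity, hr, map_zero]

theorem ProArtin.Der.odd_isEven (hr : (R.level (v.shift i)).IsEven r) :
    (R.level i).IsOdd (v.odd i r) := by
  have h := v.odd_parity i r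
  rw [hr, GradedArtin.oddPart_apply, eq_sub_iff_add_eq, add_eq_left] at h
  exact h

theorem ProArtin.Der.odd_isOdd (hr : (R.level (v.shift i)).IsOdd r) :
    (R.level i).IsEven (v.odd i r) := by
  have h := v.odd_parity i r
  rw [hr, map_zero, GradedArtin.oddPart_apply] at h
  exact (sub_eq_zero.mp h.symm).symm

/-- `∂_v` on a fibre, from the coefficients `R_{shift i}` to the coefficients `R_i`. -/
def ProArtin.Der.fib (n : ℕ) : Fib n (R.level (v.shift i)) →ₗ[ℂ] Fib n (R.level i) :=
  TensorProduct.map LinearMap.id (v.even i) + TensorProduct.map inv (v.odd i)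

theorem ProArtin.Der.fib_tmul (a : Lam n) (r : (R.level (v.shift i)).carrier) :
    v.fib i n (a ⊗ₜ r) = a ⊗ₜ[ℂ] v.even i r + inv a ⊗ₜ[ℂ] v.odd i r := rfl

theorem ProArtin.Der.fib_fibContr_tmul_of_isEven {a c : Lam n}
    {r s : (R.level (v.shift i)).carrier} (ha : inv a = a) (hr : (R.level (v.shift i)).IsEven r) :
    v.fib i n (fibContr (a ⊗ₜ r) (c ⊗ₜ s)) =
      fibContr (v.fib i n (a ⊗ₜ r))
          ((R.map (v.le_shift i)).toLinearMap.lTensor (Lam n) (c ⊗ₜ s)) +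
        fibContr ((R.map (v.le_shift i)).toLinearMap.lTensor (Lam n) (a ⊗ₜ r))
          (v.fib i n (c ⊗ₜ s)) := by
  rw [fibContr_tmul_of_isEven _ _ hr, v.fib_tmul, v.fib_tmul, v.fib_tmul, map_add, map_add,
    LinearMap.add_apply, LinearMap.lTensor_tmul, LinearMap.lTensor_tmul]
  simp only [AlgHom.toLinearMap_apply]
  rw [fibContr_tmul_of_isEven _ _ (v.even_isEven i hr),
    fibContr_tmul_of_isOdd _ _ (v.odd_isEven i hr),
    fibContr_tmul_of_isEven _ _ (ProArtin.map_isEven _ hr),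
    fibContr_tmul_of_isEven _ _ (ProArtin.map_isEven _ hr), v.even_mul, v.odd_mul,
    hr.oddPart_eq, contr_inv, ha, TensorProduct.tmul_add, TensorProduct.tmul_add]
  rw [hr, sub_zero]
  abel

theorem ProArtin.Der.fib_fibContr_tmul_of_isOdd {a c : Lam n}
    {r s : (R.level (v.shift i)).carrier} (ha : inv a = -a) (hr : (R.level (v.shift i)).IsOdd r) :
    v.fib i n (fibContr (a ⊗ₜ r) (c ⊗ₜ s)) =
      fibContr (v.fib i n (a ⊗ₜ r))
          ((R.map (v.le_shift i)).toLinearMap.lTensor (Lam n) (c ⊗ₜ s)) +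
        fibContr ((R.map (v.le_shift i)).toLinearMap.lTensor (Lam n) (a ⊗ₜ r))
          (v.fib i n (c ⊗ₜ s)) := by
  rw [fibContr_tmul_of_isOdd _ _ hr, v.fib_tmul, v.fib_tmul, v.fib_tmul, map_add, map_add,
    LinearMap.add_apply, LinearMap.lTensor_tmul, LinearMap.lTensor_tmul]
  simp only [AlgHom.toLinearMap_apply]
  rw [fibContr_tmul_of_isOdd _ _ (v.even_isOdd i hr),
    fibContr_tmul_of_isEven _ _ (v.odd_isOdd i hr),
    fibContr_tmul_of_isOdd _ _ (ProArtin.map_isOdd _ hr),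
    fibContr_tmul_of_isOdd _ _ (ProArtin.map_isOdd _ hr), v.even_mul, v.odd_mul,
    hr.oddPart_eq, contr_inv, ha, inv_inv, TensorProduct.tmul_add, TensorProduct.tmul_add]
  rw [hr, zero_sub]
  simp only [map_neg, LinearMap.neg_apply, TensorProduct.neg_tmul, TensorProduct.tmul_neg,
    neg_mul, neg_neg]
  abel

theorem ProArtin.Der.fib_fibContr {γ : Fib n (R.level (v.shift i))} (hγ : IsEvenFib γ)
    (w : Fib n (R.level (v.shift i))) :
    v.fib i n (fibContr γ w) =
      fibContr (v.fib i n γ) ((R.map (v.le_shift i)).toLinearMap.lTensor (Lam n) w) +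
        fibContr ((R.map (v.le_shift i)).toLinearMap.lTensor (Lam n) γ) (v.fib i n w) := by
  induction w using TensorProduct.induction_on with
  | zero => simp
  | add w w' h h' => simp only [map_add, h, h']; abel
  | tmul c s =>
    refine hγ.induction (P := fun γ => v.fib i n (fibContr γ (c ⊗ₜ s)) =
      fibContr (v.fib i n γ) ((R.map (v.le_shift i)).toLinearMap.lTensor (Lam n) (c ⊗ₜ s)) +
        fibContr ((R.map (v.le_shift i)).toLinearMap.lTensor (Lam n) γ) (v.fib i n (c ⊗ₜ s)))
      (fun w w' h h' => ?_) (fun a r ha hr => v.fib_fibContr_tmul_of_isEven i ha hr)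
      (fun a r ha hr => v.fib_fibContr_tmul_of_isOdd i ha hr)
    simp only [map_add, LinearMap.add_apply, h, h']; abel

end Coefficients

/-! ### Leibniz rules for `∂̄`, `∂` and contractions -/

section Leibniz

variable {W : Type*} [AddCommGroup W] [Module ℂ W] [Module.Finite ℂ W]

/-- A bilinear map in linear coordinates, as a real continuous bilinear map. -/
theorem exists_coord_bilin (F : W →ₗ[ℂ] W →ₗ[ℂ] W) :
    ∃ G : (Fin (Module.finrank ℂ W) → ℂ) →L[ℝ] (Fin (Module.finrank ℂ W) → ℂ) →L[ℝ]
      (Fin (Module.finrank ℂ W) → ℂ), ∀ a b, G (coords W a) (coords W b) = coords W (F a b) := by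
  let G : (Fin (Module.finrank ℂ W) → ℂ) →ₗ[ℝ] (Fin (Module.finrank ℂ W) → ℂ) →ₗ[ℝ]
      (Fin (Module.finrank ℂ W) → ℂ) :=
    LinearMap.mk₂ ℝ (fun a b => coords W (F ((coords W).symm a) ((coords W).symm b)))
      (by intros; simp)
      (by intro c a b; simp only [← Complex.coe_smul, map_smul, LinearMap.smul_apply])
      (by intros; simp) (by intro c a b; simp only [← Complex.coe_smul, map_smul])
  refine ⟨LinearMap.toContinuousLinearMap (LinearMap.toContinuousLinearMap.toLinearMap ∘ₗ G),
    fun a b => ?_⟩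
  change coords W (F ((coords W).symm (coords W a)) ((coords W).symm (coords W b))) = _
  rw [LinearEquiv.symm_apply_apply, LinearEquiv.symm_apply_apply]

theorem dirDeriv_bilin (F : W →ₗ[ℂ] W →ₗ[ℂ] W) {f g : Cn n → W} {y : Cn n} (hf : DiffAt f y)
    (hg : DiffAt g y) (u : Cn n) :
    dirDeriv (fun z => F (f z) (g z)) y u =
      F (dirDeriv f y u) (g y) + F (f y) (dirDeriv g y u) := by
  obtain ⟨G, hG⟩ := exists_coord_bilin F
  have h₁ : (fun z => coords W (F (f z) (g z))) =
      fun z => G (coords W (f z)) (coords W (g z)) := by funext z; rw [hG]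
  have h₂ := G.hasFDerivAt_of_bilinear hf.hasFDerivAt hg.hasFDerivAt
  unfold dirDeriv
  rw [h₁, h₂.fderiv, LinearEquiv.symm_apply_eq, map_add, ← hG, ← hG,
    LinearEquiv.apply_symm_apply, LinearEquiv.apply_symm_apply, add_comm]
  rfl

theorem dz_bilin (F : W →ₗ[ℂ] W →ₗ[ℂ] W) {f g : Cn n → W} {y : Cn n} (hf : DiffAt f y)
    (hg : DiffAt g y) (i : Fin n) :
    dz (fun z => F (f z) (g z)) y i = F (dz f y i) (g y) + F (f y) (dz g y i) := by
  simp only [dz, dirDeriv_bilin F hf hg, map_smul, map_sub, LinearMap.smul_apply,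
    LinearMap.sub_apply, smul_add, smul_sub]
  abel

theorem dzbar_bilin (F : W →ₗ[ℂ] W →ₗ[ℂ] W) {f g : Cn n → W} {y : Cn n} (hf : DiffAt f y)
    (hg : DiffAt g y) (i : Fin n) :
    dzbar (fun z => F (f z) (g z)) y i = F (dzbar f y i) (g y) + F (f y) (dzbar g y i) := by
  simp only [dzbar, dirDeriv_bilin F hf hg, map_smul, map_add, LinearMap.smul_apply,
    LinearMap.add_apply, smul_add]
  abel

theorem dirDeriv_congr {f g : Cn n → W} {y : Cn n} (h : f =ᶠ[nhds y] g) (u : Cn n) :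
    dirDeriv f y u = dirDeriv g y u := by
  have h' : (fun z => coords W (f z)) =ᶠ[nhds y] fun z => coords W (g z) :=
    h.fun_comp (coords W)
  rw [dirDeriv, dirDeriv, h'.fderiv_eq]

theorem dz_congr {f g : Cn n → W} {y : Cn n} (h : f =ᶠ[nhds y] g) (i : Fin n) :
    dz f y i = dz g y i := by
  simp only [dz, dirDeriv_congr h]

theorem dzbar_congr {f g : Cn n → W} {y : Cn n} (h : f =ᶠ[nhds y] g) (i : Fin n) :
    dzbar f y i = dzbar g y i := by
  simp only [dzbar, dirDeriv_congr h]

variable {A : GradedArtin.{u}} {X : Type*} [TopologicalSpace X] [ChartedSpace (Cn n) X]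

theorem read_chartAt_self {T : X → X → Cn n × Cn n →ₗ[ℂ] Cn n × Cn n} (s : X → Fib n A) (x : X)
    (hT : T x x = LinearMap.id) : read T x s (chartAt (Cn n) x x) = s x := by
  rw [read, (chartAt (Cn n) x).left_inv (mem_chart_source (Cn n) x), hT, ExteriorAlgebra.map_id]
  exact LinearMap.rTensor_id_apply _ _ _

variable [IsManifold 𝓘(ℂ, Cn n) ω X]

theorem jac_self (x : X) : (jac x x x : Matrix (Fin n) (Fin n) ℂ) = 1 := by
  rw [jac, ← LinearMap.toMatrix'_id]
  congr 1
  exact LinearMap.ext fun v => tangentCoordChange_self (mem_extChartAt_source x)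

theorem formChange_self (x : X) : formChange (n := n) x x = LinearMap.id := by
  simp only [formChange, jac_self, Matrix.transpose_one, Matrix.conjTranspose_one,
    Matrix.toLin'_one, LinearMap.prodMap_id]

theorem polyChange_self (x : X) : polyChange (n := n) x x = LinearMap.id := by
  simp only [polyChange, jac_self, Matrix.conjTranspose_one, Matrix.toLin'_one,
    LinearMap.prodMap_id]

variable {γ s : X → Fib n A}

theorem read_contr_eventuallyEq (γ s : X → Fib n A) (x : X) :
    read formChange x (fun z => fibContr (γ z) (s z)) =ᶠ[nhds (chartAt (Cn n) x x)]
      fun y => fibContr (read polyChange x γ y) (read formChange x s y) :=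
  Filter.eventuallyEq_of_mem ((chartAt (Cn n) x).open_target.mem_nhds
    (mem_chart_target (Cn n) x)) fun _ hy => read_contr γ s hy

theorem dz_read_contr (hγ : IsSmooth polyChange γ) (hs : IsSmooth formChange s) (x : X)
    (i : Fin n) :
    dz (read formChange x fun z => fibContr (γ z) (s z)) (chartAt (Cn n) x x) i =
      fibContr (dz (read polyChange x γ) (chartAt (Cn n) x x) i) (s x) +
        fibContr (γ x) (dz (read formChange x s) (chartAt (Cn n) x x) i) := by
  rw [dz_congr (read_contr_eventuallyEq γ s x), dz_bilin fibContr (hγ.diffAt x) (hs.diffAt x),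
    read_chartAt_self _ _ (formChange_self x), read_chartAt_self _ _ (polyChange_self x)]

theorem dzbar_read_contr (hγ : IsSmooth polyChange γ) (hs : IsSmooth formChange s) (x : X)
    (i : Fin n) :
    dzbar (read formChange x fun z => fibContr (γ z) (s z)) (chartAt (Cn n) x x) i =
      fibContr (dzbar (read polyChange x γ) (chartAt (Cn n) x x) i) (s x) +
        fibContr (γ x) (dzbar (read formChange x s) (chartAt (Cn n) x x) i) := by
  rw [dzbar_congr (read_contr_eventuallyEq γ s x),
    dzbar_bilin fibContr (hγ.diffAt x) (hs.diffAt x),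
    read_chartAt_self _ _ (formChange_self x), read_chartAt_self _ _ (polyChange_self x)]

theorem schouten_self (heven : ∀ z, IsEvenFib (γ z)) (x : X) :
    schouten γ γ x = (2 : ℂ) • halfSchouten γ γ x := by
  have fibEven_γ : (fun y => fibEven (γ y)) = γ := funext fun y => fibEven_of_isEvenFib (heven y)
  have fibOdd_γ : (fun y => fibOdd (γ y)) = 0 := funext fun y => fibOdd_of_isEvenFib (heven y)
  have halfSchouten_zero (β : X → Fib n A) : halfSchouten β 0 x = 0 := by
    have read_zero : read polyChange x (0 : X → Fib n A) = fun _ => 0 := by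
      funext y
      simp only [read, Pi.zero_apply, map_zero]
    simp [halfSchouten, read_zero, dz, dirDeriv]
  rw [schouten, fibEven_γ, fibOdd_γ, halfSchouten_zero, add_zero, two_smul]

end Leibniz

section SmoothForms

variable {X : Type*} [TopologicalSpace X] [ChartedSpace (Cn n) X] [IsManifold 𝓘(ℂ, Cn n) ω X]
  {A : GradedArtin.{u}}

variable (n X A) in
/-- The smooth differential forms on `X` with coefficients in `A`. -/
def smoothForms : Submodule ℂ (X → Fib n A) where
  carrier := {s | IsSmooth formChange s}
  add_mem' hs ht := hs.add ht
  zero_mem' := IsSmooth.zero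
  smul_mem' c _ hs := hs.smul c

/-- The value at `x` of a smooth form. -/
def evalAt (x : X) : smoothForms n X A →ₗ[ℂ] Fib n A :=
  LinearMap.proj x ∘ₗ (smoothForms n X A).subtype

/-- The value of `∂̄s` at `x`, as a linear function of the smooth form `s`. -/
def delbarAt (x : X) : smoothForms n X A →ₗ[ℂ] Fib n A where
  toFun s := delbar s.1 x
  map_add' s t := by rw [Submodule.coe_add, delbar_add s.2 t.2, Pi.add_apply]
  map_smul' c s := by rw [Submodule.coe_smul, delbar_smul c s.2, Pi.smul_apply, RingHom.id_apply]

/-- The value of `∂s` at `x`, as a linear function of the smooth form `s`. -/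
def delAt (x : X) : smoothForms n X A →ₗ[ℂ] Fib n A where
  toFun s := del s.1 x
  map_add' s t := by rw [Submodule.coe_add, del_add s.2 t.2, Pi.add_apply]
  map_smul' c s := by rw [Submodule.coe_smul, del_smul c s.2, Pi.smul_apply, RingHom.id_apply]

theorem delbarAt_apply (x : X) (s : smoothForms n X A) : delbarAt x s = delbar s.1 x := rfl

theorem delAt_apply (x : X) (s : smoothForms n X A) : delAt x s = del s.1 x := rfl

variable {γ : X → Fib n A}

/-- The contraction `i_γ` with a smooth polyvector field, as an endomorphism of smooth forms. -/
def smoothContr (hγ : IsSmooth polyChange γ) : Module.End ℂ (smoothForms n X A) where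
  toFun s := ⟨fun z => fibContr (γ z) (s.1 z), hγ.contr s.2⟩
  map_add' s t := Subtype.ext (funext fun z => map_add (fibContr (γ z)) (s.1 z) (t.1 z))
  map_smul' c s := Subtype.ext (funext fun z => map_smul (fibContr (γ z)) c (s.1 z))

theorem homCommutator_evalAt (hγ : IsSmooth polyChange γ) (x : X) :
    homCommutator (smoothContr hγ) (fibContr (γ x)) (evalAt x) = 0 :=
  LinearMap.ext fun _ => sub_self _

theorem smoothContr_pow_eq_zero (hγ : IsSmooth polyChange γ) {N : ℕ}
    (hN : ∀ x, fibContr (γ x) ^ N = 0) : smoothContr hγ ^ N = 0 := by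
  have pow_apply (k : ℕ) (s : smoothForms n X A) (x : X) :
      ((smoothContr hγ ^ k) s).1 x = (fibContr (γ x) ^ k) (s.1 x) := by
    induction k with
    | zero => rfl
    | succ k ih => rw [pow_succ', pow_succ', Module.End.mul_apply, Module.End.mul_apply, ← ih]; rfl
  ext s x
  rw [pow_apply, hN]
  rfl

theorem homCommutator_fibContr_comp_evalAt (hγ : IsSmooth polyChange γ) {x : X}
    (heven : IsEvenFib (γ x)) (β : Fib n A) :
    homCommutator (smoothContr hγ) (fibContr (γ x)) (fibContr β ∘ₗ evalAt x) = 0 :=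
  LinearMap.ext fun s => sub_eq_zero.mpr (fibContr_comm_of_isEvenFib heven β (s.1 x)).symm

theorem homCommutator_delbarAt (hγ : IsSmooth polyChange γ) {x : X} (heven : IsEvenFib (γ x)) :
    homCommutator (smoothContr hγ) (fibContr (γ x)) (delbarAt x) =
      fibContr (polyDelbar γ x) ∘ₗ evalAt x := by
  ext s
  change delbar (fun z => fibContr (γ z) (s.1 z)) x - fibContr (γ x) (delbar s.1 x) =
    fibContr (polyDelbar γ x) (s.1 x)
  simp only [delbar, polyDelbar, dzbar_read_contr hγ s.2, map_add, map_sum, LinearMap.sum_apply,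
    Finset.sum_add_distrib, fibContr_lmul_gen₂, lmul_gen₂_fibContr heven]
  abel

theorem homCommutator_delAt_apply (hγ : IsSmooth polyChange γ) {x : X} (heven : IsEvenFib (γ x))
    (s : smoothForms n X A) :
    homCommutator (smoothContr hγ) (fibContr (γ x)) (delAt x) s = ∑ i,
      (lmul (gen₁ (Pi.single i 1))
          (fibContr (dz (read polyChange x γ) (chartAt (Cn n) x x) i) (s.1 x)) +
        fibContr ((leftDer i).rTensor A.carrier (γ x))
          (dz (read formChange x s.1) (chartAt (Cn n) x x) i)) := by
  change del (fun z => fibContr (γ z) (s.1 z)) x - fibContr (γ x) (del s.1 x) = _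
  simp only [del, dz_read_contr hγ s.2, map_add, map_sum, lmul_gen₁_fibContr heven,
    ← Finset.sum_sub_distrib]
  refine Finset.sum_congr rfl fun i _ => ?_
  abel

theorem homCommutator_homCommutator_delAt (hγ : IsSmooth polyChange γ)
    (heven : ∀ z, IsEvenFib (γ z)) (x : X) :
    homCommutator (smoothContr hγ) (fibContr (γ x))
        (homCommutator (smoothContr hγ) (fibContr (γ x)) (delAt x)) =
      fibContr (schouten γ γ x) ∘ₗ evalAt x := by
  ext s
  change _ = fibContr (schouten γ γ x) (s.1 x)
  rw [homCommutator_apply, homCommutator_delAt_apply hγ (heven x),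
    homCommutator_delAt_apply hγ (heven x), sub_eq_iff_eq_add', schouten_self heven,
    map_smul, LinearMap.smul_apply, halfSchouten, map_sum, map_sum, LinearMap.sum_apply,
    Finset.smul_sum, ← Finset.sum_add_distrib]
  refine Finset.sum_congr rfl fun i _ => ?_
  change lmul _ (fibContr _ (fibContr (γ x) (s.1 x))) +
    fibContr _ (dz (read formChange x fun z => fibContr (γ z) (s.1 z)) _ i) = _
  rw [dz_read_contr hγ s.2, map_add, map_add, fibContr_fibMul,
    ← fibContr_comm_of_isEvenFib (heven x) _ (s.1 x), lmul_gen₁_fibContr (heven x),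
    ← fibContr_comm_of_isEvenFib (heven x) _ (dz _ _ i), two_smul]
  abel

end SmoothForms

/-! ### Conjugation by `exp(ħ⁻¹ i_γ)` -/

section SmoothExp

variable {X : Type*} [TopologicalSpace X] [ChartedSpace (Cn n) X] [IsManifold 𝓘(ℂ, Cn n) ω X]
  {A : GradedArtin.{u}} {γ : X → Fib n A}

/-- The value at `x` of the differential `∂̄ + ħ∂` of a series of smooth forms. -/
def totalDiffAt (x : X) : (ℤ → smoothForms n X A) →ₗ[ℂ] (ℤ → Fib n A) :=
  divHbarPow 0 (delbarAt x) + divHbarPow (-1) (delAt x)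

/-- The value at `x` of the twisted differential `∂̄ + [∂, i_γ] + ħ∂` of a series of smooth
forms. -/
def twistedDiffAt (hγ : IsSmooth polyChange γ) (x : X) :
    (ℤ → smoothForms n X A) →ₗ[ℂ] (ℤ → Fib n A) :=
  divHbarPow 0 (delbarAt x + homCommutator (smoothContr hγ) (fibContr (γ x)) (delAt x)) +
    divHbarPow (-1) (delAt x)

theorem homCommutator_totalDiffAt (hγ : IsSmooth polyChange γ) {x : X} (heven : IsEvenFib (γ x)) :
    homCommutator (overHbar (smoothContr hγ)) (overHbar (fibContr (γ x))) (totalDiffAt x) =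
      divHbarPow 1 (fibContr (polyDelbar γ x) ∘ₗ evalAt x) +
        divHbarPow 0 (homCommutator (smoothContr hγ) (fibContr (γ x)) (delAt x)) := by
  rw [totalDiffAt, map_add, homCommutator_divHbarPow, homCommutator_divHbarPow,
    homCommutator_delbarAt hγ heven, zero_add, neg_add_cancel]

theorem homCommutator_homCommutator_totalDiffAt (hγ : IsSmooth polyChange γ)
    (heven : ∀ z, IsEvenFib (γ z)) (x : X) :
    homCommutator (overHbar (smoothContr hγ)) (overHbar (fibContr (γ x)))
        (homCommutator (overHbar (smoothContr hγ)) (overHbar (fibContr (γ x))) (totalDiffAt x)) =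
      divHbarPow 1 (fibContr (schouten γ γ x) ∘ₗ evalAt x) := by
  rw [homCommutator_totalDiffAt hγ (heven x), map_add, homCommutator_divHbarPow,
    homCommutator_divHbarPow, homCommutator_fibContr_comp_evalAt hγ (heven x), divHbarPow_zero,
    homCommutator_homCommutator_delAt hγ heven, zero_add, zero_add]

/-- The Maurer–Cartan equation is what removes the `ħ⁻¹`-terms `i_{∂̄γ} + ½ i_{[γ,γ]}` of the
conjugated differential. -/
theorem totalDiffAt_comp_exp (hγ : IsSmooth polyChange γ) (heven : ∀ z, IsEvenFib (γ z)) {N : ℕ}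
    (hN : ∀ x, fibContr (γ x) ^ N = 0) {x : X}
    (hMC : polyDelbar γ x + (2⁻¹ : ℂ) • schouten γ γ x = 0) :
    totalDiffAt x ∘ₗ IsNilpotent.exp (overHbar (smoothContr hγ)) =
      IsNilpotent.exp (overHbar (fibContr (γ x))) ∘ₗ twistedDiffAt hγ x := by
  have curvature : fibContr (polyDelbar γ x) + (2⁻¹ : ℚ) • fibContr (schouten γ γ x) = 0 := by
    rw [← Rat.cast_smul_eq_qsmul ℂ, Rat.cast_inv, Rat.cast_ofNat, ← map_smul, ← map_add, hMC,
      map_zero]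
  have total : totalDiffAt x +
      homCommutator (overHbar (smoothContr hγ)) (overHbar (fibContr (γ x))) (totalDiffAt x) +
        (2⁻¹ : ℚ) • homCommutator (overHbar (smoothContr hγ)) (overHbar (fibContr (γ x)))
          (homCommutator (overHbar (smoothContr hγ)) (overHbar (fibContr (γ x)))
            (totalDiffAt x)) = twistedDiffAt hγ x := by
    rw [homCommutator_homCommutator_totalDiffAt hγ heven, homCommutator_totalDiffAt hγ (heven x)]
    ext Φ m
    have vanish := LinearMap.congr_fun curvature (evalAt x (Φ (m + 1)))
    simp only [LinearMap.add_apply, LinearMap.smul_apply, LinearMap.zero_apply] at vanish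
    simp only [totalDiffAt, twistedDiffAt, LinearMap.add_apply, LinearMap.smul_apply,
      Pi.add_apply, Pi.smul_apply, divHbarPow_apply, LinearMap.comp_apply]
    refine Eq.trans ?_ ((congrArg (_ + ·) vanish).trans (add_zero _))
    abel
  rw [← total]
  refine comp_exp_of_commutator_cube_eq_zero
    (isNilpotent_overHbar ⟨N, smoothContr_pow_eq_zero hγ hN⟩) (isNilpotent_overHbar ⟨N, hN x⟩) ?_
  rw [homCommutator_homCommutator_totalDiffAt hγ heven, homCommutator_divHbarPow,
    homCommutator_fibContr_comp_evalAt hγ (heven x), divHbarPow_zero]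

end SmoothExp

section DerExp

variable {R : ProArtin.{u}} (v : R.Der) (i : ℕ) {γ : Fib n (R.level (v.shift i))}

theorem ProArtin.Der.homCommutator_fib (heven : IsEvenFib γ) :
    homCommutator (fibContr γ)
        (fibContr ((R.map (v.le_shift i)).toLinearMap.lTensor (Lam n) γ)) (v.fib i n) =
      fibContr (v.fib i n γ) ∘ₗ (R.map (v.le_shift i)).toLinearMap.lTensor (Lam n) :=
  LinearMap.ext fun w => sub_eq_of_eq_add (v.fib_fibContr i heven w)

theorem homCommutator_fibContr_comp_lTensor {i j : ℕ} (h : i ≤ j) (β : Fib n (R.level i))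
    {γ : Fib n (R.level j)} (heven : IsEvenFib ((R.map h).toLinearMap.lTensor (Lam n) γ)) :
    homCommutator (fibContr γ) (fibContr ((R.map h).toLinearMap.lTensor (Lam n) γ))
      (fibContr β ∘ₗ (R.map h).toLinearMap.lTensor (Lam n)) = 0 := by
  refine LinearMap.ext fun w => ?_
  rw [homCommutator_apply, LinearMap.comp_apply, LinearMap.comp_apply, lTensor_fibContr,
    fibContr_comm_of_isEvenFib heven, sub_self, LinearMap.zero_apply]

theorem ProArtin.Der.fib_exp (heven : IsEvenFib γ)
    (heven' : IsEvenFib ((R.map (v.le_shift i)).toLinearMap.lTensor (Lam n) γ))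
    (hγ : IsNilpotent (fibContr γ))
    (hγ' : IsNilpotent (fibContr ((R.map (v.le_shift i)).toLinearMap.lTensor (Lam n) γ)))
    (Φ : ℤ → Fib n (R.level (v.shift i))) (m : ℤ) :
    v.fib i n (IsNilpotent.exp (overHbar (fibContr γ)) Φ m) =
      IsNilpotent.exp
        (overHbar (fibContr ((R.map (v.le_shift i)).toLinearMap.lTensor (Lam n) γ)))
        (fun k => v.fib i n (Φ k) + fibContr (v.fib i n γ)
          ((R.map (v.le_shift i)).toLinearMap.lTensor (Lam n) (Φ (k + 1)))) m := by
  have key := comp_exp_of_commutator_sq_eq_zero (isNilpotent_overHbar hγ)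
    (isNilpotent_overHbar hγ') (f := divHbarPow 0 (v.fib i n)) (by
      rw [homCommutator_divHbarPow, homCommutator_divHbarPow, v.homCommutator_fib i heven,
        homCommutator_fibContr_comp_lTensor _ _ heven', divHbarPow_zero])
  rw [homCommutator_divHbarPow, v.homCommutator_fib i heven] at key
  have coefficients : (divHbarPow 0 (v.fib i n) + divHbarPow (0 + 1) (fibContr (v.fib i n γ) ∘ₗ
      (R.map (v.le_shift i)).toLinearMap.lTensor (Lam n))) Φ = fun k => v.fib i n (Φ k) +
        fibContr (v.fib i n γ)
          ((R.map (v.le_shift i)).toLinearMap.lTensor (Lam n) (Φ (k + 1))) :=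
    funext fun k => by
      simp only [LinearMap.add_apply, Pi.add_apply, divHbarPow_apply, LinearMap.comp_apply,
        add_zero, zero_add]
  simpa only [LinearMap.comp_apply, divHbarPow_apply, add_zero, coefficients] using
    congrFun (LinearMap.congr_fun key Φ) m

end DerExp

section Fam

variable {X : Type*} {R : ProArtin.{u}}

theorem IsCompat.contrFam {γ s : Fam n X R} (hγ : IsCompat γ) (hs : IsCompat s) :
    IsCompat (contrFam γ s) := fun i j h x => by
  rw [SemiInfinite.contrFam, lTensor_fibContr, hγ i j h x, hs i j h x, SemiInfinite.contrFam]

theorem IsCompat.derFam (v : R.Der) {s : Fam n X R} (hs : IsCompat s) :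
    IsCompat (derFam v s) := by
  intro i j h x
  have hi : v.shift i ≤ max (v.shift i) (v.shift j) := le_max_left _ _
  have hj : v.shift j ≤ max (v.shift i) (v.shift j) := le_max_right _ _
  simp only [SemiInfinite.derFam, ← hs _ _ hi x, ← hs _ _ hj x]
  generalize s (max (v.shift i) (v.shift j)) x = w
  induction w using TensorProduct.induction_on with
  | zero => simp
  | tmul a r => simp [v.even_compat h hi hj, v.odd_compat h hi hj]
  | add w w' hw hw' =>
    simp only [map_add] at hw hw' ⊢
    rw [add_add_add_comm, hw, hw', add_add_add_comm]

theorem derFam_apply (v : R.Der) (s : Fam n X R) (i : ℕ) (x : X) :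
    derFam v s i x = v.fib i n (s (v.shift i) x) := rfl

/-- The operator `exp(ħ⁻¹ i_γ)` on series, defined for every family `γ`; it has its meaning only
where the contractions `i_γ` are nilpotent. -/
def expFam (γ : Fam n X R) : Series n X R →ₗ[ℂ] Series n X R where
  toFun Φ m i x := IsNilpotent.exp (overHbar (fibContr (γ i x))) (fun k => Φ k i x) m
  map_add' Φ Ψ := funext fun m => funext fun i => funext fun x =>
    congrFun (map_add (IsNilpotent.exp (overHbar (fibContr (γ i x)))) (fun k => Φ k i x)
      fun k => Ψ k i x) m
  map_smul' c Φ := funext fun m => funext fun i => funext fun x =>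
    congrFun (map_smul (IsNilpotent.exp (overHbar (fibContr (γ i x)))) c fun k => Φ k i x) m

theorem expFam_apply (γ : Fam n X R) (Φ : Series n X R) (m : ℤ) (i : ℕ) (x : X) :
    expFam γ Φ m i x =
      IsNilpotent.exp (overHbar (fibContr (γ i x))) (fun k => Φ k i x) m := rfl

end Fam

section Series

variable {X : Type*} [TopologicalSpace X] [ChartedSpace (Cn n) X] [IsManifold 𝓘(ℂ, Cn n) ω X]
  {R : ProArtin.{u}}

theorem contrFam_mem {γ s : Fam n X R} (hγ : ∀ i, IsSmooth polyChange (γ i)) (hγ' : IsCompat γ)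
    (hs : s ∈ forms n X R) : contrFam γ s ∈ forms n X R :=
  ⟨fun i => (hγ i).contr (hs.1 i), hγ'.contrFam hs.2⟩

theorem nablaSeries_mem (γ : MC n X R) (v : R.Der) {Φ : Series n X R}
    (hΦ : Φ ∈ intSeries n X R) : nablaSeries γ v Φ ∈ intSeries n X R := fun m =>
  add_mem (derFam_mem v (hΦ m)) <| contrFam_mem
    (fun i => ((γ.isPolyField.1 (v.shift i)).map _ _ map_comp_id).add
      ((γ.isPolyField.1 (v.shift i)).map _ _ map_comp_inv))
    (γ.isPolyField.2.1.derFam v) (hΦ (m + 1))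

variable {d : ℤ} {γ : Fam n X R}

theorem IsPolyField.exists_pow_eq_zero (hγ : IsPolyField n X R d γ) (i : ℕ) :
    ∃ N : ℕ, ∀ x, fibContr (γ i x) ^ N = 0 :=
  let ⟨N, hN⟩ := exists_fibContr_pow_eq_zero (R.level i)
  ⟨N, fun x => hN n d _ (hγ.2.2 i x)⟩

theorem IsPolyField.isNilpotent (hγ : IsPolyField n X R d γ) (i : ℕ) (x : X) :
    IsNilpotent (fibContr (γ i x)) :=
  (hγ.exists_pow_eq_zero i).imp fun _ hN => hN x

theorem IsPolyField.neg (hγ : IsPolyField n X R d γ) : IsPolyField n X R d (-γ) := by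
  refine ⟨fun i => ?_, fun i j h x => ?_, fun i x => neg_mem (hγ.2.2 i x)⟩
  · have smooth := (hγ.1 i).smul (-1)
    rwa [neg_one_smul] at smooth
  · simp only [Pi.neg_apply, map_neg, hγ.2.1 i j h x]

theorem expContr_eq_expFam (γ : MC n X R) (Φ : Series n X R) :
    expContr γ Φ = expFam γ.val Φ := by
  funext m i x
  obtain ⟨N, hN⟩ := γ.isPolyField.exists_pow_eq_zero i
  rw [expContr, expFam_apply, exp_overHbar_apply (hN x)]
  refine (finsum_eq_sum_of_support_subset _ fun k hk => ?_).trans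
    (Finset.sum_congr rfl fun k _ => ?_)
  · rw [Finset.coe_range, Set.mem_Iio]
    by_contra! hNk
    refine hk ?_
    dsimp only
    rw [pow_eq_zero_of_le hNk (hN x), LinearMap.zero_apply, smul_zero]
  · rw [← Rat.cast_smul_eq_qsmul ℂ, Rat.cast_inv, Rat.cast_natCast]

theorem IsPolyField.expFam_neg_expFam (hγ : IsPolyField n X R d γ) (Φ : Series n X R) :
    expFam (-γ) (expFam γ Φ) = Φ := by
  funext m i x
  have cancel := IsNilpotent.exp_neg_mul_exp_self (isNilpotent_overHbar (hγ.isNilpotent i x))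
  rw [← overHbar_neg, ← map_neg] at cancel
  exact congrFun (LinearMap.congr_fun cancel fun k => Φ k i x) m

theorem IsPolyField.expFam_expFam_neg (hγ : IsPolyField n X R d γ) (Φ : Series n X R) :
    expFam γ (expFam (-γ) Φ) = Φ := by
  simpa only [neg_neg] using hγ.neg.expFam_neg_expFam Φ

/-- The level-`i` part of a series in integral powers of `ħ`, as a series of smooth forms. -/
def smoothLevel {Φ : Series n X R} (hΦ : Φ ∈ intSeries n X R) (i : ℕ) :
    ℤ → smoothForms n X (R.level i) :=
  fun m => ⟨Φ m i, (hΦ m).1 i⟩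

theorem IsPolyField.expFam_eq_exp_smoothContr (hγ : IsPolyField n X R d γ) {Φ : Series n X R}
    (hΦ : Φ ∈ intSeries n X R) (m : ℤ) (i : ℕ) :
    expFam γ Φ m i =
      (IsNilpotent.exp (overHbar (smoothContr (hγ.1 i))) (smoothLevel hΦ i) m).1 := by
  obtain ⟨N, hN⟩ := hγ.exists_pow_eq_zero i
  exact funext fun x => (map_exp_overHbar_of_intertwines
    ⟨N, smoothContr_pow_eq_zero (hγ.1 i) hN⟩ (hγ.isNilpotent i x)
    (homCommutator_evalAt (hγ.1 i) x) (smoothLevel hΦ i) m).symm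

theorem IsPolyField.expFam_mem (hγ : IsPolyField n X R d γ) {Φ : Series n X R}
    (hΦ : Φ ∈ intSeries n X R) : expFam γ Φ ∈ intSeries n X R := by
  refine fun m => ⟨fun i => ?_, fun i j h x => ?_⟩
  · rw [hγ.expFam_eq_exp_smoothContr hΦ]
    exact Subtype.property _
  · have intertwines : homCommutator (fibContr (γ j x)) (fibContr (γ i x))
        ((R.map h).toLinearMap.lTensor (Lam n)) = 0 :=
      LinearMap.ext fun w => by
        rw [homCommutator_apply, lTensor_fibContr, hγ.2.1 i j h x, sub_self, LinearMap.zero_apply]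
    have compatible : (fun k => (R.map h).toLinearMap.lTensor (Lam n) (Φ k j x)) =
      fun k => Φ k i x := funext fun k => (hΦ k).2 i j h x
    rw [expFam_apply, expFam_apply, map_exp_overHbar_of_intertwines (hγ.isNilpotent j x)
      (hγ.isNilpotent i x) intertwines, compatible]

/-- The differential `∂̄ + ħ∂` on series in integral powers of `ħ`. -/
def dInt (Φ : Series n X R) : Series n X R := fun m i x =>
  delbar (Φ m i) x + del (Φ (m - 1) i) x

theorem MC.isEvenFib (γ : MC n X R) (i : ℕ) (x : X) : IsEvenFib (γ.val i x) :=
  isEvenFib_of_mem_polyDeg (γ.isPolyField.2.2 i x)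

theorem dInt_expFam (γ : MC n X R) {Φ : Series n X R} (hΦ : Φ ∈ intSeries n X R) :
    dInt (expFam γ.val Φ) = expFam γ.val (dTwist γ.val Φ) := by
  funext m i x
  obtain ⟨N, hN⟩ := γ.isPolyField.exists_pow_eq_zero i
  have conjugate := totalDiffAt_comp_exp (γ.isPolyField.1 i) (γ.isEvenFib i) hN
    (γ.maurerCartan i x)
  have twisted : twistedDiffAt (γ.isPolyField.1 i) x (smoothLevel hΦ i) =
      fun k => dTwist γ.val Φ k i x := by
    funext k
    simp only [twistedDiffAt, LinearMap.add_apply, Pi.add_apply, divHbarPow_apply, add_zero]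
    rfl
  have value := congrFun (LinearMap.congr_fun conjugate (smoothLevel hΦ i)) m
  simp only [LinearMap.comp_apply, twisted] at value
  rw [expFam_apply, ← value, dInt, γ.isPolyField.expFam_eq_exp_smoothContr hΦ,
    γ.isPolyField.expFam_eq_exp_smoothContr hΦ]
  simp only [totalDiffAt, LinearMap.add_apply, Pi.add_apply, divHbarPow_apply, add_zero]
  rfl

theorem derSeries_expFam (γ : MC n X R) (v : R.Der) {Φ : Series n X R}
    (hΦ : Φ ∈ intSeries n X R) :
    derSeries v (expFam γ.val Φ) = expFam γ.val (nablaSeries γ v Φ) := by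
  funext m i x
  have compat : (R.map (v.le_shift i)).toLinearMap.lTensor (Lam n) (γ.val (v.shift i) x) =
    γ.val i x := γ.isPolyField.2.1 i (v.shift i) (v.le_shift i) x
  have nabla : (fun k => v.fib i n (Φ k (v.shift i) x) + fibContr (v.fib i n (γ.val (v.shift i) x))
      ((R.map (v.le_shift i)).toLinearMap.lTensor (Lam n) (Φ (k + 1) (v.shift i) x))) =
        fun k => nablaSeries γ v Φ k i x :=
    funext fun k => by rw [(hΦ (k + 1)).2 i _ (v.le_shift i) x]; rfl
  have fib_exp := v.fib_exp i (γ.isEvenFib (v.shift i) x) (compat ▸ γ.isEvenFib i x)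
    (γ.isPolyField.isNilpotent (v.shift i) x) (compat ▸ γ.isPolyField.isNilpotent i x)
    (fun k => Φ k (v.shift i) x) m
  rwa [nabla, compat] at fib_exp

end Series

/-! ### The rescaling `l_ħ` -/

section Bidegree

variable {A B : GradedArtin.{u}}

/-- The component of bidegree `(p,q)` of a form with coefficients. -/
def fibComp (p q : ℕ) : Fib n A →ₗ[ℂ] Fib n A := (comp p q).rTensor A.carrier

theorem fibComp_eq_zero_of_lt_left {p : ℕ} (hp : n < p) (q : ℕ) (w : Fib n A) :
    fibComp p q w = 0 := by
  have comp_eq_zero : comp (n := n) p q = 0 := LinearMap.ext (comp_eq_zero_of_lt_left hp q)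
  rw [fibComp, comp_eq_zero, LinearMap.rTensor_zero, LinearMap.zero_apply]

theorem fibComp_eq_zero_of_lt_right (p : ℕ) {q : ℕ} (hq : n < q) (w : Fib n A) :
    fibComp p q w = 0 := by
  have comp_eq_zero : comp (n := n) p q = 0 := LinearMap.ext (comp_eq_zero_of_lt_right p hq)
  rw [fibComp, comp_eq_zero, LinearMap.rTensor_zero, LinearMap.zero_apply]

theorem fibComp_fibComp (p q p' q' : ℕ) (w : Fib n A) :
    fibComp p q (fibComp p' q' w) = if p = p' ∧ q = q' then fibComp p q w else 0 := by
  have comp_comp_comp : comp (n := n) p q ∘ₗ comp p' q' =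
      if p = p' ∧ q = q' then comp p q else 0 := LinearMap.ext fun a => by
    rw [LinearMap.comp_apply, comp_comp]
    split_ifs <;> rfl
  rw [fibComp, fibComp, ← LinearMap.rTensor_comp_apply, comp_comp_comp]
  split_ifs
  · rfl
  · rw [LinearMap.rTensor_zero, LinearMap.zero_apply]

theorem sum_fibComp (w : Fib n A) :
    ∑ p ∈ Finset.range (n + 1), ∑ q ∈ Finset.range (n + 1), fibComp p q w = w := by
  induction w using TensorProduct.induction_on with
  | zero => simp only [map_zero, Finset.sum_const_zero]
  | tmul a r => simp only [fibComp, LinearMap.rTensor_tmul, ← TensorProduct.sum_tmul, sum_comp]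
  | add w w' h h' => simp only [map_add, Finset.sum_add_distrib, h, h']

theorem fibComp_map (L : Lam n →ₗ[ℂ] Lam n) (f : A.carrier →ₗ[ℂ] B.carrier) {p q : ℕ}
    (hL : ∀ a, comp p q (L a) = L (comp p q a)) (w : Fib n A) :
    fibComp p q (TensorProduct.map L f w) = TensorProduct.map L f (fibComp p q w) := by
  have commute : comp p q ∘ₗ L = L ∘ₗ comp p q := LinearMap.ext hL
  rw [fibComp, fibComp, ← LinearMap.comp_apply, ← LinearMap.comp_apply,
    LinearMap.rTensor_comp_map, LinearMap.map_comp_rTensor, commute]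

theorem inv_fibComp (p q : ℕ) (w : Fib n A) :
    inv.rTensor A.carrier (fibComp p q w) = ((q : ℤ) - p).negOnePow • fibComp p q w := by
  have sign : ((q : ℤ) - p).negOnePow = ((-1) ^ (p + q) : ℤˣ) := by
    rw [Int.negOnePow_sub, ← Int.negOnePow_add, add_comm, ← Nat.cast_add, Int.negOnePow_def,
      zpow_natCast]
  induction w using TensorProduct.induction_on with
  | zero => simp only [map_zero, smul_zero]
  | tmul a r =>
    rw [sign, fibComp, LinearMap.rTensor_tmul, LinearMap.rTensor_tmul, inv_comp,
      ← TensorProduct.smul_tmul']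
    rcases Nat.even_or_odd (p + q) with h | h
    · rw [h.neg_one_pow, h.neg_one_pow, one_smul, one_smul]
    · rw [h.neg_one_pow, h.neg_one_pow, neg_one_smul, Units.neg_smul, one_smul]
  | add w w' h h' => simp only [map_add, smul_add, h, h']

theorem lmul_gen₁_fibComp (v : Cn n) (p q : ℕ) (w : Fib n A) :
    lmul (gen₁ v) (fibComp p q w) = fibComp (p + 1) q (lmul (gen₁ v) w) := by
  rw [lmul, fibComp, fibComp, ← LinearMap.rTensor_comp_apply, ← LinearMap.rTensor_comp_apply]
  congr 2
  exact LinearMap.ext fun a => (comp_gen₁_mul p q v a).symm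

theorem lmul_gen₂_fibComp (v : Cn n) (p q : ℕ) (w : Fib n A) :
    lmul (gen₂ v) (fibComp p q w) = fibComp p (q + 1) (lmul (gen₂ v) w) := by
  rw [lmul, fibComp, fibComp, ← LinearMap.rTensor_comp_apply, ← LinearMap.rTensor_comp_apply]
  congr 2
  exact LinearMap.ext fun a => (comp_gen₂_mul p q v a).symm

theorem fibComp_zero_lmul_gen₁ (v : Cn n) (q : ℕ) (w : Fib n A) :
    fibComp 0 q (lmul (gen₁ v) w) = 0 := by
  have vanish : comp 0 q ∘ₗ LinearMap.mul ℂ (Lam n) (gen₁ v) = 0 :=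
    LinearMap.ext (comp_zero_gen₁_mul q v)
  rw [fibComp, lmul, ← LinearMap.rTensor_comp_apply, vanish, LinearMap.rTensor_zero,
    LinearMap.zero_apply]

theorem fibComp_zero_lmul_gen₂ (v : Cn n) (p : ℕ) (w : Fib n A) :
    fibComp p 0 (lmul (gen₂ v) w) = 0 := by
  have vanish : comp p 0 ∘ₗ LinearMap.mul ℂ (Lam n) (gen₂ v) = 0 :=
    LinearMap.ext (comp_zero_gen₂_mul p v)
  rw [fibComp, lmul, ← LinearMap.rTensor_comp_apply, vanish, LinearMap.rTensor_zero,
    LinearMap.zero_apply]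

/-- For a family `t` of forms indexed by weights, the sum of the bidegree `(p,q)` components of
`t (q - p)`. The coefficients of `l_ħ` and of its inverse have this shape. -/
def weightSum : (ℤ → Fib n A) →ₗ[ℂ] Fib n A :=
  ∑ p ∈ Finset.range (n + 1), ∑ q ∈ Finset.range (n + 1),
    fibComp p q ∘ₗ LinearMap.proj ((q : ℤ) - p)

theorem weightSum_apply (t : ℤ → Fib n A) :
    weightSum t = ∑ p ∈ Finset.range (n + 1), ∑ q ∈ Finset.range (n + 1),
      fibComp p q (t ((q : ℤ) - p)) := by
  simp only [weightSum, LinearMap.sum_apply, LinearMap.comp_apply, LinearMap.proj_apply]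

theorem weightSum_const (w : Fib n A) : weightSum (fun _ => w) = w := by
  rw [weightSum_apply, sum_fibComp]

theorem map_weightSum {L : Fib n A →ₗ[ℂ] Fib n B}
    (hL : ∀ p q w, fibComp p q (L w) = L (fibComp p q w)) (t : ℤ → Fib n A) :
    L (weightSum t) = weightSum fun w => L (t w) := by
  simp only [weightSum_apply, map_sum, hL]

theorem inv_weightSum (t : ℤ → Fib n A) :
    inv.rTensor A.carrier (weightSum t) = weightSum fun w => w.negOnePow • t w := by
  simp only [weightSum_apply, map_sum, inv_fibComp, Units.smul_def, map_zsmul]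

theorem weightSum_weightSum (t : ℤ → ℤ → Fib n A) :
    weightSum (fun w => weightSum (t w)) = weightSum fun w => t w w := by
  rw [weightSum_apply, weightSum_apply]
  refine Finset.sum_congr rfl fun p hp => Finset.sum_congr rfl fun q hq => ?_
  simp only [weightSum_apply, map_sum, fibComp_fibComp]
  rw [Finset.sum_eq_single_of_mem p hp, Finset.sum_eq_single_of_mem q hq, if_pos ⟨rfl, rfl⟩]
  · exact fun q' _ hq' => if_neg fun h => hq' h.2.symm
  · exact fun p' _ hp' => Finset.sum_eq_zero fun q' _ => if_neg fun h => hp' h.1.symm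

/-- The weights of a form of parity `k` have the parity of `k`. -/
theorem weightSum_ite_even {k : ℤ} {u : Fib n A}
    (hu : inv.rTensor A.carrier u = k.negOnePow • u) :
    weightSum (fun w => if Even (k - w) then u else 0) = u := by
  have average : (fun w => if Even (k - w) then u else 0) =
      (2⁻¹ : ℂ) • ((fun _ => u) + k.negOnePow • fun w : ℤ => w.negOnePow • u) := by
    funext w
    rw [Pi.smul_apply, Pi.add_apply, Pi.smul_apply, smul_smul, ← Int.negOnePow_sub]
    split_ifs with h
    · rw [Int.negOnePow_even _ h, one_smul, ← two_smul ℂ, inv_smul_smul₀ two_ne_zero]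
    · rw [Int.negOnePow_odd _ (Int.not_even_iff_odd.mp h), Units.neg_smul, one_smul,
        add_neg_cancel, smul_zero]
  rw [average, map_smul, map_add, Units.smul_def, map_zsmul, ← inv_weightSum, weightSum_const, hu,
    ← Units.smul_def, smul_smul, Int.units_mul_self, one_smul, ← two_smul ℂ,
    inv_smul_smul₀ two_ne_zero]

end Bidegree

section SmoothBidegree

variable {A : GradedArtin.{u}} {X : Type*} [TopologicalSpace X] [ChartedSpace (Cn n) X]
  [IsManifold 𝓘(ℂ, Cn n) ω X]

theorem read_fibComp (p q : ℕ) (s : X → Fib n A) (x : X) :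
    read formChange x (fun z => fibComp p q (s z)) =
      fun y => fibComp p q (read formChange x s y) := by
  funext y
  rw [read, read, LinearMap.rTensor, fibComp_map]
  exact fun a => (map_prodMap_comp _ _ p q a).symm

theorem isSmooth_fibComp {s : X → Fib n A} (hs : IsSmooth formChange s) (p q : ℕ) :
    IsSmooth formChange fun z => fibComp p q (s z) := by
  intro x
  simp only [read_fibComp, ← coordMap_apply]
  exact (coordMap (fibComp p q)).contDiff.comp_contDiffOn (hs x)

/-- The component of bidegree `(p,q)` of a smooth form. -/
def smoothComp (p q : ℕ) : smoothForms n X A →ₗ[ℂ] smoothForms n X A where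
  toFun s := ⟨fun z => fibComp p q (s.1 z), isSmooth_fibComp s.2 p q⟩
  map_add' s t := Subtype.ext (funext fun z => map_add (fibComp p q) (s.1 z) (t.1 z))
  map_smul' c s := Subtype.ext (funext fun z => map_smul (fibComp p q) c (s.1 z))

theorem delAt_smoothComp (s : smoothForms n X A) (p q : ℕ) (x : X) :
    delAt x (smoothComp p q s) = fibComp (p + 1) q (delAt x s) := by
  change del (fun z => fibComp p q (s.1 z)) x = fibComp (p + 1) q (del s.1 x)
  simp only [del, read_fibComp, dz_linear (fibComp p q) (s.2.diffAt x), lmul_gen₁_fibComp,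
    map_sum]

theorem delbarAt_smoothComp (s : smoothForms n X A) (p q : ℕ) (x : X) :
    delbarAt x (smoothComp p q s) = fibComp p (q + 1) (delbarAt x s) := by
  change delbar (fun z => fibComp p q (s.1 z)) x = fibComp p (q + 1) (delbar s.1 x)
  simp only [delbar, read_fibComp, dzbar_linear (fibComp p q) (s.2.diffAt x), lmul_gen₂_fibComp,
    map_sum]

theorem fibComp_zero_delAt (q : ℕ) (s : smoothForms n X A) (x : X) :
    fibComp 0 q (delAt x s) = 0 := by
  simp only [delAt_apply, del, map_sum, fibComp_zero_lmul_gen₁, Finset.sum_const_zero]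

theorem fibComp_zero_delbarAt (p : ℕ) (s : smoothForms n X A) (x : X) :
    fibComp p 0 (delbarAt x s) = 0 := by
  simp only [delbarAt_apply, delbar, map_sum, fibComp_zero_lmul_gen₂, Finset.sum_const_zero]

/-- The operation `weightSum` on families of smooth forms. -/
def smoothWeightSum (t : ℤ → smoothForms n X A) : smoothForms n X A :=
  ∑ p ∈ Finset.range (n + 1), ∑ q ∈ Finset.range (n + 1), smoothComp p q (t ((q : ℤ) - p))

theorem smoothWeightSum_coe (t : ℤ → smoothForms n X A) :
    (smoothWeightSum t).1 = fun z => weightSum fun w => (t w).1 z := by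
  funext z
  simp only [smoothWeightSum, Submodule.coe_sum, Finset.sum_apply, weightSum_apply]
  rfl

/-- The weight `q - p` is lowered by `∂` and raised by `∂̄`, hence the shifts here and below. -/
theorem delAt_smoothWeightSum (t : ℤ → smoothForms n X A) (x : X) :
    delAt x (smoothWeightSum t) = weightSum fun w => delAt x (t (w + 1)) := by
  simp only [smoothWeightSum, map_sum, delAt_smoothComp, weightSum_apply]
  have top : ∑ q ∈ Finset.range (n + 1),
      fibComp (n + 1) q (delAt x (t ((q : ℤ) - n))) = 0 :=
    Finset.sum_eq_zero fun q _ => fibComp_eq_zero_of_lt_left n.lt_succ_self q _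
  have bottom : ∑ q ∈ Finset.range (n + 1),
      fibComp 0 q (delAt x (t ((q : ℤ) - (0 : ℕ) + 1))) = 0 :=
    Finset.sum_eq_zero fun q _ => fibComp_zero_delAt q _ x
  rw [Finset.sum_range_succ, top, Finset.sum_range_succ' _ n, bottom]
  congr 1
  refine Finset.sum_congr rfl fun p _ => Finset.sum_congr rfl fun q _ => ?_
  rw [show (q : ℤ) - (p + 1 : ℕ) + 1 = q - p by push_cast; ring]

theorem delbarAt_smoothWeightSum (t : ℤ → smoothForms n X A) (x : X) :
    delbarAt x (smoothWeightSum t) = weightSum fun w => delbarAt x (t (w - 1)) := by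
  simp only [smoothWeightSum, map_sum, delbarAt_smoothComp, weightSum_apply]
  refine Finset.sum_congr rfl fun p _ => ?_
  rw [Finset.sum_range_succ, Finset.sum_range_succ', fibComp_zero_delbarAt,
    fibComp_eq_zero_of_lt_right p n.lt_succ_self]
  congr 1
  refine Finset.sum_congr rfl fun q _ => ?_
  rw [show ((q + 1 : ℕ) : ℤ) - p - 1 = q - p by push_cast; ring]

end SmoothBidegree

section Rescale

variable {X : Type*} {R : ProArtin.{u}}

/-- A series in `ħ` as a series in `ħ^{1/2}`. -/
def toHalf (Φ : Series n X R) : Series n X R := fun j => if Even j then Φ (j / 2) else 0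

theorem toHalf_two_mul (Φ : Series n X R) (m : ℤ) : toHalf Φ (2 * m) = Φ m := by
  rw [toHalf, if_pos (even_two_mul m), Int.mul_ediv_cancel_left m two_ne_zero]

theorem toHalf_add (Φ Ψ : Series n X R) (j : ℤ) : toHalf (Φ + Ψ) j = toHalf Φ j + toHalf Ψ j := by
  simp only [toHalf]
  split_ifs
  · rfl
  · exact (add_zero 0).symm

theorem toHalf_smul (c : ℂ) (Φ : Series n X R) (j : ℤ) : toHalf (c • Φ) j = c • toHalf Φ j := by
  simp only [toHalf]
  split_ifs
  · rfl
  · exact (smul_zero c).symm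

/-- Multiplication by `ħ` on series in integral powers of `ħ`. -/
def hbarMul (Φ : Series n X R) : Series n X R := fun m => Φ (m - 1)

theorem toHalf_hbarMul (Φ : Series n X R) (j : ℤ) : toHalf (hbarMul Φ) (j + 2) = toHalf Φ j := by
  simp only [toHalf, hbarMul, Int.even_add, even_two, iff_true,
    show (j + 2) / 2 - 1 = j / 2 by omega]

theorem negOnePow_smul_toHalf (Φ : Series n X R) (j : ℤ) :
    j.negOnePow • toHalf Φ j = toHalf Φ j := by
  rw [toHalf]
  split_ifs with hj
  · rw [Int.negOnePow_even j hj, one_smul]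
  · rw [smul_zero]

theorem toHalf_derSeries (v : R.Der) (Φ : Series n X R) (j : ℤ) (i : ℕ) (x : X) :
    toHalf (derSeries v Φ) j i x = v.fib i n (toHalf Φ j (v.shift i) x) := by
  simp only [toHalf]
  split_ifs
  · rfl
  · exact (map_zero _).symm

theorem rescale_apply (Φ : Series n X R) (k : ℤ) (i : ℕ) (x : X) :
    rescale Φ k i x = weightSum fun w => toHalf Φ (k - w) i x := by
  rw [rescale, weightSum_apply]
  refine Finset.sum_congr rfl fun p _ => Finset.sum_congr rfl fun q _ => ?_
  rw [toHalf]
  split_ifs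
  · rfl
  · exact (map_zero _).symm

theorem rescale_add (Φ Ψ : Series n X R) : rescale (Φ + Ψ) = rescale Φ + rescale Ψ := by
  funext k i x
  simp only [Pi.add_apply, rescale_apply, toHalf_add, ← map_add]
  rfl

theorem rescale_smul (c : ℂ) (Φ : Series n X R) : rescale (c • Φ) = c • rescale Φ := by
  funext k i x
  simp only [Pi.smul_apply, rescale_apply, toHalf_smul, ← map_smul]
  rfl

theorem hbarInvSeries_rescale_hbarMul (Φ : Series n X R) :
    hbarInvSeries (rescale (hbarMul Φ)) = rescale Φ := by
  funext k i x
  change rescale (hbarMul Φ) (k + 2) i x = rescale Φ k i x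
  simp only [rescale_apply, add_sub_right_comm, toHalf_hbarMul]

/-- The inverse of `l_ħ`. -/
def unrescale (Ψ : Series n X R) : Series n X R := fun m i x =>
  weightSum fun w => Ψ (2 * m + w) i x

theorem unrescale_rescale (Φ : Series n X R) : unrescale (rescale Φ) = Φ := by
  funext m i x
  simp only [unrescale, rescale_apply, weightSum_weightSum, add_sub_cancel_right, toHalf_two_mul,
    weightSum_const]

theorem derSeries_rescale (v : R.Der) (Φ : Series n X R) :
    derSeries v (rescale Φ) = rescale (derSeries v Φ) := by
  funext k i x
  have fib_fibComp (p q : ℕ) (w : Fib n (R.level (v.shift i))) :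
      fibComp p q (v.fib i n w) = v.fib i n (fibComp p q w) := by
    rw [ProArtin.Der.fib, LinearMap.add_apply, LinearMap.add_apply, map_add,
      fibComp_map LinearMap.id _ fun _ => rfl, fibComp_map inv _ (comp_inv p q)]
  change derFam v (rescale Φ k) i x = _
  simp only [derFam_apply, rescale_apply, map_weightSum fib_fibComp, toHalf_derSeries]

theorem IsCompat.weightSum {t : ℤ → Fam n X R} (ht : ∀ w, IsCompat (t w)) :
    IsCompat fun i x => weightSum fun w => t w i x := fun i j h x =>
  (map_weightSum (fun _ _ => fibComp_map LinearMap.id _ fun _ => rfl) _).trans <|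
    congrArg SemiInfinite.weightSum (funext fun w => ht w i j h x)

end Rescale

section RescaleForms

variable {X : Type*} [TopologicalSpace X] [ChartedSpace (Cn n) X] [IsManifold 𝓘(ℂ, Cn n) ω X]
  {R : ProArtin.{u}}

theorem weightSum_mem {t : ℤ → Fam n X R} (ht : t ∈ intSeries n X R) :
    (fun i x => weightSum fun w => t w i x) ∈ forms n X R :=
  ⟨fun i => by
    have smooth := (smoothWeightSum (smoothLevel ht i)).2
    rw [smoothWeightSum_coe] at smooth
    exact smooth, IsCompat.weightSum fun w => (ht w).2⟩

theorem unrescale_mem {Ψ : Series n X R} (hΨ : Ψ ∈ halfSeries n X R) :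
    unrescale Ψ ∈ intSeries n X R :=
  fun _ => weightSum_mem fun _ => hΨ.1 _

theorem rescale_unrescale {Ψ : Series n X R} (hΨ : Ψ ∈ halfSeries n X R) :
    rescale (unrescale Ψ) = Ψ := by
  funext k i x
  have coefficient (w : ℤ) : toHalf (unrescale Ψ) (k - w) i x =
      weightSum fun w' => if Even (k - w) then Ψ (k - w + w') i x else 0 := by
    rw [toHalf]
    split_ifs with h
    · rw [unrescale, Int.two_mul_ediv_two_of_even h]
    · exact (map_zero weightSum).symm
  simp only [rescale_apply, coefficient, weightSum_weightSum, sub_add_cancel]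
  exact weightSum_ite_even (hΨ.2 k i x)

theorem toHalf_mem {Φ : Series n X R} (hΦ : Φ ∈ intSeries n X R) :
    toHalf Φ ∈ intSeries n X R := by
  intro j
  rw [toHalf]
  split_ifs
  · exact hΦ _
  · exact zero_mem _

theorem rescale_mem {Φ : Series n X R} (hΦ : Φ ∈ intSeries n X R) :
    rescale Φ ∈ halfSeries n X R := by
  refine ⟨fun k => ?_, fun k i x => ?_⟩
  · have coefficient : rescale Φ k = fun i x => weightSum fun w => toHalf Φ (k - w) i x :=
      funext fun i => funext (rescale_apply Φ k i)
    rw [coefficient]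
    exact weightSum_mem fun w => toHalf_mem hΦ (k - w)
  · have sign (w : ℤ) : w.negOnePow • toHalf Φ (k - w) i x =
        k.negOnePow • toHalf Φ (k - w) i x := by
      have even := congrFun (congrFun (negOnePow_smul_toHalf Φ (k - w)) i) x
      nth_rw 1 [← even]
      rw [Pi.smul_apply, Pi.smul_apply, smul_smul, ← Int.negOnePow_add, add_sub_cancel]
    simp only [rescale_apply, inv_weightSum, sign]
    exact map_zsmul weightSum _ _

theorem toHalf_dInt (Φ : Series n X R) (j : ℤ) (i : ℕ) (x : X) :
    toHalf (dInt Φ) j i x = delbar (toHalf Φ j i) x + del (toHalf Φ (j - 2) i) x := by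
  have even_sub_two : Even (j - 2) ↔ Even j := by simp
  simp only [toHalf, even_sub_two]
  split_ifs
  · rw [dInt, show (j - 2) / 2 = j / 2 - 1 by omega]
  · have delbar_zero : delbar (0 : X → Fib n (R.level i)) x = 0 := map_zero (delbarAt x)
    have del_zero : del (0 : X → Fib n (R.level i)) x = 0 := map_zero (delAt x)
    exact ((congrArg₂ (· + ·) delbar_zero del_zero).trans (add_zero 0)).symm

theorem rescale_dInt {Φ : Series n X R} (hΦ : Φ ∈ intSeries n X R) :
    rescale (dInt Φ) = dHalf (rescale Φ) := by
  funext k i x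
  let t (w : ℤ) : smoothForms n X (R.level i) := smoothLevel (toHalf_mem hΦ) i (k - 1 - w)
  have level : rescale Φ (k - 1) i = (smoothWeightSum t).1 := by
    rw [smoothWeightSum_coe]
    exact funext (rescale_apply Φ (k - 1) i)
  rw [dHalf, level, ← delAt_apply, ← delbarAt_apply, delAt_smoothWeightSum,
    delbarAt_smoothWeightSum, ← map_add, rescale_apply]
  refine congrArg weightSum (funext fun w => ?_)
  rw [toHalf_dInt, show k - w = k - 1 - (w - 1) by ring,
    show k - 1 - (w - 1) - 2 = k - 1 - (w + 1) by ring]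
  rfl

end RescaleForms

/-! ### Parallel transport and transversality -/

section Transport

variable {X : Type*} [TopologicalSpace X] [ChartedSpace (Cn n) X]
  [IsManifold 𝓘(ℂ, Cn n) ω X] {R : ProArtin.{u}}

theorem transportSeries_apply (γ : MC n X R) (Φ : Series n X R) :
    transportSeries γ Φ = rescale (expFam γ.val Φ) := by
  rw [transportSeries, expContr_eq_expFam]

/-- The operator `l_ħ exp(ħ⁻¹ i_γ)` as a linear map. -/
def transportLin (γ : MC n X R) : Series n X R →ₗ[ℂ] Series n X R where
  toFun := transportSeries γ
  map_add' Φ Ψ := by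
    simp only [transportSeries_apply, map_add, rescale_add]
  map_smul' c Φ := by
    simp only [transportSeries_apply, map_smul, rescale_smul, RingHom.id_apply]

theorem transportSeries_injective (γ : MC n X R) : Function.Injective (transportSeries γ) :=
  Function.LeftInverse.injective (g := fun Ψ => expFam (-γ.val) (unrescale Ψ)) fun Φ => by
    simp only [transportSeries_apply, unrescale_rescale, γ.isPolyField.expFam_neg_expFam]

theorem transportSeries_mem_half (γ : MC n X R) {Φ : Series n X R} (hΦ : Φ ∈ intSeries n X R) :
    transportSeries γ Φ ∈ halfSeries n X R := by
  rw [transportSeries_apply]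
  exact rescale_mem (γ.isPolyField.expFam_mem hΦ)

theorem exists_transportSeries_eq (γ : MC n X R) {Ψ : Series n X R}
    (hΨ : Ψ ∈ halfSeries n X R) : ∃ Φ ∈ intSeries n X R, transportSeries γ Φ = Ψ :=
  ⟨expFam (-γ.val) (unrescale Ψ), γ.isPolyField.neg.expFam_mem (unrescale_mem hΨ), by
    rw [transportSeries_apply, γ.isPolyField.expFam_expFam_neg, rescale_unrescale hΨ]⟩

theorem transportSeries_dTwist (γ : MC n X R) {Φ : Series n X R} (hΦ : Φ ∈ intSeries n X R) :
    transportSeries γ (dTwist γ.val Φ) = dHalf (transportSeries γ Φ) := by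
  rw [transportSeries_apply, transportSeries_apply, ← dInt_expFam γ hΦ,
    rescale_dInt (γ.isPolyField.expFam_mem hΦ)]

theorem transportSeries_nabla (γ : MC n X R) (v : R.Der) {Φ : Series n X R}
    (hΦ : Φ ∈ intSeries n X R) :
    transportSeries γ (nablaSeries γ v Φ) = derSeries v (transportSeries γ Φ) := by
  rw [transportSeries_apply, transportSeries_apply, derSeries_rescale, derSeries_expFam γ v hΦ]

theorem transportSeries_mem_iff (γ : MC n X R) {Φ : Series n X R} (hΦ : Φ ∈ intSeries n X R) :
    transportSeries γ Φ ∈ dRCocycles n X R ↔ Φ ∈ gmCocycles γ := by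
  refine ⟨fun h => ⟨hΦ, transportSeries_injective γ ?_⟩,
    fun h => ⟨transportSeries_mem_half γ hΦ, ?_⟩⟩
  · rw [transportSeries_dTwist γ hΦ, h.2]
    exact (map_zero (transportLin γ)).symm
  · rw [← transportSeries_dTwist γ hΦ, h.2]
    exact map_zero (transportLin γ)

theorem transportSeries_mem (γ : MC n X R) {Φ : Series n X R} (hΦ : Φ ∈ gmCocycles γ) :
    transportSeries γ Φ ∈ dRCocycles n X R :=
  (transportSeries_mem_iff γ hΦ.1).mpr hΦ

/-- `l_ħ exp(ħ⁻¹ i_γ)` as an isomorphism of cocycles. -/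
def cocycleEquiv (γ : MC n X R) : gmCocycles γ ≃ₗ[ℂ] dRCocycles n X R :=
  LinearEquiv.ofBijective
    ((transportLin γ).restrict (p := gmCocycles γ) (q := dRCocycles n X R)
      fun _ h => transportSeries_mem γ h)
    ⟨fun _ _ h => Subtype.ext (transportSeries_injective γ (congrArg Subtype.val h)),
      fun ⟨_, hΨ⟩ => by
        obtain ⟨Φ, hΦ, rfl⟩ := exists_transportSeries_eq γ hΨ.1
        exact ⟨⟨Φ, (transportSeries_mem_iff γ hΦ).mp hΨ⟩, rfl⟩⟩

theorem map_cocycleEquiv (γ : MC n X R) :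
    ((gmCoboundaries γ).comap (gmCocycles γ).subtype).map (cocycleEquiv γ).toLinearMap =
      (dRCoboundaries n X R).comap (dRCocycles n X R).subtype := by
  apply le_antisymm
  · rintro _ ⟨⟨_, h⟩, ⟨η, hη, rfl⟩, rfl⟩
    exact ⟨transportSeries γ η, transportSeries_mem_half γ hη,
      (transportSeries_dTwist γ hη).symm⟩
  · rintro ⟨_, h⟩ ⟨θ, hθ, rfl⟩
    obtain ⟨η, hη, rfl⟩ := exists_transportSeries_eq γ hθ
    obtain ⟨⟨Φ, hΦ⟩, e⟩ := (cocycleEquiv γ).surjective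
      ⟨(dRCocycles n X R).subtype ⟨_, h⟩, h⟩
    refine ⟨⟨Φ, hΦ⟩, ⟨η, hη, transportSeries_injective γ ?_⟩, e⟩
    rw [transportSeries_dTwist γ hη]
    exact (congrArg Subtype.val e).symm

/-- The isomorphism `P_γ` of the fibre of the Gauss–Manin local system with
`H^*(X,ℂ)[[ħ⁻¹,ħ]] ⊗̂ R`. -/
def transportEquiv (γ : MC n X R) : gmFibre γ ≃ₗ[ℂ] dRCohomology n X R :=
  Submodule.Quotient.equiv _ _ (cocycleEquiv γ) (map_cocycleEquiv γ)

theorem transportEquiv_gmClass (γ : MC n X R) {Φ : Series n X R} (h : Φ ∈ gmCocycles γ) :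
    transportEquiv γ (gmClass γ Φ h) =
      dRClass (transportSeries γ Φ) (transportSeries_mem γ h) := rfl

theorem nablaSeries_mem_gmCocycles (γ : MC n X R) (v : R.Der) {Φ : Series n X R}
    (h : Φ ∈ gmCocycles γ) : nablaSeries γ v Φ ∈ gmCocycles γ := by
  rw [← transportSeries_mem_iff γ (nablaSeries_mem γ v h.1), transportSeries_nabla γ v h.1]
  exact derSeries_mem v (transportSeries_mem γ h)

theorem transportEquiv_gmClass_nabla (γ : MC n X R) (v : R.Der) {Φ : Series n X R}
    (h : Φ ∈ gmCocycles γ) :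
    transportEquiv γ (gmClass γ (nablaSeries γ v Φ) (nablaSeries_mem_gmCocycles γ v h)) =
      dRDer v (transportEquiv γ (gmClass γ Φ h)) :=
  congrArg Submodule.Quotient.mk (Subtype.ext (transportSeries_nabla γ v h.1))

/-- The Gauss–Manin connection on the fibre over `γ`, defined by transporting `∂_v` along
`P_γ`. -/
def nablaFibre (γ : MC n X R) (v : R.Der) : gmFibre γ →ₗ[ℂ] gmFibre γ :=
  (transportEquiv γ).symm.toLinearMap ∘ₗ dRDer v ∘ₗ (transportEquiv γ).toLinearMap

theorem transportEquiv_nablaFibre (γ : MC n X R) (v : R.Der) (x : gmFibre γ) :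
    transportEquiv γ (nablaFibre γ v x) = dRDer v (transportEquiv γ x) :=
  (transportEquiv γ).apply_symm_apply _

theorem nablaFibre_gmClass (γ : MC n X R) (v : R.Der) {Φ : Series n X R}
    (h : Φ ∈ gmCocycles γ) :
    nablaFibre γ v (gmClass γ Φ h) =
      gmClass γ (nablaSeries γ v Φ) (nablaSeries_mem_gmCocycles γ v h) :=
  (transportEquiv γ).injective <| by
    rw [transportEquiv_nablaFibre, transportEquiv_gmClass_nabla]

theorem expContr_hbarMul (γ : MC n X R) (Φ : Series n X R) :
    expContr γ (hbarMul Φ) = hbarMul (expContr γ Φ) := by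
  funext m i x
  simp only [expContr, hbarMul, sub_add_eq_add_sub]

theorem hbarInvSeries_transportSeries_hbarMul (γ : MC n X R) (Φ : Series n X R) :
    hbarInvSeries (transportSeries γ (hbarMul Φ)) = transportSeries γ Φ := by
  rw [transportSeries, expContr_hbarMul, hbarInvSeries_rescale_hbarMul, transportSeries]

theorem hbarMul_mem_gmCocycles (γ : MC n X R) {Φ : Series n X R} (h : Φ ∈ gmCocycles γ) :
    hbarMul Φ ∈ gmCocycles γ :=
  ⟨fun m => h.1 (m - 1), funext fun m => congrFun h.2 (m - 1)⟩

theorem hbarMul_nablaSeries_eq_zero (γ : MC n X R) (v : R.Der) {Φ : Series n X R}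
    (hΦ : ∀ m < 0, Φ m = 0) {m : ℤ} (hm : m < 0) : hbarMul (nablaSeries γ v Φ) m = 0 := by
  funext i x
  change derFam v (Φ (m - 1)) i x + contrFam (derFam v γ.val) (Φ (m - 1 + 1)) i x = 0
  rw [hΦ (m - 1) (by omega), hΦ (m - 1 + 1) (by omega), derFam_apply, contrFam]
  simp only [Pi.zero_apply, map_zero, add_zero]

theorem dRDer_semiInfOf (γ : MC n X R) (v : R.Der) {c : dRCohomology n X R}
    (hc : c ∈ semiInfOf γ) : dRDer v c ∈ hbarInv '' semiInfOf γ := by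
  obtain ⟨Φ, hΦ, h, rfl⟩ := hc
  have cocycle : Φ ∈ gmCocycles γ := (transportSeries_mem_iff γ hΦ.1).mp h
  have cocycle_nabla := hbarMul_mem_gmCocycles γ (nablaSeries_mem_gmCocycles γ v cocycle)
  have transport_nabla : hbarInvSeries (transportSeries γ (hbarMul (nablaSeries γ v Φ))) =
      derSeries v (transportSeries γ Φ) := by
    rw [hbarInvSeries_transportSeries_hbarMul, transportSeries_nabla γ v hΦ.1]
  exact ⟨dRClass _ (transportSeries_mem γ cocycle_nabla),
    ⟨hbarMul (nablaSeries γ v Φ),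
      ⟨cocycle_nabla.1, fun m hm => hbarMul_nablaSeries_eq_zero γ v hΦ.2 hm⟩, _, rfl⟩,
    congrArg Submodule.Quotient.mk (Subtype.ext transport_nabla)⟩

end Transport

end SemiInfinite

end

theorem mainTheorem2 {n : ℕ} {X : Type*} [TopologicalSpace X] [ChartedSpace (Cn n) X]
    [IsManifold 𝓘(ℂ, Cn n) ω X] (R : ProArtin) (φ : Moduli n X R) (v : R.Der) :
    (∀ γ : MC n X R, γ.point = φ →
      ∃ (P : gmFibre γ ≃ₗ[ℂ] dRCohomology n X R) (nabla : gmFibre γ →ₗ[ℂ] gmFibre γ),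
        (∀ (Φ : Series n X R) (h : Φ ∈ gmCocycles γ),
          ∃ h' : transportSeries γ Φ ∈ dRCocycles n X R,
            P (gmClass γ Φ h) = dRClass (transportSeries γ Φ) h') ∧
        (∀ (Φ : Series n X R) (h : Φ ∈ gmCocycles γ),
          ∃ h' : nablaSeries γ v Φ ∈ gmCocycles γ,
            nabla (gmClass γ Φ h) = gmClass γ (nablaSeries γ v Φ) h') ∧
        (∀ x : gmFibre γ, P (nabla x) = dRDer v (P x)) ∧
        (∀ x : gmFibre γ, P x ∈ semiInfOf γ → P (nabla x) ∈ hbarInv '' semiInfOf γ)) ∧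
    dRDer v '' semiInf φ ⊆ hbarInv '' semiInf φ := by
  refine ⟨fun γ _ => ⟨transportEquiv γ, nablaFibre γ v, fun Φ h => ⟨_, transportEquiv_gmClass γ h⟩,
    fun Φ h => ⟨_, nablaFibre_gmClass γ v h⟩, transportEquiv_nablaFibre γ v, fun x hx => ?_⟩, ?_⟩
  · rw [transportEquiv_nablaFibre]
    exact dRDer_semiInfOf γ v hx
  · rintro _ ⟨c, ⟨γ, hγ, hc⟩, rfl⟩
    obtain ⟨c', hc', e⟩ := dRDer_semiInfOf γ v hc
    exact ⟨c', ⟨γ, hγ, hc'⟩, e⟩
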